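/- **Setting.** Let $n=n_1+n_2-1$ and let $X_\star\in\mathbb C^{s\times n}$. Its Hankel lifting is the tensor $Z_\star=\mathcal H(X_\star)\in\mathbb C^{n_1\times n_2\times s}$, $[\mathcal H(X)](i_1,i_2,j)=X(j,i_1+i_2)$ (indices start at $0$). Let $w_a$ be the length of the $a$-th skew-diagonal of an $n_1\times n_2$ matrix, let $\mathcal D$ multiply the $a$-th column of an $s\times n$ matrix by $\sqrt{w_a}$, and put $\mathcal G=\mathcal H\mathcal D^{-1}$, $Y_\star=\mathcal D(X_\star)$. For a tensor $Z$ let $\mathcal M_1(Z),\mathcal M_2(Z),\mathcal M_3(Z)$ be its matricizations; $\sigma_{\max}(Z)$ is the largest of their largest singular values, $\sigma_{\min}(Z)$ the smallest of their smallest nonzero singular values, and $(A,B,C)\cdot S=S\times_1A\times_2B\times_3C$. Assume that $Z_\star$ has multilinear rank $(r,r,r)$ with $r\ge1$, and put $\kappa=\sigma_{\max}(Z_\star)/\sigma_{\min}(Z_\star)$ and $c_s=\max\{n/n_1,n/n_2\}$. Assume that $Z_\star$ is $\mu_0$-incoherent: $Z_\star=(L_\star,R_\star,V_\star)\cdot S_\star$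 with $L_\star\in\mathbb C^{n_1\times r}$, $R_\star\in\mathbb C^{n_2\times r}$, $V_\star\in\mathbb C^{s\times r}$ column-orthonormal and all rows of $L_\star$ and of $R_\star$ of Euclidean norm at most $\sqrt{\mu_0c_sr/n}$. **Sampling.** The $m=(K+1)\hat m$ observed positions are drawn independently and uniformly, with replacement, from $[s]\times[n]$ and are split into $K+1$ batches $\Omega_0,\dots,\Omega_K$ of $\hat m$ positions each; $\hat p=\hat m/(sn)$, and $\mathcal P_\Omega(X)=\sum_{(j,a)\in\Omega}X(j,a)e_je_a^T$, repeated positions being counted with multiplicity. **Algorithm ScalHT.** For $F=(L,R,V,S)$ with $L\in\mathbb C^{n_1\times r}$, $R\in\mathbb C^{n_2\times r}$, $V\in\mathbb C^{s\times r}$, $S\in\mathbb C^{r\times r\times r}$ put $\breve L=(\overline V\otimes\overline R)\mathcal M_1(S)^H$, $\breve R=(\overline V\otimes\overline L)\mathcal M_2(S)^H$, $\breve V=(\overline R\otimes\overline L)\mathcal M_3(S)^H$. The projection with radius $B$, applied to $(L',R',V,S)$, leaves $V,S$ unchanged and multiplies each row $L'(i,:)$ by $\min\{1,B/(\sqrt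 n\,\|L'(i,:)\breve L'^H\|_2)\}$ and each row $R'(i,:)$ by $\min\{1,B/(\sqrt n\,\|R'(i,:)\breve R'^H\|_2)\}$, where $\breve L',\breve R'$ are formed from $(L',R',V,S)$ and the minimum is $1$ if the denominator is $0$. Let $\mathrm{SVD}_r$ be any fixed routine that returns top-$r$ left singular vectors of a matrix. *Initialization:* $Z^0=\hat p^{-1}\mathcal G\mathcal P_{\Omega_0}(Y_\star)$, $L'^0=\mathrm{SVD}_r(\mathcal M_1(Z^0))$, $R'^0=\mathrm{SVD}_r(\mathcal M_2(Z^0))$, $V^0=\mathrm{SVD}_r(\mathcal M_3(Z^0\times_1(L'^0)^H))$, $S^0=((L'^0)^H,(R'^0)^H,(V^0)^H)\cdot Z^0$, and $F^0$ is the projection of $(L'^0,R'^0,V^0,S^0)$. *Step* $k=0,\dots,K-1$, with $F=F^k$, $Z=(L,R,V)\cdot S$ and $E=\hat p^{-1}\mathcal G\mathcal P_{\Omega_{k+1}}(\mathcal G^*Z-Y_\star)+(\mathcal I-\mathcal G\mathcal G^*)Z$: $$L'=L-\eta\,\mathcal M_1(E)\breve L(\breve L^H\breve L)^{-1},\quad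 R'=R-\eta\,\mathcal M_2(E)\breve R(\breve R^H\breve R)^{-1},\quad V^{k+1}=V-\eta\,\mathcal M_3(E)\breve V(\breve V^H\breve V)^{-1},$$ $$S^{k+1}=S-\eta\,\big((L^HL)^{-1},(R^HR)^{-1},(V^HV)^{-1}\big)\cdot\big((L^H,R^H,V^H)\cdot E\big),$$ and $F^{k+1}$ is the projection of $(L',R',V^{k+1},S^{k+1})$. The estimates are $X^k=\mathcal D^{-1}\mathcal G^*\big((L^k,R^k,V^k)\cdot S^k\big)$. **Theorem.** There are absolute constants $\varepsilon_{\max},c>0$ and, for every $C_B$, a constant $C>0$ that depends only on $C_B$, such that the following holds for all $n_1,n_2,s,r,K,\hat m$, $X_\star$ and $\mu_0$ as above, every routine $\mathrm{SVD}_r$, every $0<\varepsilon_0\le\varepsilon_{\max}$ with $(1+\varepsilon_0)^3\le C_B$ and every step size $0<\eta\le0.4$. Let the projection radius be $B=C_B\sqrt{\mu_0c_sr}\,\sigma_{\max}(Z_\star)$. If $$m\ \ge\ C\,(K+1)\,\varepsilon_0^{-2}\mu_0c_s\,s\,r^3\kappa^2\log\big((K+1)sn\big),$$ then with probability at least $1-c\,(sn)^{-2}$,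 $$\|X^k-X_\star\|_F\le3\varepsilon_0(1-0.5\eta)^k\sigma_{\min}(Z_\star)\qquad\text{for all }k=0,\dots,K.$$ -/

import Mathlib

open scoped Matrix Kronecker
open MeasureTheory ProbabilityTheory

noncomputable section

/-! ### Matrices: norms, singular values, top left singular vectors -/

/-- The Frobenius norm of a complex matrix. -/
def frobNorm {ι κ : Type*} [Fintype ι] [Fintype κ] (M : Matrix ι κ ℂ) : ℝ :=
  √(∑ i, ∑ j, ‖M i j‖ ^ 2)

/-- The Euclidean norm of the `i`-th row of a complex matrix. -/
def rowNorm {ι κ : Type*} [Fintype κ] (M : Matrix ι κ ℂ) (i : ι) : ℝ :=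
  √(∑ j, ‖M i j‖ ^ 2)

/-- The `k`-th singular value of `M` (numbering from `0`, in decreasing order, padded by `0`). -/
def singVal {ι κ : Type*} [Fintype ι] [Fintype κ] [DecidableEq κ] (M : Matrix ι κ ℂ) (k : ℕ) : ℝ :=
  (Matrix.toEuclideanLin M).singularValues k

/-- The largest singular value of a matrix. -/
def matSigmaMax {ι κ : Type*} [Fintype ι] [Fintype κ] [DecidableEq κ] (M : Matrix ι κ ℂ) : ℝ :=
  singVal M 0

/-- The smallest nonzero singular value of a matrix, i.e. the `ρ`-th largest one, where `ρ` is its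
rank. -/
def matSigmaMin {ι κ : Type*} [Fintype ι] [Fintype κ] [DecidableEq κ] (M : Matrix ι κ ℂ) : ℝ :=
  singVal M (M.rank - 1)

/-- The columns of `U` are top-`r` left singular vectors of `M`: they are orthonormal, and the
`j`-th column is a left singular vector for the `j`-th largest singular value. -/
def IsTopLeftSingular {ι κ : Type*} [Fintype ι] [Fintype κ] [DecidableEq κ] {r : ℕ}
    (U : Matrix ι (Fin r) ℂ) (M : Matrix ι κ ℂ) : Prop :=
  Uᴴ * U = 1 ∧
    M * Mᴴ * U = U * Matrix.diagonal (fun j : Fin r => (((singVal M j) ^ 2 : ℝ) : ℂ))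

/-- A routine `SVD_r` that returns, for every matrix with at least `r` rows, top-`r` left singular
vectors of it (these are not unique, so there are many such routines). -/
structure SVDRoutine (r : ℕ) where
  /-- the matrix returned -/
  top : {a : ℕ} → {κ : Type} → [Fintype κ] → [DecidableEq κ] →
    Matrix (Fin a) κ ℂ → Matrix (Fin a) (Fin r) ℂ
  /-- it consists of top-`r` left singular vectors -/
  isTop : ∀ {a : ℕ} {κ : Type} [Fintype κ] [DecidableEq κ] (M : Matrix (Fin a) κ ℂ),
    r ≤ a → IsTopLeftSingular (top M) M

/-! ### Third-order tensors -/

/-- Complex tensors of size `a × b × c`. -/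
abbrev Tensor (a b c : ℕ) : Type := Fin a → Fin b → Fin c → ℂ

/-- Mode-1 matricization; the column index `(i₃, i₂)` stands for `i₂ + i₃ b`. -/
def unfold1 {a b c : ℕ} (Z : Tensor a b c) : Matrix (Fin a) (Fin c × Fin b) ℂ :=
  Matrix.of fun i q => Z i q.2 q.1

/-- Mode-2 matricization; the column index is `(i₃, i₁)`. -/
def unfold2 {a b c : ℕ} (Z : Tensor a b c) : Matrix (Fin b) (Fin c × Fin a) ℂ :=
  Matrix.of fun i q => Z q.2 i q.1

/-- Mode-3 matricization; the column index is `(i₂, i₁)`. -/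
def unfold3 {a b c : ℕ} (Z : Tensor a b c) : Matrix (Fin c) (Fin b × Fin a) ℂ :=
  Matrix.of fun i q => Z q.2 q.1 i

/-- The multilinear rank. -/
def mulRank {a b c : ℕ} (Z : Tensor a b c) : ℕ × ℕ × ℕ :=
  ((unfold1 Z).rank, (unfold2 Z).rank, (unfold3 Z).rank)

/-- `σ_max` of a tensor: the largest one among its three matricizations. -/
def sigmaMax {a b c : ℕ} (Z : Tensor a b c) : ℝ :=
  max (matSigmaMax (unfold1 Z)) (max (matSigmaMax (unfold2 Z)) (matSigmaMax (unfold3 Z)))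

/-- `σ_min` of a tensor: the smallest one among its three matricizations. -/
def sigmaMin {a b c : ℕ} (Z : Tensor a b c) : ℝ :=
  min (matSigmaMin (unfold1 Z)) (min (matSigmaMin (unfold2 Z)) (matSigmaMin (unfold3 Z)))

/-- The condition number of a tensor. -/
def condNumber {a b c : ℕ} (Z : Tensor a b c) : ℝ := sigmaMax Z / sigmaMin Z

/-- The multilinear product `(A, B, C) • S = S ×₁ A ×₂ B ×₃ C`. -/
def tucker {a b c p q t : ℕ} (A : Matrix (Fin a) (Fin p) ℂ) (B : Matrix (Fin b) (Fin q) ℂ)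
    (C : Matrix (Fin c) (Fin t) ℂ) (S : Tensor p q t) : Tensor a b c :=
  fun i₁ i₂ i₃ => ∑ j₁, ∑ j₂, ∑ j₃, A i₁ j₁ * B i₂ j₂ * C i₃ j₃ * S j₁ j₂ j₃

/-! ### Hankel lifting of `s × n` matrices, `n = n₁ + n₂ - 1` -/

/-- The Hankel lifting `[H X](i₁, i₂, j) = X(j, i₁ + i₂)`. -/
def hankel {n₁ n₂ s : ℕ} (X : Matrix (Fin s) (Fin (n₁ + n₂ - 1)) ℂ) : Tensor n₁ n₂ s :=
  fun i₁ i₂ j => X j ⟨i₁.val + i₂.val, by have := i₁.isLt; have := i₂.isLt; omega⟩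

/-- `w_a`: the length of the `a`-th skew-diagonal of an `n₁ × n₂` matrix. -/
def skewLen (n₁ n₂ a : ℕ) : ℕ :=
  (Finset.univ.filter fun q : Fin n₁ × Fin n₂ => q.1.val + q.2.val = a).card

/-- The reweighting `D`: the `a`-th column is multiplied by `√w_a`. -/
def reweight (n₁ n₂ : ℕ) {s : ℕ} (X : Matrix (Fin s) (Fin (n₁ + n₂ - 1)) ℂ) :
    Matrix (Fin s) (Fin (n₁ + n₂ - 1)) ℂ :=
  Matrix.of fun j a => ((√(skewLen n₁ n₂ a) : ℝ) : ℂ) * X j a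

/-- The inverse `D⁻¹` of the reweighting. -/
def unweight (n₁ n₂ : ℕ) {s : ℕ} (X : Matrix (Fin s) (Fin (n₁ + n₂ - 1)) ℂ) :
    Matrix (Fin s) (Fin (n₁ + n₂ - 1)) ℂ :=
  Matrix.of fun j a => (((√(skewLen n₁ n₂ a))⁻¹ : ℝ) : ℂ) * X j a

/-- `G = H D⁻¹`. -/
def liftG {n₁ n₂ s : ℕ} (X : Matrix (Fin s) (Fin (n₁ + n₂ - 1)) ℂ) : Tensor n₁ n₂ s :=
  hankel (unweight n₁ n₂ X)

/-- The adjoint `G*`: sums over skew-diagonals, divided by `√w_a`. -/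
def adjG {n₁ n₂ s : ℕ} (Z : Tensor n₁ n₂ s) : Matrix (Fin s) (Fin (n₁ + n₂ - 1)) ℂ :=
  Matrix.of fun j a => (((√(skewLen n₁ n₂ a))⁻¹ : ℝ) : ℂ) *
    ∑ i₁ : Fin n₁, ∑ i₂ : Fin n₂, if i₁.val + i₂.val = a.val then Z i₁ i₂ j else 0

/-! ### Incoherence -/

/-- `c_s = max {n / n₁, n / n₂}` with `n = n₁ + n₂ - 1`. -/
def cSym (n₁ n₂ : ℕ) : ℝ :=
  max (((n₁ + n₂ - 1 : ℕ) : ℝ) / n₁) (((n₁ + n₂ - 1 : ℕ) : ℝ) / n₂)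

/-- `μ₀`-incoherence: `Z = (L, R, V) • S` with column-orthonormal factors having `r` columns such
that the rows of `L` and of `R` have norm at most `√(μ₀ c_s r / n)`. If `Z` has multilinear rank
`(r, r, r)`, then `L` and `R` are unique up to a unitary `r × r` matrix on the right, so that the
row norms do not depend on the decomposition. -/
def IsIncoherent {n₁ n₂ s : ℕ} (μ₀ : ℝ) (r : ℕ) (Z : Tensor n₁ n₂ s) : Prop :=
  ∃ (L : Matrix (Fin n₁) (Fin r) ℂ) (R : Matrix (Fin n₂) (Fin r) ℂ)
    (V : Matrix (Fin s) (Fin r) ℂ) (S : Tensor r r r),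
    Lᴴ * L = 1 ∧ Rᴴ * R = 1 ∧ Vᴴ * V = 1 ∧ Z = tucker L R V S ∧
    (∀ i, rowNorm L i ≤ √(μ₀ * cSym n₁ n₂ * r / ((n₁ + n₂ - 1 : ℕ) : ℝ))) ∧
    (∀ i, rowNorm R i ≤ √(μ₀ * cSym n₁ n₂ * r / ((n₁ + n₂ - 1 : ℕ) : ℝ)))

/-! ### Sampling with replacement -/

/-- `P_Ω(X)` for a list `Ω` of `m` observed positions, counted with multiplicity. -/
def sampleOp {s n m : ℕ} (Ω : Fin m → Fin s × Fin n) (X : Matrix (Fin s) (Fin n) ℂ) :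
    Matrix (Fin s) (Fin n) ℂ :=
  Matrix.of fun j a => ∑ i, if Ω i = (j, a) then X j a else 0

/-- The law of `K + 1` batches `Ω₀, …, Ω_K` of `m` positions each, all positions being drawn
independently and uniformly from `[s] × [n]`. -/
def sampleLaw (s n m K : ℕ) : Measure (Fin (K + 1) → Fin m → Fin s × Fin n) :=
  Measure.pi fun _ => Measure.pi fun _ => uniformOn Set.univ

/-! ### The algorithm -/

/-- A factor quadruple `(L, R, V, S)`. -/
structure Factors (n₁ n₂ s r : ℕ) where
  /-- first factor -/
  L : Matrix (Fin n₁) (Fin r) ℂ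
  /-- second factor -/
  R : Matrix (Fin n₂) (Fin r) ℂ
  /-- third factor -/
  V : Matrix (Fin s) (Fin r) ℂ
  /-- core tensor -/
  S : Tensor r r r

namespace Factors

variable {n₁ n₂ s r m : ℕ}

/-- The tensor `(L, R, V) • S`. -/
def toTensor (F : Factors n₁ n₂ s r) : Tensor n₁ n₂ s := tucker F.L F.R F.V F.S

/-- `L̆ = (V̄ ⊗ R̄) M₁(S)ᴴ`. -/
def breveL (F : Factors n₁ n₂ s r) : Matrix (Fin s × Fin n₂) (Fin r) ℂ :=
  (F.V.map star ⊗ₖ F.R.map star) * (unfold1 F.S)ᴴ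

/-- `R̆ = (V̄ ⊗ L̄) M₂(S)ᴴ`. -/
def breveR (F : Factors n₁ n₂ s r) : Matrix (Fin s × Fin n₁) (Fin r) ℂ :=
  (F.V.map star ⊗ₖ F.L.map star) * (unfold2 F.S)ᴴ

/-- `V̆ = (R̄ ⊗ L̄) M₃(S)ᴴ`. -/
def breveV (F : Factors n₁ n₂ s r) : Matrix (Fin n₂ × Fin n₁) (Fin r) ℂ :=
  (F.R.map star ⊗ₖ F.L.map star) * (unfold3 F.S)ᴴ

/-- The estimate `D⁻¹ G* ((L, R, V) • S)` of the signal matrix. -/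
def estimate (F : Factors n₁ n₂ s r) : Matrix (Fin s) (Fin (n₁ + n₂ - 1)) ℂ :=
  unweight n₁ n₂ (adjG F.toTensor)

/-- The number `min {1, B / (√n t)}`, equal to `1` for `t = 0`. -/
def shrink (B : ℝ) (n : ℕ) (t : ℝ) : ℝ :=
  if √(n : ℝ) * t = 0 then 1 else min 1 (B / (√(n : ℝ) * t))

/-- The scaled projection of `L` and `R` with radius `B`: the `i`-th row of `L` is multiplied by
`min {1, B / (√n ‖L(i,:) L̆ᴴ‖)}`, similarly for `R`; `V` and `S` are unchanged. -/
def project (B : ℝ) (F : Factors n₁ n₂ s r) : Factors n₁ n₂ s r where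
  L := Matrix.of fun i j =>
    (shrink B (n₁ + n₂ - 1) (rowNorm (F.L * F.breveLᴴ) i) : ℂ) * F.L i j
  R := Matrix.of fun i j =>
    (shrink B (n₁ + n₂ - 1) (rowNorm (F.R * F.breveRᴴ) i) : ℂ) * F.R i j
  V := F.V
  S := F.S

/-- The gradient of the loss with respect to the tensor `Z = (L, R, V) • S`:
`p⁻¹ G P_Ω (G* Z - Y) + (I - G G*) Z`, where `Y = D X` and `p = m / (s n)`. -/
def gradTensor (X : Matrix (Fin s) (Fin (n₁ + n₂ - 1)) ℂ)
    (Ω : Fin m → Fin s × Fin (n₁ + n₂ - 1)) (F : Factors n₁ n₂ s r) : Tensor n₁ n₂ s :=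
  ((((m : ℝ) / (s * (n₁ + n₂ - 1 : ℕ)))⁻¹ : ℝ) : ℂ) •
      liftG (sampleOp Ω (adjG F.toTensor - reweight n₁ n₂ X)) +
    (F.toTensor - liftG (adjG F.toTensor))

/-- One scaled gradient step with step size `η`, before the projection. -/
def gradStep (X : Matrix (Fin s) (Fin (n₁ + n₂ - 1)) ℂ) (η : ℝ)
    (Ω : Fin m → Fin s × Fin (n₁ + n₂ - 1)) (F : Factors n₁ n₂ s r) : Factors n₁ n₂ s r where
  L := F.L - (η : ℂ) • (unfold1 (gradTensor X Ω F) * F.breveL * (F.breveLᴴ * F.breveL)⁻¹)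
  R := F.R - (η : ℂ) • (unfold2 (gradTensor X Ω F) * F.breveR * (F.breveRᴴ * F.breveR)⁻¹)
  V := F.V - (η : ℂ) • (unfold3 (gradTensor X Ω F) * F.breveV * (F.breveVᴴ * F.breveV)⁻¹)
  S := F.S - (η : ℂ) • tucker (F.Lᴴ * F.L)⁻¹ (F.Rᴴ * F.R)⁻¹ (F.Vᴴ * F.V)⁻¹
    (tucker F.Lᴴ F.Rᴴ F.Vᴴ (gradTensor X Ω F))

/-- The surrogate `Z⁰ = p⁻¹ G P_Ω (Y)`, where `Y = D X` and `p = m / (s n)`. -/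
def initTensor (X : Matrix (Fin s) (Fin (n₁ + n₂ - 1)) ℂ)
    (Ω : Fin m → Fin s × Fin (n₁ + n₂ - 1)) : Tensor n₁ n₂ s :=
  ((((m : ℝ) / (s * (n₁ + n₂ - 1 : ℕ)))⁻¹ : ℝ) : ℂ) • liftG (sampleOp Ω (reweight n₁ n₂ X))

/-- Sequential spectral initialization, before the projection: `V` is computed from
`Z⁰ ×₁ Lᴴ`. -/
def spectral (svd : SVDRoutine r) (Z : Tensor n₁ n₂ s) : Factors n₁ n₂ s r :=
  let L := svd.top (unfold1 Z)
  let R := svd.top (unfold2 Z)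
  let V := svd.top (unfold3 (tucker Lᴴ (1 : Matrix (Fin n₂) (Fin n₂) ℂ)
    (1 : Matrix (Fin s) (Fin s) ℂ) Z))
  { L := L, R := R, V := V, S := tucker Lᴴ Rᴴ Vᴴ Z }

/-- The iterates `F⁰, …, F^K`: the initialization uses the batch `Ω₀`, and the step from `F^k` to
`F^(k+1)` uses the fresh batch `Ω_(k+1)`. -/
def iterate {K : ℕ} (svd : SVDRoutine r) (X : Matrix (Fin s) (Fin (n₁ + n₂ - 1)) ℂ) (η B : ℝ)
    (Ω : Fin (K + 1) → Fin m → Fin s × Fin (n₁ + n₂ - 1)) (k : Fin (K + 1)) :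
    Factors n₁ n₂ s r :=
  Fin.induction (motive := fun _ => Factors n₁ n₂ s r)
    (project B (spectral svd (initTensor X (Ω 0))))
    (fun i F => project B (gradStep X η (Ω i.succ) F)) k

end Factors

end

set_option linter.unusedSectionVars false

/-! The error is measured only by the distance D of the current tensor Z = (L, R, V) • S from the
lifted signal Z⋆, so factors never have to be aligned. While ‖D‖ ≤ σ/200, with σ the smallest
singular value of Z⋆, all factors have full column rank (`Factors.regular_of_close`). A scaled step
then replaces Z by the product of three matrices 1 - η Aᵢ, acting in the three modes, applied to Z -
η p₁p₂p₃E. Here pᵢ and qᵢ are the projections onto the column and row spaces of the i-th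
matricization of Z, and Aᵢ is the matricized gradient times a pseudo-inverse. It satisfies AᵢZ = qᵢE
and has norm at most 1/50.

To first order D therefore becomes D - η W D with W = q₁ + q₂ + q₃ + p₁p₂p₃. This W vanishes on the
normal space of the Tucker manifold, lies between 1 and 4 on the range of p₁p₂p₃, and is 1 on the
rest of the tangent space. So for η ≤ 0.4 the tangential error shrinks by 1 - η. The normal part of
D has size at most a constant times ‖D‖²/σ, because Z⋆ has the same multilinear rank as Z. The slack
between 1 - η and 1 - η/2 absorbs this part, the noise and the higher powers of η
(`TuckerProjections.step_contraction`, `Factors.gradStep_contraction`).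

The noise in E is G(p⁻¹P_Ω - 1)G*D, and it enters only after p₁ or p₂. A fresh batch is independent
of Z, so each of these two noises is a centred sum of independent vectors in a Hilbert space. The
Bernstein inequality `card_norm_sum_sub_mean_ge`, proved with the martingale-like quantity cosh‖·‖,
controls it without a dimension factor. Incoherence makes the projected atoms and the entries of G*D
small (`Factors.ncard_not_gradStep_contraction_le`). The current factors are incoherent because the
scaled projection bounds the slices of the tensor, and it never moves the tensor away from Z⋆
(`Factors.norm_tvec_project_sub_le`).

For the initialization, a Hankel matricization in mode 1 or 2 has norm at most the largest discrete
Fourier coefficient (`norm_hankel_form_sq_le`), so a vector Bernstein bound for each of the n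
frequencies suffices. Passing from operator to Frobenius norms costs a factor r
(`Factors.norm_spectral_sub_le`); its square, together with the r in the incoherence bound, gives
the r³ of the sample size. A union bound over the batches finishes the proof
(`Factors.ncard_not_linear_convergence_le`). -/

noncomputable section

/-! ### A Bernstein inequality for sums of independent vectors in a Hilbert space -/

/-- The power series of cosh √x in x has nonnegative coefficients 1/(2n)!, so convexity on [0, ∞) is
inherited from the monomials. -/
lemma cosh_sqrt_convex_comb {p q t : ℝ} (hp : 0 ≤ p) (hq : 0 ≤ q) (ht : 0 ≤ t) (ht1 : t ≤ 1) :
    Real.cosh √(t * p + (1 - t) * q) ≤ t * Real.cosh √p + (1 - t) * Real.cosh √q := by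
  have hs : ∀ x : ℝ, 0 ≤ x →
      HasSum (fun n : ℕ => x ^ n / ((2 * n).factorial : ℝ)) (Real.cosh √x) := by
    intro x hx
    have h := Real.hasSum_cosh √x
    simpa only [pow_mul, Real.sq_sqrt hx] using h
  have h1t : 0 ≤ 1 - t := by linarith
  have h := ((hs p hp).mul_left t).add ((hs q hq).mul_left (1 - t))
  refine hasSum_le (fun n => ?_) (hs _ (by positivity)) h
  have hc := (convexOn_pow (𝕜 := ℝ) n).2 (Set.mem_Ici.2 hp) (Set.mem_Ici.2 hq) ht h1t (by ring)
  simp only [smul_eq_mul] at hc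
  rw [← mul_div_assoc, ← mul_div_assoc, ← add_div]
  gcongr

lemma self_le_sinh_of_nonneg {c : ℝ} (hc : 0 ≤ c) : c ≤ Real.sinh c :=
  Real.self_le_sinh_iff.2 hc

/-- A second-order expansion of the potential cosh‖·‖ whose remainder depends only on norms. The
term linear in x is isolated because it disappears after averaging over a centred x. -/
lemma cosh_norm_add_le {E : Type*} [NormedAddCommGroup E] [InnerProductSpace ℝ E] (y x : E) :
    Real.cosh ‖y + x‖ ≤ Real.cosh ‖y‖ * (Real.exp ‖x‖ - ‖x‖) +
      Real.sinh ‖y‖ / ‖y‖ * inner ℝ y x := by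
  have hexp : Real.exp ‖x‖ = Real.cosh ‖x‖ + Real.sinh ‖x‖ := (Real.cosh_add_sinh _).symm
  have hx := self_le_sinh_of_nonneg (norm_nonneg x)
  rcases eq_or_ne y 0 with rfl | hy
  · simp only [zero_add, norm_zero, Real.cosh_zero, inner_zero_left, mul_zero, add_zero, one_mul]
    linarith
  rcases eq_or_ne x 0 with rfl | hx0
  · simp
  set a := ‖y‖ with ha
  set c := ‖x‖ with hc
  have ha0 : 0 < a := norm_pos_iff.2 hy
  have hc0 : 0 < c := norm_pos_iff.2 hx0
  set s := inner ℝ y x / (a * c) with hs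
  have habs : |s| ≤ 1 := abs_real_inner_div_norm_mul_norm_le_one y x
  obtain ⟨hs1, hs2⟩ := abs_le.1 habs
  have hin : inner ℝ y x = a * c * s := by rw [hs]; field_simp
  -- With s the cosine of the angle, ‖y + x‖² is a convex combination of its two collinear extremes
  -- (a + c)² and (a - c)². Convexity of cosh √ reduces the claim to the addition formulas.
  have hsq : ‖y + x‖ = √((1 + s) / 2 * (a + c) ^ 2 + (1 - (1 + s) / 2) * (a - c) ^ 2) := by
    rw [← Real.sqrt_sq (norm_nonneg (y + x)), norm_add_sq_real, hin]
    congr 1; ring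
  have h := cosh_sqrt_convex_comb (p := (a + c) ^ 2) (q := (a - c) ^ 2) (t := (1 + s) / 2)
    (sq_nonneg _) (sq_nonneg _) (by linarith) (by linarith)
  rw [← hsq, Real.sqrt_sq_eq_abs, Real.sqrt_sq_eq_abs, Real.cosh_abs, Real.cosh_abs,
    Real.cosh_add, Real.cosh_sub] at h
  have hsa : 0 ≤ Real.sinh a := Real.sinh_nonneg_iff.2 ha0.le
  have hca : Real.sinh a ≤ Real.cosh a := (Real.sinh_lt_cosh a).le
  have hg : Real.sinh a / a * (a * c * s) = Real.sinh a * c * s := by field_simp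
  rw [hin, hg, hexp]
  have h3 : s * Real.sinh a * (Real.sinh c - c) ≤ Real.cosh a * (Real.sinh c - c) := by
    apply mul_le_mul_of_nonneg_right _ (by linarith)
    nlinarith
  nlinarith

/-- Centring kills the linear term, and exp c - c ≤ 1 + c² holds for 0 ≤ c ≤ 1. -/
lemma sum_cosh_norm_add_le {α E : Type*} [Fintype α] [NormedAddCommGroup E]
    [InnerProductSpace ℝ E] (ξ : α → E) (h0 : ∑ x, ξ x = 0) (h1 : ∀ x, ‖ξ x‖ ≤ 1) (y : E) :
    ∑ x, Real.cosh ‖y + ξ x‖ ≤ Real.cosh ‖y‖ * (Fintype.card α + ∑ x, ‖ξ x‖ ^ 2) := by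
  calc ∑ x, Real.cosh ‖y + ξ x‖
      ≤ ∑ x, (Real.cosh ‖y‖ * (1 + ‖ξ x‖ ^ 2) + Real.sinh ‖y‖ / ‖y‖ * inner ℝ y (ξ x)) := by
        refine Finset.sum_le_sum fun x _ => (cosh_norm_add_le y (ξ x)).trans ?_
        have h := abs_le.1 (Real.abs_exp_sub_one_sub_id_le
          (x := ‖ξ x‖) (by rw [abs_norm]; exact h1 x))
        gcongr
        linarith [h.2]
    _ = Real.cosh ‖y‖ * (Fintype.card α + ∑ x, ‖ξ x‖ ^ 2) := by
        rw [Finset.sum_add_distrib, ← Finset.mul_sum, ← Finset.mul_sum, ← inner_sum, h0,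
          inner_zero_right, mul_zero, add_zero, Finset.sum_add_distrib]
        simp

/-- The shift y is what makes the induction run: the first sample is absorbed into it. -/
lemma sum_cosh_norm_sum_le {α E : Type*} [Fintype α] [NormedAddCommGroup E]
    [InnerProductSpace ℝ E] (ξ : α → E) (h0 : ∑ x, ξ x = 0) (h1 : ∀ x, ‖ξ x‖ ≤ 1) (m : ℕ)
    (y : E) :
    ∑ Ω : Fin m → α, Real.cosh ‖y + ∑ i, ξ (Ω i)‖ ≤
      Real.cosh ‖y‖ * (Fintype.card α + ∑ x, ‖ξ x‖ ^ 2) ^ m := by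
  induction m generalizing y with
  | zero => simp
  | succ m ih =>
    rw [← (Fin.consEquiv fun _ : Fin (m + 1) => α).sum_comp, Fintype.sum_prod_type]
    have hV : 0 ≤ ∑ x, ‖ξ x‖ ^ 2 := by positivity
    calc ∑ x : α, ∑ Ω : Fin m → α,
          Real.cosh ‖y + ∑ i, ξ ((Fin.consEquiv fun _ : Fin (m + 1) => α) (x, Ω) i)‖
        = ∑ x : α, ∑ Ω : Fin m → α, Real.cosh ‖(y + ξ x) + ∑ i, ξ (Ω i)‖ := by
          refine Finset.sum_congr rfl fun x _ => Finset.sum_congr rfl fun Ω _ => ?_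
          rw [Fin.sum_univ_succ]
          simp [Fin.consEquiv, add_assoc]
      _ ≤ ∑ x : α, Real.cosh ‖y + ξ x‖ * (Fintype.card α + ∑ x, ‖ξ x‖ ^ 2) ^ m :=
          Finset.sum_le_sum fun x _ => ih (y + ξ x)
      _ ≤ _ := by
          rw [← Finset.sum_mul, pow_succ', ← mul_assoc]
          gcongr
          exact sum_cosh_norm_add_le ξ h0 h1 y

/-- Bernstein's inequality for independent uniform samples of a Hilbert space valued function, in
the form of a bound on the number of bad samples. -/
theorem card_norm_sum_sub_mean_ge {α E : Type*} [Fintype α] [Nonempty α] [NormedAddCommGroup E]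
    [InnerProductSpace ℝ E] (ξ : α → E) (m : ℕ) {M v t l : ℝ} (ht : 0 < t) (hl : 0 < l)
    (hM : ∀ x, ‖ξ x‖ ≤ M) (hv : m / Fintype.card α * ∑ x, ‖ξ x‖ ^ 2 ≤ v)
    (hMt : M ≤ t / (4 * l)) (hvt : v ≤ t ^ 2 / (4 * l)) :
    (Set.ncard {Ω : Fin m → α |
      t ≤ ‖∑ i, ξ (Ω i) - (m / Fintype.card α : ℝ) • ∑ x, ξ x‖} : ℝ) ≤
      2 * Real.exp (-l) * (Fintype.card α : ℝ) ^ m := by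
  classical
  rw [Set.ncard_eq_toFinset_card', Set.toFinset_ofPred]
  set N : ℝ := (Fintype.card α : ℝ) with hN
  have hN0 : 0 < N := by rw [hN]; exact_mod_cast Fintype.card_pos
  set μ : E := N⁻¹ • ∑ x, ξ x with hμ
  -- This scale makes each centred summand of norm at most 1 (by `hMt`) and the total variance at
  -- most l (by `hvt`). The moment bound is then exp l, against a Markov threshold cosh (2l) ≥ exp
  -- (2l) / 2, which leaves 2 exp (-l).
  set lam : ℝ := 2 * l / t with hlam
  have hlam0 : 0 < lam := by positivity
  set ζ : α → E := fun x => lam • (ξ x - μ) with hζ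
  have hM0 : 0 ≤ M := (norm_nonneg _).trans (hM (Classical.arbitrary α))
  have hNμ : ∑ x, ξ x = N • μ := by rw [hμ, smul_smul, mul_inv_cancel₀ hN0.ne', one_smul]
  have hμM : ‖μ‖ ≤ M := by
    rw [hμ, norm_smul, Real.norm_of_nonneg (by positivity)]
    have : ‖∑ x, ξ x‖ ≤ N * M := by
      refine (norm_sum_le_of_le _ fun x _ => hM x).trans ?_
      simp [hN]
    calc N⁻¹ * ‖∑ x, ξ x‖ ≤ N⁻¹ * (N * M) := by gcongr
      _ = M := by field_simp
  have h0 : ∑ x, ζ x = 0 := by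
    rw [hζ, ← Finset.smul_sum, Finset.sum_sub_distrib, hNμ]
    simp [hN, Nat.cast_smul_eq_nsmul]
  have h1 : ∀ x, ‖ζ x‖ ≤ 1 := by
    intro x
    rw [hζ, norm_smul, Real.norm_of_nonneg hlam0.le]
    calc lam * ‖ξ x - μ‖ ≤ lam * (M + M) := by
          gcongr; exact (norm_sub_le _ _).trans (add_le_add (hM x) hμM)
      _ ≤ lam * (t / (4 * l) + t / (4 * l)) := by gcongr
      _ = 1 := by rw [hlam]; field_simp; norm_num
  have hvar : ∑ x, ‖ζ x‖ ^ 2 ≤ lam ^ 2 * ∑ x, ‖ξ x‖ ^ 2 := by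
    have e1 : ∀ x, ‖ζ x‖ ^ 2 = lam ^ 2 * (‖ξ x‖ ^ 2 - 2 * inner ℝ (ξ x) μ + ‖μ‖ ^ 2) := by
      intro x
      rw [hζ, norm_smul, mul_pow, Real.norm_of_nonneg hlam0.le, norm_sub_sq_real]
    simp_rw [e1]
    rw [← Finset.mul_sum, Finset.sum_add_distrib, Finset.sum_sub_distrib, ← Finset.mul_sum,
      ← sum_inner, hNμ, real_inner_smul_left, real_inner_self_eq_norm_sq]
    gcongr
    simp only [Finset.sum_const, Finset.card_univ, nsmul_eq_mul, ← hN]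
    nlinarith [mul_nonneg hN0.le (sq_nonneg ‖μ‖)]
  have hmgf := sum_cosh_norm_sum_le ζ h0 h1 m 0
  simp only [zero_add, norm_zero, Real.cosh_zero, one_mul, ← hN] at hmgf
  have hsum : ∀ Ω : Fin m → α, ∑ i, ζ (Ω i) =
      lam • (∑ i, ξ (Ω i) - (m / N : ℝ) • ∑ x, ξ x) := by
    intro Ω
    rw [hζ, ← Finset.smul_sum, Finset.sum_sub_distrib, hNμ, smul_smul, div_mul_cancel₀ _ hN0.ne']
    simp [Nat.cast_smul_eq_nsmul]
  have hpow : (N + ∑ x, ‖ζ x‖ ^ 2) ^ m ≤ N ^ m * Real.exp l := by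
    have h2 : N + ∑ x, ‖ζ x‖ ^ 2 ≤ N * Real.exp (lam ^ 2 * (∑ x, ‖ξ x‖ ^ 2) / N) := by
      have := Real.add_one_le_exp (lam ^ 2 * (∑ x, ‖ξ x‖ ^ 2) / N)
      calc N + ∑ x, ‖ζ x‖ ^ 2 ≤ N + lam ^ 2 * ∑ x, ‖ξ x‖ ^ 2 := by gcongr
        _ = N * (lam ^ 2 * (∑ x, ‖ξ x‖ ^ 2) / N + 1) := by field_simp; ring
        _ ≤ _ := by gcongr
    calc (N + ∑ x, ‖ζ x‖ ^ 2) ^ m ≤ (N * Real.exp (lam ^ 2 * (∑ x, ‖ξ x‖ ^ 2) / N)) ^ m := by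
          gcongr
      _ = N ^ m * Real.exp (m * (lam ^ 2 * (∑ x, ‖ξ x‖ ^ 2) / N)) := by
          rw [mul_pow, ← Real.exp_nat_mul]
      _ ≤ N ^ m * Real.exp l := by
          gcongr
          calc m * (lam ^ 2 * (∑ x, ‖ξ x‖ ^ 2) / N)
              = lam ^ 2 * (m / N * ∑ x, ‖ξ x‖ ^ 2) := by ring
            _ ≤ lam ^ 2 * (t ^ 2 / (4 * l)) := by gcongr; exact hv.trans hvt
            _ = l := by rw [hlam]; field_simp; norm_num
  have hmarkov : ((Finset.univ.filter fun Ω : Fin m → α =>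
      t ≤ ‖∑ i, ξ (Ω i) - (m / N : ℝ) • ∑ x, ξ x‖).card : ℝ) * (Real.exp (2 * l) / 2) ≤
      ∑ Ω : Fin m → α, Real.cosh ‖∑ i, ζ (Ω i)‖ := by
    rw [← nsmul_eq_mul, ← Finset.sum_const]
    refine (Finset.sum_le_sum fun Ω hΩ => ?_).trans
      (Finset.sum_le_sum_of_subset_of_nonneg (Finset.filter_subset _ _)
        fun Ω _ _ => (Real.cosh_pos _).le)
    have hΩ' := (Finset.mem_filter.1 hΩ).2
    have h3 : 2 * l ≤ ‖∑ i, ζ (Ω i)‖ := by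
      rw [hsum, norm_smul, Real.norm_of_nonneg hlam0.le]
      calc 2 * l = lam * t := by rw [hlam]; field_simp
        _ ≤ _ := by gcongr
    rw [Real.cosh_eq]
    have := Real.exp_le_exp.2 h3
    have := Real.exp_pos (-‖∑ i, ζ (Ω i)‖)
    linarith
  have hfin := hmarkov.trans (hmgf.trans hpow)
  have e2 : Real.exp (2 * l) = Real.exp l * Real.exp l := by rw [← Real.exp_add]; congr 1; ring
  rw [e2] at hfin
  have hel := Real.exp_pos l
  rw [Real.exp_neg]
  have h5 : ((Finset.univ.filter fun Ω : Fin m → α =>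
      t ≤ ‖∑ i, ξ (Ω i) - (m / N : ℝ) • ∑ x, ξ x‖).card : ℝ) * (Real.exp l / 2) ≤ N ^ m := by
    nlinarith
  have h6 : 0 < (Real.exp l)⁻¹ := by positivity
  calc _ ≤ (N ^ m) / (Real.exp l / 2) := (le_div_iff₀ (by positivity)).2 h5
    _ = _ := by rw [div_div_eq_mul_div]; ring

set_option linter.unusedSimpArgs false

/-! ### Contraction of the scaled gradient step in an abstract Hilbert space -/

/-- Orthogonal projections `pᵢ` onto the mode-`i` column spaces and `qᵢ` onto the mode-`i` row spaces
of a third-order tensor, reduced to the relations among them. -/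
structure TuckerProjections (H : Type*) [NormedAddCommGroup H] [InnerProductSpace ℂ H] where
  (p₁ p₂ p₃ q₁ q₂ q₃ : H →ₗ[ℂ] H)
  symm_p₁ : p₁.IsSymmetric
  symm_p₂ : p₂.IsSymmetric
  symm_p₃ : p₃.IsSymmetric
  symm_q₁ : q₁.IsSymmetric
  symm_q₂ : q₂.IsSymmetric
  symm_q₃ : q₃.IsSymmetric
  p₁p₁ : ∀ x, p₁ (p₁ x) = p₁ x
  p₂p₂ : ∀ x, p₂ (p₂ x) = p₂ x
  p₃p₃ : ∀ x, p₃ (p₃ x) = p₃ x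
  q₁q₁ : ∀ x, q₁ (q₁ x) = q₁ x
  q₂q₂ : ∀ x, q₂ (q₂ x) = q₂ x
  q₃q₃ : ∀ x, q₃ (q₃ x) = q₃ x
  p₂p₁ : ∀ x, p₂ (p₁ x) = p₁ (p₂ x)
  p₃p₁ : ∀ x, p₃ (p₁ x) = p₁ (p₃ x)
  p₃p₂ : ∀ x, p₃ (p₂ x) = p₂ (p₃ x)
  q₁p₁ : ∀ x, q₁ (p₁ x) = p₁ (q₁ x)
  q₂p₂ : ∀ x, q₂ (p₂ x) = p₂ (q₂ x)
  q₃p₃ : ∀ x, q₃ (p₃ x) = p₃ (q₃ x)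
  q₁p₂ : ∀ x, q₁ (p₂ x) = q₁ x
  q₁p₃ : ∀ x, q₁ (p₃ x) = q₁ x
  q₂p₁ : ∀ x, q₂ (p₁ x) = q₂ x
  q₂p₃ : ∀ x, q₂ (p₃ x) = q₂ x
  q₃p₁ : ∀ x, q₃ (p₁ x) = q₃ x
  q₃p₂ : ∀ x, q₃ (p₂ x) = q₃ x
  p₂q₁ : ∀ x, p₂ (q₁ x) = q₁ x
  p₃q₁ : ∀ x, p₃ (q₁ x) = q₁ x
  p₁q₂ : ∀ x, p₁ (q₂ x) = q₂ x
  p₃q₂ : ∀ x, p₃ (q₂ x) = q₂ x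
  p₁q₃ : ∀ x, p₁ (q₃ x) = q₃ x
  p₂q₃ : ∀ x, p₂ (q₃ x) = q₃ x

section Projection

variable {H : Type*} [NormedAddCommGroup H] [InnerProductSpace ℂ H]

lemma re_inner_of_symm_idem {p : H →ₗ[ℂ] H} (hs : p.IsSymmetric) (hp : ∀ x, p (p x) = p x)
    (x : H) : RCLike.re (inner ℂ x (p x)) = ‖p x‖ ^ 2 := by
  rw [← hp x, ← hs, hp, inner_self_eq_norm_sq]

lemma norm_le_of_symm_idem {p : H →ₗ[ℂ] H} (hs : p.IsSymmetric) (hp : ∀ x, p (p x) = p x)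
    (x : H) : ‖p x‖ ≤ ‖x‖ := by
  have h := re_inner_of_symm_idem hs hp x
  have h2 := re_inner_le_norm (𝕜 := ℂ) x (p x)
  rcases (norm_nonneg (p x)).eq_or_lt with h0 | h0
  · rw [← h0]; exact norm_nonneg x
  · nlinarith

end Projection

namespace TuckerProjections

variable {H : Type*} [NormedAddCommGroup H] [InnerProductSpace ℂ H] (T : TuckerProjections H)

lemma p₁p₂q₂ (x : H) : T.p₁ (T.p₂ (T.q₂ x)) = T.p₂ (T.q₂ x) := by
  rw [← T.p₂p₁, T.p₁q₂]

lemma p₁p₃q₃ (x : H) : T.p₁ (T.p₃ (T.q₃ x)) = T.p₃ (T.q₃ x) := by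
  rw [← T.p₃p₁, T.p₁q₃]

lemma p₂p₃q₃ (x : H) : T.p₂ (T.p₃ (T.q₃ x)) = T.p₃ (T.q₃ x) := by
  rw [← T.p₃p₂, T.p₂q₃]

/-- The projection `p₁ p₂ p₃`. -/
def core (x : H) : H := T.p₁ (T.p₂ (T.p₃ x))

/-- The linearization of the scaled gradient step. -/
def lin (x : H) : H := T.q₁ x + T.q₂ x + T.q₃ x + T.core x

lemma core_add (x y : H) : T.core (x + y) = T.core x + T.core y := by simp [core]

lemma lin_add (x y : H) : T.lin (x + y) = T.lin x + T.lin y := by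
  simp only [lin, core_add, map_add]; abel

/-- The component orthogonal to the tangent space. -/
def normalPart (x : H) : H :=
  (x - T.p₁ x - T.q₁ (x - T.p₁ x)) + T.p₁ (x - T.p₂ x - T.q₂ (x - T.p₂ x)) +
    T.p₁ (T.p₂ (x - T.p₃ x - T.q₃ (x - T.p₃ x)))

/-- The component in the tangent space and orthogonal to the range of `core`. -/
def sidePart (x : H) : H :=
  (T.q₁ x - T.p₁ (T.q₁ x)) + (T.q₂ x - T.p₂ (T.q₂ x)) + (T.q₃ x - T.p₃ (T.q₃ x))

lemma inner_core (x y : H) : inner ℂ (T.core x) y = inner ℂ x (T.core y) := by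
  simp only [core]
  rw [T.symm_p₁, T.symm_p₂, T.symm_p₃, T.p₂p₁, T.p₃p₁, T.p₃p₂]

lemma inner_core_eq_zero {x y : H} (hx : T.core x = x) (hy : T.core y = 0) : inner ℂ x y = 0 := by
  rw [← hx, inner_core, hy, inner_zero_right]

lemma inner_sidePart_normalPart (x : H) : inner ℂ (T.sidePart x) (T.normalPart x) = 0 := by
  have e1 : ∀ z, inner ℂ (T.q₁ x - T.p₁ (T.q₁ x)) z = inner ℂ x (T.q₁ z - T.p₁ (T.q₁ z)) := by
    intro z; rw [inner_sub_left, inner_sub_right, T.symm_p₁, T.symm_q₁, T.symm_q₁, T.q₁p₁]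
  have e2 : ∀ z, inner ℂ (T.q₂ x - T.p₂ (T.q₂ x)) z = inner ℂ x (T.q₂ z - T.p₂ (T.q₂ z)) := by
    intro z; rw [inner_sub_left, inner_sub_right, T.symm_p₂, T.symm_q₂, T.symm_q₂, T.q₂p₂]
  have e3 : ∀ z, inner ℂ (T.q₃ x - T.p₃ (T.q₃ x)) z = inner ℂ x (T.q₃ z - T.p₃ (T.q₃ z)) := by
    intro z; rw [inner_sub_left, inner_sub_right, T.symm_p₃, T.symm_q₃, T.symm_q₃, T.q₃p₃]
  rw [sidePart, inner_add_left, inner_add_left, e1, e2, e3, ← inner_add_right, ← inner_add_right]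
  have h0 : ∀ z : H, z = 0 → inner ℂ x z = 0 := by rintro _ rfl; exact inner_zero_right x
  apply h0
  simp only [normalPart, map_add, map_sub, T.p₁p₁, T.p₂p₂, T.p₃p₃, T.q₁q₁, T.q₂q₂, T.q₃q₃, T.p₂p₁,
    T.p₃p₁, T.p₃p₂, T.q₁p₁, T.q₂p₂, T.q₃p₃, T.q₁p₂, T.q₁p₃, T.q₂p₁, T.q₂p₃, T.q₃p₁, T.q₃p₂,
    T.p₂q₁, T.p₃q₁, T.p₁q₂, T.p₃q₂, T.p₁q₃, T.p₂q₃,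
    T.p₁p₂q₂, T.p₁p₃q₃, T.p₂p₃q₃]
  abel

/-- Telescope x = (1 - p₁)x + p₁(1 - p₂)x + p₁p₂(1 - p₃)x + p₁p₂p₃x and split each of the first
three terms by the matching qᵢ. The tangential halves collapse to `sidePart` because pⱼqᵢ = qᵢ for j
≠ i. -/
lemma decompose (x : H) : x = T.core x + T.sidePart x + T.normalPart x := by
  simp only [core, sidePart, normalPart, map_sub, T.p₁p₁, T.p₂p₂, T.p₃p₃, T.q₁q₁, T.q₂q₂, T.q₃q₃,
    T.p₂p₁, T.p₃p₁, T.p₃p₂, T.q₁p₁, T.q₂p₂, T.q₃p₃, T.q₁p₂, T.q₁p₃, T.q₂p₁, T.q₂p₃, T.q₃p₁,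
    T.q₃p₂, T.p₂q₁, T.p₃q₁, T.p₁q₂, T.p₃q₂, T.p₁q₃, T.p₂q₃,
    T.p₁p₂q₂, T.p₁p₃q₃, T.p₂p₃q₃]
  abel

lemma core_core (x : H) : T.core (T.core x) = T.core x := by
  simp only [core, T.p₁p₁, T.p₂p₂, T.p₃p₃, T.p₂p₁, T.p₃p₁, T.p₃p₂]

lemma core_sidePart (x : H) : T.core (T.sidePart x) = 0 := by
  simp only [core, sidePart, map_add, map_sub, T.p₁p₁, T.p₂p₂, T.p₃p₃, T.p₂p₁, T.p₃p₁, T.p₃p₂,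
    T.p₂q₁, T.p₃q₁, T.p₁q₂, T.p₃q₂, T.p₁q₃, T.p₂q₃,
    T.p₁p₂q₂, T.p₁p₃q₃, T.p₂p₃q₃]
  abel

lemma core_normalPart (x : H) : T.core (T.normalPart x) = 0 := by
  simp only [core, normalPart, map_add, map_sub, T.p₁p₁, T.p₂p₂, T.p₃p₃, T.p₂p₁, T.p₃p₁, T.p₃p₂,
    T.q₁p₁, T.q₂p₂, T.q₃p₃, T.q₁p₂, T.q₁p₃, T.q₂p₁, T.q₂p₃, T.q₃p₁, T.q₃p₂,
    T.p₂q₁, T.p₃q₁, T.p₁q₂, T.p₃q₂, T.p₁q₃, T.p₂q₃,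
    T.p₁p₂q₂, T.p₁p₃q₃, T.p₂p₃q₃]
  abel

/-- In the orthogonal decomposition `lin` is 1 + q₁ + q₂ + q₃ on the core part, the identity on the
side part and 0 on the normal part. -/
lemma lin_eq (x : H) : T.lin x = T.core x + (T.q₁ (T.core x) + T.q₂ (T.core x) + T.q₃ (T.core x)) +
    T.sidePart x := by
  simp only [lin, core, sidePart, T.p₂p₁, T.p₃p₁, T.p₃p₂, T.q₁p₁, T.q₂p₂, T.q₃p₃, T.q₁p₂, T.q₁p₃,
    T.q₂p₁, T.q₂p₃, T.q₃p₁, T.q₃p₂, T.p₂q₁, T.p₃q₁, T.p₁q₂, T.p₃q₂, T.p₁q₃, T.p₂q₃,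
    T.p₁p₂q₂, T.p₁p₃q₃, T.p₂p₃q₃]
  abel

lemma core_q_core (x : H) :
    T.core (T.q₁ (T.core x) + T.q₂ (T.core x) + T.q₃ (T.core x)) =
      T.q₁ (T.core x) + T.q₂ (T.core x) + T.q₃ (T.core x) := by
  simp only [core, map_add, T.p₁p₁, T.p₂p₂, T.p₃p₃, T.p₂p₁, T.p₃p₁, T.p₃p₂,
    T.q₁p₁, T.q₂p₂, T.q₃p₃, T.q₁p₂, T.q₁p₃, T.q₂p₁, T.q₂p₃, T.q₃p₁, T.q₃p₂,
    T.p₂q₁, T.p₃q₁, T.p₁q₂, T.p₃q₂, T.p₁q₃, T.p₂q₃,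
    T.p₁p₂q₂, T.p₁p₃q₃, T.p₂p₃q₃]

/-- The sum q₁ + q₂ + q₃ is positive with norm at most 3, so 1 - η - η(q₁ + q₂ + q₃) has its
spectrum in [1 - 4η, 1 - η]. Its absolute value stays below 1 - η as long as 4η - 1 ≤ 1 - η, which
is the source of η ≤ 0.4. The proof replaces the spectrum by the inequality ‖a‖² ≤ 3 Re⟨d, a⟩. -/
lemma norm_sub_smul_sum_le {η : ℝ} (h0 : 0 ≤ η) (h1 : η ≤ 0.4) (d : H) :
    ‖((1 - η : ℝ) : ℂ) • d - (η : ℂ) • (T.q₁ d + T.q₂ d + T.q₃ d)‖ ^ 2 ≤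
      (1 - η) ^ 2 * ‖d‖ ^ 2 := by
  set a := T.q₁ d + T.q₂ d + T.q₃ d with ha
  have hin : RCLike.re (inner ℂ d a) = ‖T.q₁ d‖ ^ 2 + ‖T.q₂ d‖ ^ 2 + ‖T.q₃ d‖ ^ 2 := by
    rw [ha, inner_add_right, inner_add_right, map_add, map_add,
      re_inner_of_symm_idem T.symm_q₁ T.q₁q₁, re_inner_of_symm_idem T.symm_q₂ T.q₂q₂,
      re_inner_of_symm_idem T.symm_q₃ T.q₃q₃]
  have hna : ‖a‖ ^ 2 ≤ 3 * RCLike.re (inner ℂ d a) := by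
    have h : ‖a‖ ≤ ‖T.q₁ d‖ + ‖T.q₂ d‖ + ‖T.q₃ d‖ := norm_add₃_le
    rw [hin]
    nlinarith [sq_nonneg (‖T.q₁ d‖ - ‖T.q₂ d‖), sq_nonneg (‖T.q₁ d‖ - ‖T.q₃ d‖),
      sq_nonneg (‖T.q₂ d‖ - ‖T.q₃ d‖), norm_nonneg a]
  have hpos : 0 ≤ RCLike.re (inner ℂ d a) := by rw [hin]; positivity
  rw [norm_sub_sq (𝕜 := ℂ), inner_smul_left, inner_smul_right, norm_smul, norm_smul,
    Complex.conj_ofReal, ← mul_assoc, ← Complex.ofReal_mul]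
  have e : RCLike.re (((((1 - η) * η : ℝ)) : ℂ) * inner ℂ d a) =
      (1 - η) * η * RCLike.re (inner ℂ d a) := by
    simp
  rw [e, Complex.norm_real, Complex.norm_real, mul_pow, mul_pow, Real.norm_eq_abs,
    Real.norm_eq_abs, sq_abs, sq_abs]
  nlinarith [mul_nonneg h0 hpos, mul_nonneg (mul_nonneg h0 hpos) (sub_nonneg.2 h1),
    mul_le_mul_of_nonneg_left hna (sq_nonneg η)]

/-- The three components remain mutually orthogonal. Core and side parts shrink by 1 - η, the normal
part is untouched, and 1 - (1 - η)² ≤ 2η. -/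
theorem norm_sub_lin_sq_le {η : ℝ} (h0 : 0 ≤ η) (h1 : η ≤ 0.4) (x : H) :
    ‖x - (η : ℂ) • T.lin x‖ ^ 2 ≤ (1 - η) ^ 2 * ‖x‖ ^ 2 + 2 * η * ‖T.normalPart x‖ ^ 2 := by
  set d := T.core x with hd
  set u := T.sidePart x with hu
  set y := T.normalPart x with hy
  set c := ((1 - η : ℝ) : ℂ) • d - (η : ℂ) • (T.q₁ d + T.q₂ d + T.q₃ d) with hc
  have hx : x = d + u + y := T.decompose x
  have hW : T.lin x = d + (T.q₁ d + T.q₂ d + T.q₃ d) + u := T.lin_eq x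
  have hxW : x - (η : ℂ) • T.lin x = c + ((1 - η : ℝ) : ℂ) • u + y := by
    rw [hW, hc]; nth_rewrite 1 [hx]; push_cast; module
  have hcd : T.core d = d := T.core_core x
  have hcc : T.core c = c := by
    have hsmul : ∀ (k : ℂ) (z : H), T.core (k • z) = k • T.core z := fun k z => by simp [core]
    have hsub : ∀ z w : H, T.core (z - w) = T.core z - T.core w := fun z w => by simp [core]
    rw [hc, hsub, hsmul, hsmul, hcd, hd, T.core_q_core]
  have hdu : inner ℂ d u = 0 := T.inner_core_eq_zero hcd (T.core_sidePart x)
  have hdy : inner ℂ d y = 0 := T.inner_core_eq_zero hcd (T.core_normalPart x)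
  have hcu : inner ℂ c u = 0 := T.inner_core_eq_zero hcc (T.core_sidePart x)
  have hcy : inner ℂ c y = 0 := T.inner_core_eq_zero hcc (T.core_normalPart x)
  have huy : inner ℂ u y = 0 := T.inner_sidePart_normalPart x
  have hnx : ‖x‖ ^ 2 = ‖d‖ ^ 2 + ‖u‖ ^ 2 + ‖y‖ ^ 2 := by
    rw [hx, norm_add_sq (𝕜 := ℂ), norm_add_sq (𝕜 := ℂ), inner_add_left, hdu, hdy, huy]
    simp
  have hnW : ‖x - (η : ℂ) • T.lin x‖ ^ 2 = ‖c‖ ^ 2 + (1 - η) ^ 2 * ‖u‖ ^ 2 + ‖y‖ ^ 2 := by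
    rw [hxW, norm_add_sq (𝕜 := ℂ), norm_add_sq (𝕜 := ℂ), inner_add_left, inner_smul_left,
      inner_smul_right, hcu, hcy, huy, norm_smul, mul_pow, Complex.norm_real, Real.norm_eq_abs,
      sq_abs]
    simp
  have hcb := T.norm_sub_smul_sum_le h0 h1 d
  rw [hnW, hnx]
  nlinarith [sq_nonneg ‖y‖, sq_nonneg (η * ‖y‖)]

lemma norm_normalPart_le {x : H} {b : ℝ}
    (h1 : ‖x - T.p₁ x - T.q₁ (x - T.p₁ x)‖ ≤ b) (h2 : ‖x - T.p₂ x - T.q₂ (x - T.p₂ x)‖ ≤ b)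
    (h3 : ‖x - T.p₃ x - T.q₃ (x - T.p₃ x)‖ ≤ b) : ‖T.normalPart x‖ ≤ 3 * b := by
  have n1 := norm_le_of_symm_idem T.symm_p₁ T.p₁p₁
  have n2 := norm_le_of_symm_idem T.symm_p₂ T.p₂p₂
  refine norm_add₃_le.trans ?_
  have := (n1 (x - T.p₂ x - T.q₂ (x - T.p₂ x))).trans h2
  have := ((n1 _).trans (n2 (x - T.p₃ x - T.q₃ (x - T.p₃ x)))).trans h3
  linarith

/-- One step of the scaled gradient method contracts the error by the factor `1 - η / 2`, if the
noise, the curvature and the sizes of the updates are small. -/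
theorem step_contraction {η : ℝ} (h0 : 0 ≤ η) (h1 : η ≤ 0.4) {Z Zs N C : H}
    (hN1 : ‖T.p₁ N‖ ≤ 1 / 50 * ‖Z - Zs‖) (hN2 : ‖T.p₂ N‖ ≤ 1 / 50 * ‖Z - Zs‖)
    {A₁ A₂ A₃ : H →ₗ[ℂ] H} (hA1 : ∀ x, ‖A₁ x‖ ≤ 1 / 50 * ‖x‖)
    (hA2 : ∀ x, ‖A₂ x‖ ≤ 1 / 50 * ‖x‖) (hA3 : ∀ x, ‖A₃ x‖ ≤ 1 / 50 * ‖x‖)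
    (hZ1 : A₁ Z = T.q₁ (Z - Zs + N)) (hZ2 : A₂ Z = T.q₂ (Z - Zs + N))
    (hZ3 : A₃ Z = T.q₃ (Z - Zs + N)) (hC : C = T.core (Z - Zs + N))
    (hn : ‖T.normalPart (Z - Zs)‖ ≤ 3 / 100 * ‖Z - Zs‖) :
    ‖(Z - (η : ℂ) • C) - (η : ℂ) • A₃ (Z - (η : ℂ) • C) -
        (η : ℂ) • A₂ ((Z - (η : ℂ) • C) - (η : ℂ) • A₃ (Z - (η : ℂ) • C)) -
        (η : ℂ) • A₁ ((Z - (η : ℂ) • C) - (η : ℂ) • A₃ (Z - (η : ℂ) • C) -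
          (η : ℂ) • A₂ ((Z - (η : ℂ) • C) - (η : ℂ) • A₃ (Z - (η : ℂ) • C))) - Zs‖ ≤
      (1 - 0.5 * η) * ‖Z - Zs‖ := by
  set D := Z - Zs with hD
  set e := ‖D‖ with he
  have he0 : 0 ≤ e := norm_nonneg _
  have p1 := norm_le_of_symm_idem T.symm_p₁ T.p₁p₁
  have p2 := norm_le_of_symm_idem T.symm_p₂ T.p₂p₂
  have p3 := norm_le_of_symm_idem T.symm_p₃ T.p₃p₃
  have q1 := norm_le_of_symm_idem T.symm_q₁ T.q₁q₁
  have q2 := norm_le_of_symm_idem T.symm_q₂ T.q₂q₂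
  have q3 := norm_le_of_symm_idem T.symm_q₃ T.q₃q₃
  -- Since qᵢ = qᵢpⱼ for j ≠ i, every occurrence of the noise can be routed through p₁ or p₂. No
  -- bound on the noise in mode 3 is required.
  have hq1N : ‖T.q₁ N‖ ≤ 1 / 50 * e := by rw [← T.q₁p₂]; exact (q1 _).trans hN2
  have hq2N : ‖T.q₂ N‖ ≤ 1 / 50 * e := by rw [← T.q₂p₁]; exact (q2 _).trans hN1
  have hq3N : ‖T.q₃ N‖ ≤ 1 / 50 * e := by rw [← T.q₃p₁]; exact (q3 _).trans hN1
  have hcN : ‖T.core N‖ ≤ 1 / 50 * e := by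
    rw [core, ← T.p₃p₂, ← T.p₃p₁, ← T.p₂p₁]
    exact (p3 _).trans ((p2 _).trans hN1)
  have hcD : ‖T.core D‖ ≤ e := (p1 _).trans ((p2 _).trans (p3 _))
  have hlinN : ‖T.lin N‖ ≤ 4 / 50 * e := by
    refine (norm_add_le _ _).trans ?_
    have := norm_add₃_le (a := T.q₁ N) (b := T.q₂ N) (c := T.q₃ N)
    linarith
  have hC' : ‖C‖ ≤ 51 / 50 * e := by
    rw [hC, core_add]; refine (norm_add_le _ _).trans ?_; linarith
  have hE1 : ‖A₁ Z‖ ≤ 51 / 50 * e := by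
    rw [hZ1, map_add]; refine (norm_add_le _ _).trans ?_; linarith [q1 D]
  have hE2 : ‖A₂ Z‖ ≤ 51 / 50 * e := by
    rw [hZ2, map_add]; refine (norm_add_le _ _).trans ?_; linarith [q2 D]
  have hE3 : ‖A₃ Z‖ ≤ 51 / 50 * e := by
    rw [hZ3, map_add]; refine (norm_add_le _ _).trans ?_; linarith [q3 D]
  have hmain : ‖D - (η : ℂ) • T.lin D‖ ≤ (1 - η + 0.02 * η) * e := by
    have h := T.norm_sub_lin_sq_le h0 h1 D
    refine pow_le_pow_iff_left₀ (norm_nonneg _) (by nlinarith) two_ne_zero |>.1 (h.trans ?_)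
    have h2 : ‖T.normalPart D‖ ^ 2 ≤ (3 / 100 * e) ^ 2 := by gcongr
    have : 2 * η * ‖T.normalPart D‖ ^ 2 ≤ 2 * η * (3 / 100 * e) ^ 2 := by gcongr
    have h3 : 0 ≤ e ^ 2 * η := by positivity
    nlinarith [mul_nonneg h3 (sub_nonneg.2 h1), mul_nonneg h3 h0]
  -- `R`, `R'` and `R''` collect the terms with η², η³ and η⁴ of the expanded product. Each contains
  -- at least one superfluous factor Aᵢ of norm at most 1/50. The losses per unit of η are 0.02
  -- (normal part), 0.08 (noise) and less than 0.13 (these remainders), well below the available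
  -- 0.5.
  set R : H := A₃ C + A₂ C + A₂ (A₃ Z) + A₁ C + A₁ (A₃ Z) + A₁ (A₂ Z) with hR
  set R' : H := A₂ (A₃ C) + A₁ (A₃ C) + A₁ (A₂ C) + A₁ (A₂ (A₃ Z)) with hR'
  set R'' : H := A₁ (A₂ (A₃ C)) with hR''
  have hsum : T.lin D + T.lin N = A₁ Z + A₂ Z + A₃ Z + C := by
    rw [← lin_add, hZ1, hZ2, hZ3, hC, lin]
  have hexp : (Z - (η : ℂ) • C) - (η : ℂ) • A₃ (Z - (η : ℂ) • C) -
        (η : ℂ) • A₂ ((Z - (η : ℂ) • C) - (η : ℂ) • A₃ (Z - (η : ℂ) • C)) -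
        (η : ℂ) • A₁ ((Z - (η : ℂ) • C) - (η : ℂ) • A₃ (Z - (η : ℂ) • C) -
          (η : ℂ) • A₂ ((Z - (η : ℂ) • C) - (η : ℂ) • A₃ (Z - (η : ℂ) • C))) - Zs =
      (D - (η : ℂ) • T.lin D) - (η : ℂ) • T.lin N + (η : ℂ) • (η : ℂ) • R -
        (η : ℂ) • (η : ℂ) • (η : ℂ) • R' + (η : ℂ) • (η : ℂ) • (η : ℂ) • (η : ℂ) • R'' := by
    have e1 : (η : ℂ) • T.lin N = (η : ℂ) • (A₁ Z + A₂ Z + A₃ Z + C) - (η : ℂ) • T.lin D := by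
      rw [← hsum]; module
    rw [e1, hD, hR, hR', hR'']
    simp only [map_sub, map_smul, smul_sub, smul_add]
    abel
  have hRb : ‖R‖ ≤ 6 * (1 / 50 * (51 / 50 * e)) := by
    have a1 := (hA3 C); have a2 := hA2 C; have a3 := hA2 (A₃ Z); have a4 := hA1 C
    have a5 := hA1 (A₃ Z); have a6 := hA1 (A₂ Z)
    rw [hR]
    refine (norm_add_le _ _).trans ?_
    have b1 := norm_add_le (A₃ C + A₂ C + A₂ (A₃ Z) + A₁ C) (A₁ (A₃ Z))
    have b2 := norm_add_le (A₃ C + A₂ C + A₂ (A₃ Z)) (A₁ C)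
    have b3 := norm_add₃_le (a := A₃ C) (b := A₂ C) (c := A₂ (A₃ Z))
    linarith
  have hRb' : ‖R'‖ ≤ 4 * (1 / 50 * (1 / 50 * (51 / 50 * e))) := by
    have a1 := hA2 (A₃ C); have a2 := hA1 (A₃ C); have a3 := hA1 (A₂ C)
    have a4 := hA1 (A₂ (A₃ Z)); have a5 := hA2 (A₃ Z); have a6 := hA3 C; have a7 := hA2 C
    rw [hR']
    refine (norm_add_le _ _).trans ?_
    have b3 := norm_add₃_le (a := A₂ (A₃ C)) (b := A₁ (A₃ C)) (c := A₁ (A₂ C))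
    linarith
  have hRb'' : ‖R''‖ ≤ 1 / 50 * (1 / 50 * (1 / 50 * (51 / 50 * e))) := by
    have a1 := hA1 (A₂ (A₃ C)); have a2 := hA2 (A₃ C); have a3 := hA3 C
    linarith
  have hη1 : η ≤ 1 := by linarith
  have hs : ∀ x : H, ‖(η : ℂ) • x‖ = η * ‖x‖ := fun x => by
    rw [norm_smul, Complex.norm_real, Real.norm_of_nonneg h0]
  have hshrink : ∀ t : ℝ, 0 ≤ t → η * t ≤ t := fun t ht => mul_le_of_le_one_left ht hη1
  rw [hexp]
  refine (norm_add_le _ _).trans ?_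
  have c1 := norm_sub_le ((D - (η : ℂ) • T.lin D) - (η : ℂ) • T.lin N + (η : ℂ) • (η : ℂ) • R)
    ((η : ℂ) • (η : ℂ) • (η : ℂ) • R')
  have c2 := norm_add_le ((D - (η : ℂ) • T.lin D) - (η : ℂ) • T.lin N) ((η : ℂ) • (η : ℂ) • R)
  have c3 := norm_sub_le (D - (η : ℂ) • T.lin D) ((η : ℂ) • T.lin N)
  simp only [hs] at c1 c2 c3 ⊢
  have d1 : η * (η * ‖R‖) ≤ η * ‖R‖ := by
    gcongr; exact hshrink _ (norm_nonneg _)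
  have d2 : η * (η * (η * ‖R'‖)) ≤ η * ‖R'‖ := by
    gcongr; exact (hshrink _ (by positivity)).trans (hshrink _ (norm_nonneg _))
  have d3 : η * (η * (η * (η * ‖R''‖))) ≤ η * ‖R''‖ := by
    gcongr; exact (hshrink _ (by positivity)).trans
      ((hshrink _ (by positivity)).trans (hshrink _ (norm_nonneg _)))
  have f1 := mul_le_mul_of_nonneg_left hRb h0
  have f2 := mul_le_mul_of_nonneg_left hRb' h0
  have f3 := mul_le_mul_of_nonneg_left hRb'' h0
  have f4 := mul_le_mul_of_nonneg_left hlinN h0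
  have : 0 ≤ η * e := by positivity
  linarith

end TuckerProjections

/-! ### Singular values -/

section SingularValues

variable {E F : Type*} [NormedAddCommGroup E] [InnerProductSpace ℂ E] [FiniteDimensional ℂ E]
  [NormedAddCommGroup F] [InnerProductSpace ℂ F] [FiniteDimensional ℂ F]

open Module

lemma re_inner_self_apply_eq_sum {T : E →ₗ[ℂ] E} (hT : T.IsSymmetric) (v : E) :
    RCLike.re (inner ℂ v (T v)) =
      ∑ i, hT.eigenvalues rfl i * ‖inner ℂ (hT.eigenvectorBasis rfl i) v‖ ^ 2 := by
  rw [← (hT.eigenvectorBasis rfl).sum_inner_mul_inner, map_sum]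
  refine Finset.sum_congr rfl fun i _ => ?_
  rw [← OrthonormalBasis.repr_apply_apply _ (T v), hT.eigenvectorBasis_apply_self_apply,
    OrthonormalBasis.repr_apply_apply, mul_left_comm, ← inner_conj_symm, RCLike.conj_mul]
  norm_cast

lemma re_inner_self_apply_le {T : E →ₗ[ℂ] E} (hT : T.IsSymmetric) {c : ℝ}
    (hc : ∀ (τ : ℝ) (x : E), x ≠ 0 → T x = (τ : ℂ) • x → τ ≤ c) (v : E) :
    RCLike.re (inner ℂ v (T v)) ≤ c * ‖v‖ ^ 2 := by
  rw [re_inner_self_apply_eq_sum hT, ← (hT.eigenvectorBasis rfl).sum_sq_norm_inner_right v,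
    Finset.mul_sum]
  gcongr with i
  exact hc _ _ (hT.hasEigenvector_eigenvectorBasis rfl i).2 (hT.apply_eigenvectorBasis rfl i)

/-- The right singular vectors of a linear map. -/
def rightSingular (f : E →ₗ[ℂ] F) : OrthonormalBasis (Fin (finrank ℂ E)) ℂ E :=
  f.isSymmetric_adjoint_comp_self.eigenvectorBasis rfl

lemma norm_apply_sq_eq_sum (f : E →ₗ[ℂ] F) (v : E) :
    ‖f v‖ ^ 2 = ∑ i : Fin (finrank ℂ E), f.singularValues i ^ 2 * ‖inner ℂ (rightSingular f i) v‖ ^ 2 := by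
  have h := re_inner_self_apply_eq_sum f.isSymmetric_adjoint_comp_self v
  rw [LinearMap.comp_apply, LinearMap.adjoint_inner_right, inner_self_eq_norm_sq] at h
  rw [h]
  simp only [rightSingular, LinearMap.sq_singularValues_fin f rfl]

lemma norm_apply_le_singularValues_zero (f : E →ₗ[ℂ] F) (v : E) :
    ‖f v‖ ≤ f.singularValues 0 * ‖v‖ := by
  have h0 := f.singularValues_nonneg 0
  refine pow_le_pow_iff_left₀ (norm_nonneg _) (by positivity) two_ne_zero |>.1 ?_
  rw [norm_apply_sq_eq_sum, mul_pow, ← (rightSingular f).sum_sq_norm_inner_right v,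
    Finset.mul_sum]
  gcongr with i
  · exact f.singularValues_nonneg _
  · exact f.singularValues_antitone (Nat.zero_le _)

lemma apply_rightSingular_eq_zero (f : E →ₗ[ℂ] F) (i : Fin (finrank ℂ E))
    (h : f.singularValues i = 0) : f (rightSingular f i) = 0 := by
  have h2 := norm_apply_sq_eq_sum f (rightSingular f i)
  rw [Finset.sum_eq_single i] at h2
  · rw [h] at h2; simpa using h2
  · intro j _ hj
    rw [(rightSingular f).inner_eq_zero hj]; simp
  · simp

/-- Right singular vectors of index at least the rank lie in the kernel, so v has no component along
them; the remaining singular values are at least the last nonzero one. -/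
lemma singularValues_mul_norm_le {f : E →ₗ[ℂ] F} {v : E} (hv : v ∈ (LinearMap.ker f)ᗮ) :
    f.singularValues (finrank ℂ f.range - 1) * ‖v‖ ≤ ‖f v‖ := by
  have h0 := f.singularValues_nonneg (finrank ℂ f.range - 1)
  refine pow_le_pow_iff_left₀ (by positivity) (norm_nonneg _) two_ne_zero |>.1 ?_
  rw [norm_apply_sq_eq_sum, mul_pow, ← (rightSingular f).sum_sq_norm_inner_right v,
    Finset.mul_sum]
  refine Finset.sum_le_sum fun i _ => ?_
  by_cases hi : (i : ℕ) < finrank ℂ f.range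
  · gcongr
    exact f.singularValues_antitone (by omega)
  · have hk : f (rightSingular f i) = 0 := apply_rightSingular_eq_zero f i
      (f.singularValues_eq_zero_iff_le_finrank_range.2 (by omega))
    rw [(Submodule.mem_orthogonal _ _).1 hv _ hk]
    simp

/-- `k + 1` orthogonal vectors whose images under `f` are orthogonal and at least `√τ` times as
long force the `k`-th squared singular value of `f` to be at least `τ`. -/
lemma le_sq_singularValues_of_orthogonal (f : E →ₗ[ℂ] F) {k : ℕ} {τ : ℝ} (z : Fin (k + 1) → E)
    (horth : ∀ c : Fin (k + 1) → ℂ, τ * ‖∑ i, c i • z i‖ ^ 2 ≤ ‖f (∑ i, c i • z i)‖ ^ 2)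
    (hli : LinearIndependent ℂ z) : τ ≤ f.singularValues k ^ 2 := by
  have hkn : k < finrank ℂ E := by
    have := hli.fintype_card_le_finrank
    simpa using this
  -- The Courant–Fischer argument: k linear conditions on k + 1 coefficients leave a nonzero
  -- combination orthogonal to the first k right singular vectors, and on it f stretches by at most
  -- the k-th singular value.
  let g : (Fin (k + 1) → ℂ) →ₗ[ℂ] (Fin k → ℂ) :=
    LinearMap.pi fun i : Fin k => (innerₛₗ ℂ (rightSingular f ⟨i, by omega⟩)) ∘ₗ
      (Fintype.linearCombination ℂ z)
  obtain ⟨c, hc, hc0⟩ := (Submodule.ne_bot_iff _).1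
    (LinearMap.ker_ne_bot_of_finrank_lt (f := g) (by simp))
  set w := ∑ i, c i • z i with hw
  have hw0 : w ≠ 0 := fun h => hc0 (funext fun i => (Fintype.linearIndependent_iff.1 hli) c h i)
  have hin : ∀ i : Fin (finrank ℂ E), (i : ℕ) < k → inner ℂ (rightSingular f i) w = 0 := by
    intro i hi
    have := congrFun (LinearMap.mem_ker.1 hc) ⟨i, hi⟩
    simpa [g, Fintype.linearCombination_apply] using this
  have hup : ‖f w‖ ^ 2 ≤ f.singularValues k ^ 2 * ‖w‖ ^ 2 := by
    rw [norm_apply_sq_eq_sum, ← (rightSingular f).sum_sq_norm_inner_right w, Finset.mul_sum]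
    refine Finset.sum_le_sum fun i _ => ?_
    by_cases hi : (i : ℕ) < k
    · rw [hin i hi]; simp
    · gcongr
      · exact f.singularValues_nonneg _
      · exact f.singularValues_antitone (by omega)
  have hpos : 0 < ‖w‖ ^ 2 := by positivity
  exact le_of_mul_le_mul_right ((horth c).trans hup) hpos

lemma norm_sq_sum_smul_of_orthogonal {ι : Type*} [Fintype ι] {e : ι → E}
    (he : ∀ i j, i ≠ j → inner ℂ (e i) (e j) = 0) (c : ι → ℂ) :
    ‖∑ i, c i • e i‖ ^ 2 = ∑ i, ‖c i‖ ^ 2 * ‖e i‖ ^ 2 := by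
  classical
  rw [← inner_self_eq_norm_sq (𝕜 := ℂ), sum_inner, map_sum]
  refine Finset.sum_congr rfl fun i _ => ?_
  rw [inner_sum, Finset.sum_eq_single i, inner_smul_left, inner_smul_right, ← mul_assoc,
    RCLike.conj_mul, inner_self_eq_norm_sq_to_K]
  · norm_cast
  · intro j _ hj
    rw [inner_smul_left, inner_smul_right, he i j hj.symm]; simp
  · simp

/-- If the `uⱼ` are top left singular vectors of `f`, then the adjoint of `f` is bounded, on the
orthogonal complement of the `uⱼ`, by the distance of `f` to the maps of rank at most `r`. -/
theorem norm_adjoint_apply_le_of_top_singular {f fs : E →ₗ[ℂ] F} {r : ℕ} {u : Fin r → F}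
    (hu : Orthonormal ℂ u)
    (hev : ∀ j : Fin r, f (LinearMap.adjoint f (u j)) = ((f.singularValues j ^ 2 : ℝ) : ℂ) • u j)
    (hrank : finrank ℂ fs.range ≤ r) {δ : ℝ} (hδ0 : 0 ≤ δ)
    (hδ : ∀ y, ‖LinearMap.adjoint f y - LinearMap.adjoint fs y‖ ≤ δ * ‖y‖) {x : F}
    (hx : ∀ j, inner ℂ (u j) x = 0) : ‖LinearMap.adjoint f x‖ ≤ δ * ‖x‖ := by
  set g := LinearMap.adjoint f with hg
  have hfg : (f ∘ₗ g).IsSymmetric := LinearMap.isSymmetric_self_comp_adjoint f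
  let W : Submodule ℂ F := (Submodule.span ℂ (Set.range u))ᗮ
  have hW : ∀ y : F, y ∈ W ↔ ∀ j, inner ℂ (u j) y = 0 := by
    intro y
    rw [Submodule.mem_orthogonal]
    refine ⟨fun h j => h _ (Submodule.subset_span ⟨j, rfl⟩), fun h v hv => ?_⟩
    induction hv using Submodule.span_induction with
    | mem v hv => obtain ⟨j, rfl⟩ := hv; exact h j
    | zero => simp
    | add v w _ _ hv hw => rw [inner_add_left, hv, hw, add_zero]
    | smul c v _ hv => rw [inner_smul_left, hv, mul_zero]
  have hinv : ∀ y ∈ W, (f ∘ₗ g) y ∈ W := by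
    intro y hy
    rw [hW] at hy ⊢
    intro j
    rw [← hfg, LinearMap.comp_apply, hev, inner_smul_left, hy, mul_zero]
  -- It suffices to bound the eigenvalues of f f* on the invariant complement W, since f f*
  -- restricted to W is symmetric.
  have key : ∀ (τ : ℝ) (y : F), y ∈ W → y ≠ 0 → f (g y) = (τ : ℂ) • y → τ ≤ δ ^ 2 := by
    intro τ y hyW hy0 hy
    by_contra! hlt
    have hτ : 0 < τ := (sq_nonneg δ).trans_lt hlt
    rw [hW] at hyW
    -- the eigenvectors `u₀, …, u_{k-1}, y`
    have aux : ∀ (k : ℕ) (hk : k ≤ r), (∀ j, j < k → τ ≤ f.singularValues j ^ 2) →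
        ∃ (e : Fin (k + 1) → F) (t : Fin (k + 1) → ℝ), (∀ i, e i ≠ 0) ∧
          (∀ i j, i ≠ j → inner ℂ (e i) (e j) = 0) ∧ (∀ i, τ ≤ t i) ∧
          (∀ i, f (g (e i)) = (t i : ℂ) • e i) := by
      intro k hk hkt
      refine ⟨Fin.snoc (fun i : Fin k => u ⟨i, by omega⟩) y,
        Fin.snoc (fun i : Fin k => f.singularValues i ^ 2) τ, ?_, ?_, ?_, ?_⟩
      · intro i
        refine Fin.lastCases ?_ (fun i => ?_) i
        · simpa using hy0
        · simpa using hu.ne_zero _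
      · intro i j
        refine Fin.lastCases ?_ (fun i => ?_) i
        · refine Fin.lastCases (fun h => absurd rfl h) (fun j _ => ?_) j
          simp only [Fin.snoc_last, Fin.snoc_castSucc]
          rw [← inner_conj_symm, hyW, map_zero]
        · refine Fin.lastCases (fun _ => ?_) (fun j hij => ?_) j
          · simp only [Fin.snoc_last, Fin.snoc_castSucc]
            exact hyW _
          · simp only [Fin.snoc_castSucc]
            refine hu.2 fun h => hij ?_
            simp only [Fin.mk.injEq] at h
            rw [Fin.ext h]
      · intro i
        refine Fin.lastCases ?_ (fun i => ?_) i
        · simp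
        · simpa using hkt i i.isLt
      · intro i
        refine Fin.lastCases ?_ (fun i => ?_) i
        · simpa using hy
        · simpa using hev ⟨i, by omega⟩
    have horthg : ∀ {k : ℕ} (e : Fin (k + 1) → F) (t : Fin (k + 1) → ℝ),
        (∀ i j, i ≠ j → inner ℂ (e i) (e j) = 0) → (∀ i, f (g (e i)) = (t i : ℂ) • e i) →
        (∀ i j, i ≠ j → inner ℂ (g (e i)) (g (e j)) = 0) ∧
          ∀ i, ‖g (e i)‖ ^ 2 = t i * ‖e i‖ ^ 2 := by
      intro k e t he ht
      have h : ∀ i j, inner ℂ (g (e i)) (g (e j)) = t j * inner ℂ (e i) (e j) := by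
        intro i j
        rw [hg, LinearMap.adjoint_inner_left, ← hg, ht, inner_smul_right]
      refine ⟨fun i j hij => by rw [h, he i j hij, mul_zero], fun i => ?_⟩
      have hre : ∀ z : ℂ, RCLike.re ((t i : ℂ) * z) = t i * RCLike.re z := fun z => by simp
      rw [← inner_self_eq_norm_sq (𝕜 := ℂ), h, hre, inner_self_eq_norm_sq]
    -- If some listed singular value has square below τ, let k be the first such index. Then u₀, …,
    -- u_{k-1}, y are k + 1 orthogonal eigenvectors with eigenvalues at least τ, which forces the
    -- k-th squared singular value up to τ: the list would not have been the top one.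
    by_cases hB : ∃ j, j < r ∧ f.singularValues j ^ 2 < τ
    · classical
      obtain ⟨hkr, hkτ⟩ := Nat.find_spec hB
      set k := Nat.find hB with hk
      obtain ⟨e, t, he0, he, ht, het⟩ := aux k hkr.le fun j hj => by
        by_contra! hcon
        exact Nat.find_min hB hj ⟨hj.trans hkr, hcon⟩
      obtain ⟨ho, hn⟩ := horthg e t he het
      refine absurd (le_sq_singularValues_of_orthogonal f (τ := τ) (fun i => g (e i)) ?_ ?_)
        (not_le.2 hkτ)
      · intro c
        have h1 : f (∑ i, c i • g (e i)) = ∑ i, (c i * t i) • e i := by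
          rw [map_sum]
          refine Finset.sum_congr rfl fun i _ => ?_
          rw [map_smul, het, smul_smul]
        rw [h1, norm_sq_sum_smul_of_orthogonal ho, norm_sq_sum_smul_of_orthogonal he,
          Finset.mul_sum]
        refine Finset.sum_le_sum fun i _ => ?_
        have hti := ht i
        rw [hn, norm_mul, Complex.norm_real, Real.norm_of_nonneg (hτ.le.trans hti)]
        have : 0 ≤ ‖c i‖ ^ 2 * ‖e i‖ ^ 2 * t i := by
          have := hτ.le.trans hti
          positivity
        nlinarith [mul_le_mul_of_nonneg_left hti this]
      · refine linearIndependent_of_ne_zero_of_inner_eq_zero (fun i hi => ?_)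
          (fun i j hij => ho i j hij)
        have h2 := hn i
        rw [hi, norm_zero] at h2
        have : 0 < t i * ‖e i‖ ^ 2 := by
          have := he0 i; have := hτ.trans_le (ht i); positivity
        linarith
    · push Not at hB
      obtain ⟨e, t, he0, he, ht, het⟩ := aux r le_rfl hB
      obtain ⟨ho, hn⟩ := horthg e t he het
      have hli : LinearIndependent ℂ e :=
        linearIndependent_of_ne_zero_of_inner_eq_zero he0 (fun i j hij => he i j hij)
      -- Otherwise u₀, …, u_{r-1}, y span r + 1 dimensions, while the adjoint of `fs` has rank at
      -- most r and kills some nonzero vector of this span. On that vector the adjoint of f equals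
      -- its distance from the adjoint of `fs`, which contradicts τ > δ².
      let L : (Fin (r + 1) → ℂ) →ₗ[ℂ] (LinearMap.adjoint fs).range :=
        (LinearMap.adjoint fs).rangeRestrict ∘ₗ (Fintype.linearCombination ℂ e)
      obtain ⟨c, hc, hc0⟩ := (Submodule.ne_bot_iff _).1
        (LinearMap.ker_ne_bot_of_finrank_lt (f := L) (by
          rw [LinearMap.finrank_range_adjoint]; simp; omega))
      set w := ∑ i, c i • e i with hw
      have hw0 : w ≠ 0 := fun h => hc0 (funext fun i => (Fintype.linearIndependent_iff.1 hli) c h i)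
      have hfs : LinearMap.adjoint fs w = 0 := by
        have := congrArg Subtype.val (LinearMap.mem_ker.1 hc)
        rw [hw, map_sum]
        simpa [L, Fintype.linearCombination_apply] using this
      have h1 := hδ w
      rw [hfs, sub_zero] at h1
      have h2 : τ * ‖w‖ ^ 2 ≤ ‖g w‖ ^ 2 := by
        have h3 : g w = ∑ i, c i • g (e i) := by
          rw [hw, map_sum]; exact Finset.sum_congr rfl fun i _ => map_smul _ _ _
        rw [h3, hw, norm_sq_sum_smul_of_orthogonal ho, norm_sq_sum_smul_of_orthogonal he,
          Finset.mul_sum]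
        refine Finset.sum_le_sum fun i _ => ?_
        rw [hn]
        have : 0 ≤ ‖c i‖ ^ 2 * ‖e i‖ ^ 2 := by positivity
        nlinarith [mul_le_mul_of_nonneg_left (ht i) this]
      have h4 : ‖g w‖ ^ 2 ≤ (δ * ‖w‖) ^ 2 := by gcongr
      have hpos : 0 < ‖w‖ ^ 2 := by positivity
      nlinarith
  have hsymm : ((f ∘ₗ g).restrict hinv).IsSymmetric := hfg.restrict_invariant hinv
  have hfin := re_inner_self_apply_le hsymm (c := δ ^ 2)
    (fun τ y hy h => key τ y y.2 (by simpa using hy) (by simpa using congrArg Subtype.val h))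
    ⟨x, (hW x).2 hx⟩
  have h5 : ‖g x‖ ^ 2 ≤ δ ^ 2 * ‖x‖ ^ 2 := by
    have : RCLike.re (inner ℂ x (f (g x))) = ‖g x‖ ^ 2 := by
      rw [hg, ← LinearMap.adjoint_inner_left, inner_self_eq_norm_sq]
    rw [← this]
    exact hfin
  rw [← mul_pow] at h5
  exact pow_le_pow_iff_left₀ (norm_nonneg _) (by positivity) two_ne_zero |>.1 h5

/-- A map of rank at most `r` close to one of rank `r` is bounded below on the orthogonal complement
of its kernel. -/
theorem mul_norm_le_norm_apply_of_close {f fs : E →ₗ[ℂ] F} {σ e : ℝ} (he : e < σ)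
    (hfs : ∀ v ∈ (LinearMap.ker fs)ᗮ, σ * ‖v‖ ≤ ‖fs v‖)
    (hrank : finrank ℂ f.range ≤ finrank ℂ fs.range) (hclose : ∀ v, ‖f v - fs v‖ ≤ e * ‖v‖) :
    finrank ℂ f.range = finrank ℂ fs.range ∧
      ∀ v ∈ (LinearMap.ker f)ᗮ, (σ - e) * ‖v‖ ≤ ‖f v‖ := by
  -- The orthogonal projection does not change values of f. The lower bound for f along (ker fs)ᗮ
  -- makes p injective, the rank hypothesis then makes it bijective, and p does not increase norms.
  -- So the lower bound carries over to all of (ker f)ᗮ.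
  let p : (LinearMap.ker fs)ᗮ →ₗ[ℂ] (LinearMap.ker f)ᗮ :=
    ((LinearMap.ker f)ᗮ.orthogonalProjectionOnto : E →ₗ[ℂ] (LinearMap.ker f)ᗮ) ∘ₗ
      (LinearMap.ker fs)ᗮ.subtype
  have hfp : ∀ v, f (p v) = f v := by
    intro v
    have h : (v : E) - p v ∈ (LinearMap.ker f)ᗮᗮ :=
      Submodule.sub_starProjection_mem_orthogonal (K := (LinearMap.ker f)ᗮ) (v : E)
    rw [Submodule.orthogonal_orthogonal, LinearMap.mem_ker, map_sub, sub_eq_zero] at h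
    exact h.symm
  have hlow : ∀ v : (LinearMap.ker fs)ᗮ, (σ - e) * ‖(v : E)‖ ≤ ‖f (p v)‖ := by
    intro v
    have h1 := hfs v v.2
    have h2 := hclose v
    have h3 := norm_sub_norm_le (fs v) (fs v - f v)
    rw [sub_sub_cancel, norm_sub_rev] at h3
    rw [hfp]
    linarith
  have hinj : Function.Injective p := by
    rw [injective_iff_map_eq_zero]
    intro v hv
    have h := hlow v
    rw [hv] at h
    simp only [ZeroMemClass.coe_zero, map_zero, norm_zero] at h
    have h4 : ‖(v : E)‖ ≤ 0 := by
      by_contra! h5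
      have := mul_pos (sub_pos.2 he) h5
      linarith
    exact Subtype.ext (norm_le_zero_iff.1 h4)
  have hfr : ∀ h : E →ₗ[ℂ] F, finrank ℂ (LinearMap.ker h)ᗮ = finrank ℂ h.range := by
    intro h
    have h1 := (LinearMap.ker h).finrank_add_finrank_orthogonal
    have h2 := h.finrank_range_add_finrank_ker
    omega
  have hle := LinearMap.finrank_le_finrank_of_injective hinj
  rw [hfr, hfr] at hle
  have heq := le_antisymm hrank hle
  refine ⟨heq, fun v hv => ?_⟩
  have hsurj : Function.Surjective p := by
    rw [← LinearMap.injective_iff_surjective_of_finrank_eq_finrank (by rw [hfr, hfr, heq])]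
    exact hinj
  obtain ⟨w, hw⟩ := hsurj ⟨v, hv⟩
  have hwv : ((p w : (LinearMap.ker f)ᗮ) : E) = v := by rw [hw]
  have h := hlow w
  rw [hwv] at h
  refine le_trans ?_ h
  have hpn : ‖v‖ ≤ ‖(w : E)‖ := by
    rw [← hwv]
    exact Submodule.norm_orthogonalProjectionOnto_apply_le (LinearMap.ker f)ᗮ (w : E)
  have := sub_pos.2 he
  gcongr

end SingularValues

/-! ### Frobenius and operator norms of matrices -/


section MatrixNorms

open scoped Matrix.Norms.L2Operator ComplexOrder

variable {ι κ μ : Type*} [Fintype ι] [Fintype κ] [Fintype μ]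

/-- The entries of a matrix as a vector of a Euclidean space. -/
def mvec : Matrix ι κ ℂ ≃ₗ[ℂ] EuclideanSpace ℂ (ι × κ) where
  toFun M := WithLp.toLp 2 fun q => M q.1 q.2
  invFun v := Matrix.of fun i j => v (i, j)
  map_add' _ _ := rfl
  map_smul' _ _ := rfl
  left_inv _ := rfl
  right_inv _ := rfl

lemma frobNorm_eq_norm_mvec (M : Matrix ι κ ℂ) : frobNorm M = ‖mvec M‖ := by
  rw [frobNorm, EuclideanSpace.norm_eq, Fintype.sum_prod_type]; rfl

lemma frobNorm_nonneg (M : Matrix ι κ ℂ) : 0 ≤ frobNorm M := Real.sqrt_nonneg _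

lemma rowNorm_nonneg (M : Matrix ι κ ℂ) (i : ι) : 0 ≤ rowNorm M i := Real.sqrt_nonneg _

lemma frobNorm_sq (M : Matrix ι κ ℂ) : frobNorm M ^ 2 = ∑ i, ∑ j, ‖M i j‖ ^ 2 :=
  Real.sq_sqrt (by positivity)

lemma rowNorm_sq (M : Matrix ι κ ℂ) (i : ι) : rowNorm M i ^ 2 = ∑ j, ‖M i j‖ ^ 2 :=
  Real.sq_sqrt (by positivity)

lemma norm_apply_le_rowNorm (M : Matrix ι κ ℂ) (i : ι) (j : κ) : ‖M i j‖ ≤ rowNorm M i := by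
  refine pow_le_pow_iff_left₀ (norm_nonneg _) (rowNorm_nonneg _ _) two_ne_zero |>.1 ?_
  rw [rowNorm_sq]
  exact Finset.single_le_sum (f := fun j => ‖M i j‖ ^ 2) (fun i _ => sq_nonneg _)
    (Finset.mem_univ j)

lemma frobNorm_conjTranspose (M : Matrix ι κ ℂ) : frobNorm Mᴴ = frobNorm M := by
  rw [frobNorm, frobNorm, Finset.sum_comm]
  simp [Matrix.conjTranspose_apply]

lemma frobNorm_neg (M : Matrix ι κ ℂ) : frobNorm (-M) = frobNorm M := by
  simp [frobNorm_eq_norm_mvec]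

variable [DecidableEq ι] [DecidableEq κ] [DecidableEq μ]

lemma norm_toEuclideanLin_le (M : Matrix ι κ ℂ) (v : EuclideanSpace ℂ κ) :
    ‖Matrix.toEuclideanLin M v‖ ≤ ‖M‖ * ‖v‖ := Matrix.l2_opNorm_mulVec M v

lemma opNorm_le_of_forall {M : Matrix ι κ ℂ} {c : ℝ} (hc : 0 ≤ c)
    (h : ∀ v, ‖Matrix.toEuclideanLin M v‖ ≤ c * ‖v‖) : ‖M‖ ≤ c := by
  rw [Matrix.l2_opNorm_def]
  exact ContinuousLinearMap.opNorm_le_bound _ hc h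

lemma norm_toLp_col_le (A : Matrix ι κ ℂ) (B : Matrix κ μ ℂ) (j : μ) :
    ‖WithLp.toLp 2 ((A * B)ᵀ j)‖ ≤ ‖A‖ * ‖WithLp.toLp 2 (Bᵀ j)‖ := by
  have h := norm_toEuclideanLin_le A (WithLp.toLp 2 (Bᵀ j))
  exact h

lemma frobNorm_sq_eq_sum_col (M : Matrix ι κ ℂ) :
    frobNorm M ^ 2 = ∑ j, ‖WithLp.toLp 2 (Mᵀ j)‖ ^ 2 := by
  rw [frobNorm_sq, Finset.sum_comm]
  refine Finset.sum_congr rfl fun j _ => ?_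
  rw [EuclideanSpace.norm_sq_eq]
  rfl

lemma frobNorm_mul_le_opNorm_mul (A : Matrix ι κ ℂ) (B : Matrix κ μ ℂ) :
    frobNorm (A * B) ≤ ‖A‖ * frobNorm B := by
  have hB := frobNorm_nonneg B
  refine pow_le_pow_iff_left₀ (frobNorm_nonneg _) (by positivity) two_ne_zero |>.1 ?_
  rw [mul_pow, frobNorm_sq_eq_sum_col, frobNorm_sq_eq_sum_col, Finset.mul_sum]
  refine Finset.sum_le_sum fun j _ => ?_
  rw [← mul_pow]
  exact pow_le_pow_left₀ (norm_nonneg _) (norm_toLp_col_le A B j) 2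

lemma frobNorm_mul_le_mul_opNorm (A : Matrix ι κ ℂ) (B : Matrix κ μ ℂ) :
    frobNorm (A * B) ≤ frobNorm A * ‖B‖ := by
  rw [← frobNorm_conjTranspose, Matrix.conjTranspose_mul, mul_comm (frobNorm A),
    ← frobNorm_conjTranspose A, ← Matrix.l2_opNorm_conjTranspose B]
  exact frobNorm_mul_le_opNorm_mul _ _

lemma rowNorm_eq_frobNorm_row (M : Matrix ι κ ℂ) (i : ι) :
    rowNorm M i = frobNorm (Matrix.of fun (_ : Unit) j => M i j) := by
  simp [rowNorm, frobNorm]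

lemma rowNorm_mul_le (A : Matrix ι κ ℂ) (B : Matrix κ μ ℂ) (i : ι) :
    rowNorm (A * B) i ≤ rowNorm A i * ‖B‖ := by
  simp only [rowNorm_eq_frobNorm_row]
  exact frobNorm_mul_le_mul_opNorm (Matrix.of fun (_ : Unit) j => A i j) B

lemma opNorm_le_frobNorm (M : Matrix ι κ ℂ) : ‖M‖ ≤ frobNorm M := by
  refine opNorm_le_of_forall (frobNorm_nonneg _) fun v => ?_
  have hM := frobNorm_nonneg M
  refine pow_le_pow_iff_left₀ (norm_nonneg _) (by positivity) two_ne_zero |>.1 ?_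
  rw [EuclideanSpace.norm_sq_eq, mul_pow, frobNorm_sq, EuclideanSpace.norm_sq_eq, Finset.sum_mul]
  refine Finset.sum_le_sum fun i _ => ?_
  have h1 : ‖Matrix.toEuclideanLin M v i‖ ≤ ∑ j, ‖M i j‖ * ‖v j‖ := by
    have : Matrix.toEuclideanLin M v i = ∑ j, M i j * v j := rfl
    rw [this]
    refine (norm_sum_le _ _).trans (Finset.sum_le_sum fun j _ => (norm_mul _ _).le)
  calc ‖Matrix.toEuclideanLin M v i‖ ^ 2 ≤ (∑ j, ‖M i j‖ * ‖v j‖) ^ 2 := by gcongr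
    _ ≤ _ := Finset.sum_mul_sq_le_sq_mul_sq _ _ _

lemma opNorm_le_matSigmaMax (M : Matrix ι κ ℂ) : ‖M‖ ≤ matSigmaMax M :=
  opNorm_le_of_forall (LinearMap.singularValues_nonneg _ _)
    fun v => norm_apply_le_singularValues_zero _ v

lemma finrank_range_toEuclideanLin (M : Matrix ι κ ℂ) :
    Module.finrank ℂ (Matrix.toEuclideanLin M).range = M.rank := by
  rw [Matrix.toEuclideanLin_eq_toLin_orthonormal]
  exact (Matrix.rank_eq_finrank_range_toLin M _ _).symm

/-- A matrix of rank `r` has Frobenius norm at most `√r` times its operator norm. -/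
lemma frobNorm_le_sqrt_rank_mul (M : Matrix ι κ ℂ) : frobNorm M ≤ √M.rank * ‖M‖ := by
  refine pow_le_pow_iff_left₀ (frobNorm_nonneg _) (by positivity) two_ne_zero |>.1 ?_
  set f := Matrix.toEuclideanLin M with hf
  set b := rightSingular f with hb
  -- The Frobenius norm may be computed in the basis of right singular vectors, where only the first
  -- rank-many images are nonzero.
  have h1 : frobNorm M ^ 2 = ∑ k, ‖f (b k)‖ ^ 2 := by
    have h2 : ∀ i, ∑ j, ‖M i j‖ ^ 2 = ∑ k, ‖f (b k) i‖ ^ 2 := by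
      intro i
      have h3 : ∀ v, inner ℂ (WithLp.toLp 2 (fun j => star (M i j))) v = f v i := by
        intro v
        rw [hf, PiLp.inner_apply]
        have : Matrix.toEuclideanLin M v i = ∑ j, M i j * v j := rfl
        rw [this]
        refine Finset.sum_congr rfl fun j _ => ?_
        simp [mul_comm]
      calc ∑ j, ‖M i j‖ ^ 2 = ‖WithLp.toLp 2 (fun j => star (M i j))‖ ^ 2 := by
            rw [EuclideanSpace.norm_sq_eq]; simp
        _ = _ := by
            rw [← b.sum_sq_norm_inner_left]
            simp only [h3]
    rw [frobNorm_sq]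
    simp only [h2]
    rw [Finset.sum_comm]
    refine Finset.sum_congr rfl fun k _ => ?_
    rw [EuclideanSpace.norm_sq_eq]
  have h4 : ∀ k : Fin (Module.finrank ℂ (EuclideanSpace ℂ κ)),
      ‖f (b k)‖ ^ 2 ≤ if (k : ℕ) < M.rank then ‖M‖ ^ 2 else 0 := by
    intro k
    split_ifs with hk
    · have := norm_toEuclideanLin_le M (b k)
      rw [b.norm_eq_one, mul_one] at this
      gcongr
    · rw [hb, apply_rightSingular_eq_zero f k
        (f.singularValues_eq_zero_iff_le_finrank_range.2 (by
          rw [hf, finrank_range_toEuclideanLin]; omega))]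
      simp
  rw [h1, mul_pow, Real.sq_sqrt (by positivity)]
  refine (Finset.sum_le_sum fun k _ => h4 k).trans ?_
  rw [← Finset.sum_filter, Finset.sum_const, nsmul_eq_mul]
  gcongr
  have : (Finset.univ.filter fun k : Fin (Module.finrank ℂ (EuclideanSpace ℂ κ)) =>
      (k : ℕ) < M.rank).card ≤ (Finset.range M.rank).card := by
    refine Finset.card_le_card_of_injOn (fun k => (k : ℕ)) (fun k hk => ?_)
      (fun a _ b _ h => Fin.ext h)
    simpa using hk
  simpa using this

/-! ### Projections and pseudo-inverses attached to a factorization -/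

section Factorization

variable {ρ : Type*} [Fintype ρ] [DecidableEq ρ]

/-- The orthogonal projection onto the column space of a matrix of full column rank. -/
def colProj (L : Matrix ι ρ ℂ) : Matrix ι ι ℂ := L * (Lᴴ * L)⁻¹ * Lᴴ

/-- The pseudo-inverse of `L * Bᴴ`, for `L` and `B` of full column rank. -/
def pinvFactor (L : Matrix ι ρ ℂ) (B : Matrix κ ρ ℂ) : Matrix κ ι ℂ :=
  B * (Bᴴ * B)⁻¹ * ((Lᴴ * L)⁻¹ * Lᴴ)

variable {L : Matrix ι ρ ℂ} {B : Matrix κ ρ ℂ}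

lemma colProj_mul_self (hL : IsUnit (Lᴴ * L).det) : colProj L * L = L := by
  rw [colProj, Matrix.mul_assoc, Matrix.mul_assoc, Matrix.nonsing_inv_mul _ hL, Matrix.mul_one]

lemma conjTranspose_mul_colProj (hL : IsUnit (Lᴴ * L).det) : Lᴴ * colProj L = Lᴴ := by
  rw [colProj, ← Matrix.mul_assoc, ← Matrix.mul_assoc, Matrix.mul_nonsing_inv _ hL, Matrix.one_mul]

lemma conjTranspose_colProj : (colProj L)ᴴ = colProj L := by
  simp [colProj, Matrix.conjTranspose_nonsing_inv, Matrix.mul_assoc]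

lemma colProj_mul_colProj (hL : IsUnit (Lᴴ * L).det) : colProj L * colProj L = colProj L := by
  nth_rewrite 2 [colProj]
  rw [← Matrix.mul_assoc, ← Matrix.mul_assoc, colProj_mul_self hL, colProj]

lemma colProj_of_orthonormal (hL : Lᴴ * L = 1) : colProj L = L * Lᴴ := by
  rw [colProj, hL, inv_one, Matrix.mul_one]

lemma mul_pinvFactor (hB : IsUnit (Bᴴ * B).det) : L * Bᴴ * pinvFactor L B = colProj L := by
  rw [pinvFactor, colProj]
  simp only [Matrix.mul_assoc]
  rw [← Matrix.mul_assoc Bᴴ, ← Matrix.mul_assoc (Bᴴ * B), Matrix.mul_nonsing_inv _ hB,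
    Matrix.one_mul]

lemma pinvFactor_mul (hL : IsUnit (Lᴴ * L).det) : pinvFactor L B * (L * Bᴴ) = colProj B := by
  rw [pinvFactor, colProj]
  simp only [Matrix.mul_assoc]
  rw [← Matrix.mul_assoc Lᴴ, ← Matrix.mul_assoc (Lᴴ * L)⁻¹, Matrix.nonsing_inv_mul _ hL,
    Matrix.one_mul]

lemma colProj_mul_pinvFactor (hB : IsUnit (Bᴴ * B).det) :
    colProj B * pinvFactor L B = pinvFactor L B := by
  rw [pinvFactor, Matrix.mul_assoc B, ← Matrix.mul_assoc (colProj B), colProj_mul_self hB]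

lemma opNorm_le_one_of_projection {P : Matrix ι ι ℂ} (h1 : Pᴴ = P) (h2 : P * P = P) : ‖P‖ ≤ 1 := by
  have h := Matrix.l2_opNorm_conjTranspose_mul_self P
  rw [h1, h2] at h
  rcases (norm_nonneg P).eq_or_lt with h0 | h0
  · rw [← h0]; exact zero_le_one
  · nlinarith

lemma opNorm_one_sub_le_one {P : Matrix ι ι ℂ} (h1 : Pᴴ = P) (h2 : P * P = P) : ‖1 - P‖ ≤ 1 := by
  refine opNorm_le_one_of_projection (by simp [h1]) ?_
  rw [Matrix.sub_mul, Matrix.mul_sub, Matrix.mul_sub, h2]; simp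

lemma isUnit_det_gram_of_rank {L : Matrix ι ρ ℂ} (h : L.rank = Fintype.card ρ) :
    IsUnit (Lᴴ * L).det := by
  rw [← Matrix.isUnit_iff_isUnit_det]
  rw [← Matrix.rank_conjTranspose_mul_self] at h
  have hr := finrank_range_toEuclideanLin (Lᴴ * L)
  rw [h] at hr
  have hsurj : Function.Surjective (Matrix.toEuclideanLin (Lᴴ * L)) := by
    rw [← LinearMap.range_eq_top]
    exact Submodule.eq_top_of_finrank_eq (by rw [hr]; simp)
  rw [← Matrix.mulVec_surjective_iff_isUnit]
  intro y
  obtain ⟨x, hx⟩ := hsurj (WithLp.toLp 2 y)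
  exact ⟨x.ofLp, congrArg WithLp.ofLp hx⟩

/-- A factorization `L * Bᴴ` through `r` dimensions close to a matrix of rank `r` is well
conditioned. -/
theorem factorization_of_close {Ms : Matrix ι κ ℂ} {σ e : ℝ} (he : e < σ)
    (hσ : σ ≤ matSigmaMin Ms) (hr : Ms.rank = Fintype.card ρ) (hclose : ‖L * Bᴴ - Ms‖ ≤ e) :
    IsUnit (Lᴴ * L).det ∧ IsUnit (Bᴴ * B).det ∧ ‖pinvFactor L B‖ ≤ 1 / (σ - e) := by
  set f := Matrix.toEuclideanLin (L * Bᴴ) with hf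
  set fs := Matrix.toEuclideanLin Ms with hfs
  have hrf : Module.finrank ℂ f.range = (L * Bᴴ).rank := finrank_range_toEuclideanLin _
  have hrs : Module.finrank ℂ fs.range = Ms.rank := finrank_range_toEuclideanLin _
  have hle : (L * Bᴴ).rank ≤ Fintype.card ρ :=
    (Matrix.rank_mul_le_left _ _).trans (Matrix.rank_le_card_width _)
  obtain ⟨hrank, hlow⟩ := mul_norm_le_norm_apply_of_close (f := f) (fs := fs) he
    (fun v hv => by
      refine le_trans ?_ (singularValues_mul_norm_le hv)
      rw [hrs]
      have : σ ≤ fs.singularValues (Ms.rank - 1) := hσ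
      gcongr)
    (by rw [hrf, hrs, hr]; exact hle)
    (fun v => by
      have h := norm_toEuclideanLin_le (L * Bᴴ - Ms) v
      rw [map_sub] at h
      exact h.trans (by gcongr))
  rw [hrf, hrs, hr] at hrank
  have hL : IsUnit (Lᴴ * L).det := isUnit_det_gram_of_rank
    (le_antisymm (Matrix.rank_le_card_width _) (hrank ▸ Matrix.rank_mul_le_left L Bᴴ))
  have hB : IsUnit (Bᴴ * B).det := isUnit_det_gram_of_rank
    (le_antisymm (Matrix.rank_le_card_width _)
      (hrank ▸ Matrix.rank_conjTranspose B ▸ Matrix.rank_mul_le_right L Bᴴ))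
  refine ⟨hL, hB, opNorm_le_of_forall (by have := sub_pos.2 he; positivity) fun x => ?_⟩
  -- The values of the pseudo-inverse lie in (ker f)ᗮ, where f is bounded below by σ - e, and f
  -- sends them to `colProj L` x, of norm at most ‖x‖.
  have hmem : Matrix.toEuclideanLin (pinvFactor L B) x ∈ (LinearMap.ker f)ᗮ := by
    rw [Submodule.mem_orthogonal]
    intro v hv
    have e1 : Matrix.toEuclideanLin (pinvFactor L B) x =
        LinearMap.adjoint (Matrix.toEuclideanLin (colProj B))
          (Matrix.toEuclideanLin (pinvFactor L B) x) := by
      rw [← Matrix.toEuclideanLin_conjTranspose_eq_adjoint, conjTranspose_colProj]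
      conv_lhs => rw [← colProj_mul_pinvFactor (L := L) hB]
      exact congrArg (WithLp.toLp 2) (Matrix.mulVec_mulVec _ _ _).symm
    have e2 : Matrix.toEuclideanLin (colProj B) v = 0 := by
      rw [← pinvFactor_mul hL]
      have : Matrix.toEuclideanLin (pinvFactor L B * (L * Bᴴ)) v =
          Matrix.toEuclideanLin (pinvFactor L B) (f v) :=
        congrArg (WithLp.toLp 2) (Matrix.mulVec_mulVec _ _ _).symm
      rw [this, LinearMap.mem_ker.1 hv, map_zero]
    rw [e1, LinearMap.adjoint_inner_right, e2, inner_zero_left]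
  have h1 := hlow _ hmem
  have h2 : f (Matrix.toEuclideanLin (pinvFactor L B) x) = Matrix.toEuclideanLin (colProj L) x := by
    rw [← mul_pinvFactor hB]
    exact congrArg (WithLp.toLp 2) (Matrix.mulVec_mulVec _ _ _)
  have h3 : ‖Matrix.toEuclideanLin (colProj L) x‖ ≤ ‖x‖ := by
    refine (norm_toEuclideanLin_le _ x).trans ?_
    have := opNorm_le_one_of_projection conjTranspose_colProj (colProj_mul_colProj hL)
    exact mul_le_of_le_one_left (norm_nonneg _) this
  rw [h2] at h1
  rw [one_div, inv_mul_eq_div, le_div_iff₀ (sub_pos.2 he), mul_comm]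
  exact h1.trans h3

/-- Second order bound for the part of `Ms` normal to the tangent space at `L * Bᴴ`. -/
theorem frobNorm_normal_le {Ms : Matrix ι κ ℂ} {Ls : Matrix ι ρ ℂ} {Bs : Matrix κ ρ ℂ} {σ : ℝ}
    (hσ0 : 0 < σ) (hσ : σ ≤ matSigmaMin Ms) (hr : Ms.rank = Fintype.card ρ) (hMs : Ms = Ls * Bsᴴ)
    (hL : IsUnit (Lᴴ * L).det) (hB : IsUnit (Bᴴ * B).det) :
    frobNorm ((1 - colProj L) * (L * Bᴴ - Ms) * (1 - colProj B)) ≤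
      frobNorm (L * Bᴴ - Ms) ^ 2 / σ := by
  obtain ⟨hLs, hBs, hY⟩ := factorization_of_close (L := Ls) (B := Bs) hσ0 hσ hr
    (by rw [hMs, sub_self, norm_zero])
  rw [sub_zero] at hY
  set D := L * Bᴴ - Ms with hD
  have h1 : (1 - colProj L) * (L * Bᴴ) = 0 := by
    rw [Matrix.sub_mul, Matrix.one_mul, ← Matrix.mul_assoc, colProj_mul_self hL, sub_self]
  have h2 : L * Bᴴ * (1 - colProj B) = 0 := by
    rw [Matrix.mul_sub, Matrix.mul_one, Matrix.mul_assoc, conjTranspose_mul_colProj hB, sub_self]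
  have h3 : Ms * pinvFactor Ls Bs * Ms = Ms := by
    rw [hMs, mul_pinvFactor hBs, ← Matrix.mul_assoc, colProj_mul_self hLs]
  -- The outer projections annihilate L * Bᴴ, so on either side D may be exchanged for -Ms.
  -- Inserting Ms = Ms Ms⁺ Ms between them exhibits two factors D, hence the quadratic bound.
  have e : (1 - colProj L) * D * (1 - colProj B) =
      -(((1 - colProj L) * D) * pinvFactor Ls Bs * (D * (1 - colProj B))) := by
    have e1 : (1 - colProj L) * D = -((1 - colProj L) * Ms) := by
      rw [hD, Matrix.mul_sub, h1, zero_sub]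
    have e2 : D * (1 - colProj B) = -(Ms * (1 - colProj B)) := by
      rw [hD, Matrix.sub_mul, h2, zero_sub]
    rw [e2, e1]
    nth_rewrite 1 [← h3]
    simp only [Matrix.neg_mul, Matrix.mul_neg, neg_neg, Matrix.mul_assoc]
  rw [e, frobNorm_neg]
  have hPL := opNorm_one_sub_le_one conjTranspose_colProj (colProj_mul_colProj hL)
  have hPB := opNorm_one_sub_le_one conjTranspose_colProj (colProj_mul_colProj hB)
  have hD0 := frobNorm_nonneg D
  calc _ ≤ ‖(1 - colProj L) * D * pinvFactor Ls Bs‖ * frobNorm (D * (1 - colProj B)) :=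
        frobNorm_mul_le_opNorm_mul _ _
    _ ≤ (frobNorm D * (1 / σ)) * (frobNorm D * 1) := by
        refine mul_le_mul ?_ ?_ (frobNorm_nonneg _) (by positivity)
        · refine (Matrix.l2_opNorm_mul _ _).trans (mul_le_mul ?_ hY (norm_nonneg _) hD0)
          refine (opNorm_le_frobNorm _).trans ((frobNorm_mul_le_opNorm_mul _ _).trans ?_)
          exact mul_le_of_le_one_left hD0 hPL
        · exact (frobNorm_mul_le_mul_opNorm _ _).trans (by gcongr)
    _ = _ := by field_simp

end Factorization

/-- Top left singular vectors of a matrix near a matrix of rank at most `r` almost contain its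
column space. -/
theorem opNorm_one_sub_mul_le_of_top {r : ℕ} {U : Matrix ι (Fin r) ℂ} {M Ms : Matrix ι κ ℂ}
    (hU : IsTopLeftSingular U M) (hr : Ms.rank ≤ r) : ‖(1 - U * Uᴴ) * M‖ ≤ ‖M - Ms‖ := by
  obtain ⟨hU1, hU2⟩ := hU
  set f := Matrix.toEuclideanLin M with hf
  set fs := Matrix.toEuclideanLin Ms with hfs
  set u : Fin r → EuclideanSpace ℂ ι := fun j => WithLp.toLp 2 (Uᵀ j) with hu
  have hin : ∀ j (x : EuclideanSpace ℂ ι), inner ℂ (u j) x = (Uᴴ *ᵥ x.ofLp) j := by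
    intro j x
    rw [PiLp.inner_apply]
    refine Finset.sum_congr rfl fun i _ => ?_
    simp [hu, mul_comm]
  have huo : Orthonormal ℂ u := by
    rw [orthonormal_iff_ite]
    intro i j
    rw [hin]
    have : (Uᴴ *ᵥ (u j).ofLp) i = (Uᴴ * U) i j := rfl
    rw [this, hU1, Matrix.one_apply]
  have hadj : LinearMap.adjoint f = Matrix.toEuclideanLin Mᴴ :=
    (Matrix.toEuclideanLin_conjTranspose_eq_adjoint M).symm
  have hadjs : LinearMap.adjoint fs = Matrix.toEuclideanLin Msᴴ :=
    (Matrix.toEuclideanLin_conjTranspose_eq_adjoint Ms).symm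
  have hev : ∀ j : Fin r, f (LinearMap.adjoint f (u j)) =
      ((f.singularValues j ^ 2 : ℝ) : ℂ) • u j := by
    intro j
    rw [hadj]
    ext i
    have h1 : f (Matrix.toEuclideanLin Mᴴ (u j)) i = (M * Mᴴ * U) i j := by
      rw [Matrix.mul_assoc]; rfl
    rw [h1, hU2, Matrix.mul_diagonal, mul_comm]
    rfl
  have hbound := fun x hx => norm_adjoint_apply_le_of_top_singular (fs := fs) huo hev
    (by rw [hfs, finrank_range_toEuclideanLin]; exact hr) (norm_nonneg (M - Ms))
    (fun y => by
      rw [hadj, hadjs, ← LinearMap.sub_apply, ← map_sub, ← Matrix.conjTranspose_sub,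
        ← Matrix.l2_opNorm_conjTranspose (M - Ms)]
      exact norm_toEuclideanLin_le _ y) (x := x) hx
  have hP1 : (U * Uᴴ)ᴴ = U * Uᴴ := by simp
  have hP2 : U * Uᴴ * (U * Uᴴ) = U * Uᴴ := by
    rw [Matrix.mul_assoc, ← Matrix.mul_assoc Uᴴ, hU1, Matrix.one_mul]
  rw [← Matrix.l2_opNorm_conjTranspose, Matrix.conjTranspose_mul]
  refine opNorm_le_of_forall (norm_nonneg _) fun y => ?_
  have h5 : Matrix.toEuclideanLin (Mᴴ * (1 - U * Uᴴ)ᴴ) y =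
      LinearMap.adjoint f (Matrix.toEuclideanLin (1 - U * Uᴴ) y) := by
    rw [hadj, Matrix.conjTranspose_sub, hP1, Matrix.conjTranspose_one]
    exact congrArg (WithLp.toLp 2) (Matrix.mulVec_mulVec _ _ _).symm
  rw [h5]
  refine (hbound _ fun j => ?_).trans ?_
  · rw [hin]
    have : (Matrix.toEuclideanLin (1 - U * Uᴴ) y).ofLp = (1 - U * Uᴴ) *ᵥ y.ofLp := rfl
    rw [this, Matrix.mulVec_mulVec, Matrix.mul_sub, ← Matrix.mul_assoc, hU1]
    simp
  · gcongr
    refine (norm_toEuclideanLin_le _ y).trans ?_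
    exact mul_le_of_le_one_left (norm_nonneg _) (opNorm_one_sub_le_one hP1 hP2)

/-- Replacing M by Ms costs a second δ; the rank of Ms turns the operator norm into the Frobenius
norm at the price √r. -/
theorem frobNorm_one_sub_mul_le_of_top {r : ℕ} {U : Matrix ι (Fin r) ℂ} {M Ms : Matrix ι κ ℂ}
    (hU : IsTopLeftSingular U M) (hr : Ms.rank ≤ r) {δ : ℝ} (hδ : ‖M - Ms‖ ≤ δ) :
    frobNorm ((1 - U * Uᴴ) * Ms) ≤ √r * (2 * δ) := by
  have h := opNorm_one_sub_mul_le_of_top hU hr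
  have hP1 : (U * Uᴴ)ᴴ = U * Uᴴ := by simp
  have hP2 : U * Uᴴ * (U * Uᴴ) = U * Uᴴ := by
    rw [Matrix.mul_assoc, ← Matrix.mul_assoc Uᴴ, hU.1, Matrix.one_mul]
  have h2 : ‖(1 - U * Uᴴ) * Ms‖ ≤ 2 * δ := by
    have e : (1 - U * Uᴴ) * Ms = (1 - U * Uᴴ) * M - (1 - U * Uᴴ) * (M - Ms) := by
      rw [Matrix.mul_sub]; abel
    rw [e]
    refine (norm_sub_le _ _).trans ?_
    have h3 := Matrix.l2_opNorm_mul (1 - U * Uᴴ) (M - Ms)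
    have h4 := mul_le_of_le_one_left (norm_nonneg (M - Ms)) (opNorm_one_sub_le_one hP1 hP2)
    linarith
  refine (frobNorm_le_sqrt_rank_mul _).trans ?_
  gcongr
  exact (Matrix.rank_mul_le_right _ _).trans hr

end MatrixNorms

/-! ### Tensors, their matricizations and mode products -/

section Tensors

open scoped Matrix.Norms.L2Operator

variable {a b c a' b' c' r n₁ n₂ s m : ℕ}

/-- The entries of a tensor as a vector of a Euclidean space. -/
def tvec : Tensor a b c ≃ₗ[ℂ] EuclideanSpace ℂ (Fin a × Fin b × Fin c) where
  toFun Z := WithLp.toLp 2 fun q => Z q.1 q.2.1 q.2.2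
  invFun v := fun i j k => v (i, j, k)
  map_add' _ _ := rfl
  map_smul' _ _ := rfl
  left_inv _ := rfl
  right_inv _ := rfl

lemma norm_tvec_sq (Z : Tensor a b c) : ‖tvec Z‖ ^ 2 = ∑ i, ∑ j, ∑ k, ‖Z i j k‖ ^ 2 := by
  rw [EuclideanSpace.norm_sq_eq, Fintype.sum_prod_type]
  refine Finset.sum_congr rfl fun i _ => ?_
  rw [Fintype.sum_prod_type]; rfl

lemma inner_tvec (Z Y : Tensor a b c) :
    inner ℂ (tvec Z) (tvec Y) = ∑ i, ∑ j, ∑ k, star (Z i j k) * Y i j k := by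
  rw [PiLp.inner_apply, Fintype.sum_prod_type]
  refine Finset.sum_congr rfl fun i _ => ?_
  rw [Fintype.sum_prod_type]
  refine Finset.sum_congr rfl fun j _ => Finset.sum_congr rfl fun k _ => ?_
  rw [RCLike.inner_apply, mul_comm]; rfl

lemma trace_conjTranspose_mul_eq {ι κ : Type*} [Fintype ι] [Fintype κ] (M N : Matrix ι κ ℂ) :
    (Mᴴ * N).trace = ∑ i, ∑ q, star (M i q) * N i q := by
  rw [Finset.sum_comm]; rfl

lemma inner_tvec_unfold1 (Z Y : Tensor a b c) :
    inner ℂ (tvec Z) (tvec Y) = ((unfold1 Z)ᴴ * unfold1 Y).trace := by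
  rw [inner_tvec, trace_conjTranspose_mul_eq]
  refine Finset.sum_congr rfl fun i _ => ?_
  rw [Fintype.sum_prod_type, Finset.sum_comm]; rfl

lemma inner_tvec_unfold2 (Z Y : Tensor a b c) :
    inner ℂ (tvec Z) (tvec Y) = ((unfold2 Z)ᴴ * unfold2 Y).trace := by
  rw [inner_tvec, trace_conjTranspose_mul_eq, Finset.sum_comm]
  refine Finset.sum_congr rfl fun i _ => ?_
  rw [Fintype.sum_prod_type, Finset.sum_comm]; rfl

lemma inner_tvec_unfold3 (Z Y : Tensor a b c) :
    inner ℂ (tvec Z) (tvec Y) = ((unfold3 Z)ᴴ * unfold3 Y).trace := by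
  rw [inner_tvec, trace_conjTranspose_mul_eq]
  have : ∀ k, ∑ q : Fin b × Fin a, star (unfold3 Z k q) * unfold3 Y k q =
      ∑ i, ∑ j, star (Z i j k) * Y i j k := by
    intro k; rw [Fintype.sum_prod_type, Finset.sum_comm]; rfl
  simp only [this]
  rw [Finset.sum_comm (s := Finset.univ (α := Fin c))]
  refine Finset.sum_congr rfl fun i _ => ?_
  rw [Finset.sum_comm]

lemma frobNorm_sq_eq_trace {ι κ : Type*} [Fintype ι] [Fintype κ] (M : Matrix ι κ ℂ) :
    ((frobNorm M ^ 2 : ℝ) : ℂ) = (Mᴴ * M).trace := by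
  rw [trace_conjTranspose_mul_eq, frobNorm_sq]
  push_cast
  refine Finset.sum_congr rfl fun i _ => Finset.sum_congr rfl fun q _ => ?_
  exact (Complex.conj_mul' (M i q)).symm

lemma frobNorm_eq_of_trace {ι κ : Type*} [Fintype ι] [Fintype κ] {M : Matrix ι κ ℂ}
    {Z : Tensor a b c} (h : inner ℂ (tvec Z) (tvec Z) = (Mᴴ * M).trace) :
    frobNorm M = ‖tvec Z‖ := by
  have h2 := congrArg RCLike.re h
  rw [inner_self_eq_norm_sq, ← frobNorm_sq_eq_trace] at h2
  replace h2 : ‖tvec Z‖ ^ 2 = frobNorm M ^ 2 := h2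
  exact (pow_left_inj₀ (norm_nonneg _) (frobNorm_nonneg _) two_ne_zero).1 h2 |>.symm

lemma frobNorm_unfold1 (Z : Tensor a b c) : frobNorm (unfold1 Z) = ‖tvec Z‖ :=
  frobNorm_eq_of_trace (inner_tvec_unfold1 Z Z)

lemma frobNorm_unfold2 (Z : Tensor a b c) : frobNorm (unfold2 Z) = ‖tvec Z‖ :=
  frobNorm_eq_of_trace (inner_tvec_unfold2 Z Z)

lemma frobNorm_unfold3 (Z : Tensor a b c) : frobNorm (unfold3 Z) = ‖tvec Z‖ :=
  frobNorm_eq_of_trace (inner_tvec_unfold3 Z Z)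

lemma unfold1_injective : Function.Injective (unfold1 : Tensor a b c → _) := fun Z Y h => by
  funext i j k; exact congrFun (congrFun h i) (k, j)

lemma unfold2_injective : Function.Injective (unfold2 : Tensor a b c → _) := fun Z Y h => by
  funext i j k; exact congrFun (congrFun h j) (k, i)

lemma unfold3_injective : Function.Injective (unfold3 : Tensor a b c → _) := fun Z Y h => by
  funext i j k; exact congrFun (congrFun h k) (j, i)

lemma unfold1_sub (Z Y : Tensor a b c) : unfold1 (Z - Y) = unfold1 Z - unfold1 Y := rfl
lemma unfold2_sub (Z Y : Tensor a b c) : unfold2 (Z - Y) = unfold2 Z - unfold2 Y := rfl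
lemma unfold3_sub (Z Y : Tensor a b c) : unfold3 (Z - Y) = unfold3 Z - unfold3 Y := rfl

/-- Mode-1 product with a matrix. -/
def left1 (A : Matrix (Fin a') (Fin a) ℂ) : Tensor a b c →ₗ[ℂ] Tensor a' b c where
  toFun Z := fun i j k => (A * unfold1 Z) i (k, j)
  map_add' Z Y := by funext i j k; exact congrFun (congrFun (Matrix.mul_add A _ _) i) (k, j)
  map_smul' t Z := by funext i j k; exact congrFun (congrFun (Matrix.mul_smul A t _) i) (k, j)

/-- Mode-2 product with a matrix. -/
def left2 (B : Matrix (Fin b') (Fin b) ℂ) : Tensor a b c →ₗ[ℂ] Tensor a b' c where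
  toFun Z := fun i j k => (B * unfold2 Z) j (k, i)
  map_add' Z Y := by funext i j k; exact congrFun (congrFun (Matrix.mul_add B _ _) j) (k, i)
  map_smul' t Z := by funext i j k; exact congrFun (congrFun (Matrix.mul_smul B t _) j) (k, i)

/-- Mode-3 product with a matrix. -/
def left3 (C : Matrix (Fin c') (Fin c) ℂ) : Tensor a b c →ₗ[ℂ] Tensor a b c' where
  toFun Z := fun i j k => (C * unfold3 Z) k (j, i)
  map_add' Z Y := by funext i j k; exact congrFun (congrFun (Matrix.mul_add C _ _) k) (j, i)
  map_smul' t Z := by funext i j k; exact congrFun (congrFun (Matrix.mul_smul C t _) k) (j, i)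

/-- Multiplication of the mode-1 matricization from the right. -/
def right1 (M : Matrix (Fin c × Fin b) (Fin c × Fin b) ℂ) : Tensor a b c →ₗ[ℂ] Tensor a b c where
  toFun Z := fun i j k => (unfold1 Z * M) i (k, j)
  map_add' Z Y := by
    funext i j k; exact congrFun (congrFun (Matrix.add_mul (unfold1 Z) (unfold1 Y) M) i) (k, j)
  map_smul' t Z := by
    funext i j k; exact congrFun (congrFun (Matrix.smul_mul t (unfold1 Z) M) i) (k, j)

/-- Multiplication of the mode-2 matricization from the right. -/
def right2 (M : Matrix (Fin c × Fin a) (Fin c × Fin a) ℂ) : Tensor a b c →ₗ[ℂ] Tensor a b c where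
  toFun Z := fun i j k => (unfold2 Z * M) j (k, i)
  map_add' Z Y := by
    funext i j k; exact congrFun (congrFun (Matrix.add_mul (unfold2 Z) (unfold2 Y) M) j) (k, i)
  map_smul' t Z := by
    funext i j k; exact congrFun (congrFun (Matrix.smul_mul t (unfold2 Z) M) j) (k, i)

/-- Multiplication of the mode-3 matricization from the right. -/
def right3 (M : Matrix (Fin b × Fin a) (Fin b × Fin a) ℂ) : Tensor a b c →ₗ[ℂ] Tensor a b c where
  toFun Z := fun i j k => (unfold3 Z * M) k (j, i)
  map_add' Z Y := by
    funext i j k; exact congrFun (congrFun (Matrix.add_mul (unfold3 Z) (unfold3 Y) M) k) (j, i)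
  map_smul' t Z := by
    funext i j k; exact congrFun (congrFun (Matrix.smul_mul t (unfold3 Z) M) k) (j, i)

lemma unfold1_left1 (A : Matrix (Fin a') (Fin a) ℂ) (Z : Tensor a b c) :
    unfold1 (left1 A Z) = A * unfold1 Z := rfl
lemma unfold2_left2 (B : Matrix (Fin b') (Fin b) ℂ) (Z : Tensor a b c) :
    unfold2 (left2 B Z) = B * unfold2 Z := rfl
lemma unfold3_left3 (C : Matrix (Fin c') (Fin c) ℂ) (Z : Tensor a b c) :
    unfold3 (left3 C Z) = C * unfold3 Z := rfl
lemma unfold1_right1 (M : Matrix (Fin c × Fin b) (Fin c × Fin b) ℂ) (Z : Tensor a b c) :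
    unfold1 (right1 M Z) = unfold1 Z * M := rfl
lemma unfold2_right2 (M : Matrix (Fin c × Fin a) (Fin c × Fin a) ℂ) (Z : Tensor a b c) :
    unfold2 (right2 M Z) = unfold2 Z * M := rfl
lemma unfold3_right3 (M : Matrix (Fin b × Fin a) (Fin b × Fin a) ℂ) (Z : Tensor a b c) :
    unfold3 (right3 M Z) = unfold3 Z * M := rfl

lemma left1_apply (A : Matrix (Fin a') (Fin a) ℂ) (Z : Tensor a b c) (i j k) :
    left1 A Z i j k = ∑ i', A i i' * Z i' j k := rfl
lemma left2_apply (B : Matrix (Fin b') (Fin b) ℂ) (Z : Tensor a b c) (i j k) :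
    left2 B Z i j k = ∑ j', B j j' * Z i j' k := rfl
lemma left3_apply (C : Matrix (Fin c') (Fin c) ℂ) (Z : Tensor a b c) (i j k) :
    left3 C Z i j k = ∑ k', C k k' * Z i j k' := rfl

/-- A product in another mode acts on a matricization from the right, through a Kronecker product
with an identity. This reduces the commutation of different modes to associativity of matrix
multiplication. -/
lemma unfold1_left2 (B : Matrix (Fin b') (Fin b) ℂ) (Z : Tensor a b c) :
    unfold1 (left2 B Z) = unfold1 Z * ((1 : Matrix (Fin c) (Fin c) ℂ) ⊗ₖ B)ᵀ := by
  ext i ⟨k, j⟩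
  simp [unfold1, left2_apply, Matrix.mul_apply, Fintype.sum_prod_type, Matrix.one_apply, mul_comm]

lemma unfold1_left3 (C : Matrix (Fin c') (Fin c) ℂ) (Z : Tensor a b c) :
    unfold1 (left3 C Z) = unfold1 Z * (C ⊗ₖ (1 : Matrix (Fin b) (Fin b) ℂ))ᵀ := by
  ext i ⟨k, j⟩
  simp [unfold1, left3_apply, Matrix.mul_apply, Fintype.sum_prod_type, Matrix.one_apply, mul_comm]

lemma unfold2_left1 (A : Matrix (Fin a') (Fin a) ℂ) (Z : Tensor a b c) :
    unfold2 (left1 A Z) = unfold2 Z * ((1 : Matrix (Fin c) (Fin c) ℂ) ⊗ₖ A)ᵀ := by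
  ext i ⟨k, j⟩
  simp [unfold2, left1_apply, Matrix.mul_apply, Fintype.sum_prod_type, Matrix.one_apply, mul_comm]

lemma unfold2_left3 (C : Matrix (Fin c') (Fin c) ℂ) (Z : Tensor a b c) :
    unfold2 (left3 C Z) = unfold2 Z * (C ⊗ₖ (1 : Matrix (Fin a) (Fin a) ℂ))ᵀ := by
  ext i ⟨k, j⟩
  simp [unfold2, left3_apply, Matrix.mul_apply, Fintype.sum_prod_type, Matrix.one_apply, mul_comm]

lemma unfold3_left1 (A : Matrix (Fin a') (Fin a) ℂ) (Z : Tensor a b c) :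
    unfold3 (left1 A Z) = unfold3 Z * ((1 : Matrix (Fin b) (Fin b) ℂ) ⊗ₖ A)ᵀ := by
  ext i ⟨k, j⟩
  simp [unfold3, left1_apply, Matrix.mul_apply, Fintype.sum_prod_type, Matrix.one_apply, mul_comm]

lemma unfold3_left2 (B : Matrix (Fin b') (Fin b) ℂ) (Z : Tensor a b c) :
    unfold3 (left2 B Z) = unfold3 Z * (B ⊗ₖ (1 : Matrix (Fin a) (Fin a) ℂ))ᵀ := by
  ext i ⟨k, j⟩
  simp [unfold3, left2_apply, Matrix.mul_apply, Fintype.sum_prod_type, Matrix.one_apply, mul_comm]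

lemma left1_left1 {a'' : ℕ} (A : Matrix (Fin a'') (Fin a') ℂ) (A' : Matrix (Fin a') (Fin a) ℂ)
    (Z : Tensor a b c) : left1 A (left1 A' Z) = left1 (A * A') Z :=
  unfold1_injective (by simp only [unfold1_left1, Matrix.mul_assoc])

lemma left2_left2 {b'' : ℕ} (B : Matrix (Fin b'') (Fin b') ℂ) (B' : Matrix (Fin b') (Fin b) ℂ)
    (Z : Tensor a b c) : left2 B (left2 B' Z) = left2 (B * B') Z :=
  unfold2_injective (by simp only [unfold2_left2, Matrix.mul_assoc])

lemma left3_left3 {c'' : ℕ} (C : Matrix (Fin c'') (Fin c') ℂ) (C' : Matrix (Fin c') (Fin c) ℂ)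
    (Z : Tensor a b c) : left3 C (left3 C' Z) = left3 (C * C') Z :=
  unfold3_injective (by simp only [unfold3_left3, Matrix.mul_assoc])

lemma left2_left1 (A : Matrix (Fin a') (Fin a) ℂ) (B : Matrix (Fin b') (Fin b) ℂ)
    (Z : Tensor a b c) : left2 B (left1 A Z) = left1 A (left2 B Z) :=
  unfold1_injective (by simp only [unfold1_left1, unfold1_left2, Matrix.mul_assoc])

lemma left3_left1 (A : Matrix (Fin a') (Fin a) ℂ) (C : Matrix (Fin c') (Fin c) ℂ)
    (Z : Tensor a b c) : left3 C (left1 A Z) = left1 A (left3 C Z) :=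
  unfold1_injective (by simp only [unfold1_left1, unfold1_left3, Matrix.mul_assoc])

lemma left3_left2 (B : Matrix (Fin b') (Fin b) ℂ) (C : Matrix (Fin c') (Fin c) ℂ)
    (Z : Tensor a b c) : left3 C (left2 B Z) = left2 B (left3 C Z) :=
  unfold2_injective (by simp only [unfold2_left2, unfold2_left3, Matrix.mul_assoc])

lemma left2_one (Z : Tensor a b c) : left2 1 Z = Z := unfold2_injective (by simp [unfold2_left2])
lemma left3_one (Z : Tensor a b c) : left3 1 Z = Z := unfold3_injective (by simp [unfold3_left3])

lemma left1_one_sub_smul (η : ℂ) (A : Matrix (Fin a) (Fin a) ℂ) (Z : Tensor a b c) :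
    left1 (1 - η • A) Z = Z - η • left1 A Z :=
  unfold1_injective (by
    rw [unfold1_left1, Matrix.sub_mul, Matrix.one_mul, Matrix.smul_mul]; rfl)

lemma left2_one_sub_smul (η : ℂ) (A : Matrix (Fin b) (Fin b) ℂ) (Z : Tensor a b c) :
    left2 (1 - η • A) Z = Z - η • left2 A Z :=
  unfold2_injective (by
    rw [unfold2_left2, Matrix.sub_mul, Matrix.one_mul, Matrix.smul_mul]; rfl)

lemma left3_one_sub_smul (η : ℂ) (A : Matrix (Fin c) (Fin c) ℂ) (Z : Tensor a b c) :
    left3 (1 - η • A) Z = Z - η • left3 A Z :=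
  unfold3_injective (by
    rw [unfold3_left3, Matrix.sub_mul, Matrix.one_mul, Matrix.smul_mul]; rfl)

lemma tucker_eq_left (A : Matrix (Fin a') (Fin a) ℂ) (B : Matrix (Fin b') (Fin b) ℂ)
    (C : Matrix (Fin c') (Fin c) ℂ) (S : Tensor a b c) :
    tucker A B C S = left1 A (left2 B (left3 C S)) := by
  funext i j k
  simp only [tucker, left1_apply, left2_apply, left3_apply, Finset.mul_sum, mul_assoc]

lemma tucker_tucker {a'' b'' c'' : ℕ} (A : Matrix (Fin a'') (Fin a') ℂ)
    (B : Matrix (Fin b'') (Fin b') ℂ) (C : Matrix (Fin c'') (Fin c') ℂ)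
    (A' : Matrix (Fin a') (Fin a) ℂ) (B' : Matrix (Fin b') (Fin b) ℂ)
    (C' : Matrix (Fin c') (Fin c) ℂ) (S : Tensor a b c) :
    tucker A B C (tucker A' B' C' S) = tucker (A * A') (B * B') (C * C') S := by
  simp only [tucker_eq_left, left3_left1, left3_left2, left2_left1, left1_left1, left2_left2,
    left3_left3]

lemma conjTranspose_map_star_kronecker {α β γ δ : Type*} (V : Matrix α β ℂ) (R : Matrix γ δ ℂ) :
    (V.map star ⊗ₖ R.map star)ᴴ = (V ⊗ₖ R)ᵀ := by
  ext i j; simp [Matrix.conjTranspose_apply]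

/-- The second factor is written as a conjugate transpose so that, for a factor quadruple, it is
literally the `breveL` of the algorithm. -/
lemma unfold1_tucker (A : Matrix (Fin a') (Fin a) ℂ) (B : Matrix (Fin b') (Fin b) ℂ)
    (C : Matrix (Fin c') (Fin c) ℂ) (S : Tensor a b c) :
    unfold1 (tucker A B C S) = A * ((C.map star ⊗ₖ B.map star) * (unfold1 S)ᴴ)ᴴ := by
  rw [tucker_eq_left, unfold1_left1, unfold1_left2, unfold1_left3, Matrix.conjTranspose_mul,
    conjTranspose_map_star_kronecker, Matrix.conjTranspose_conjTranspose, Matrix.mul_assoc,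
    ← Matrix.transpose_mul, ← Matrix.mul_kronecker_mul, Matrix.one_mul, Matrix.mul_one]

lemma unfold2_tucker (A : Matrix (Fin a') (Fin a) ℂ) (B : Matrix (Fin b') (Fin b) ℂ)
    (C : Matrix (Fin c') (Fin c) ℂ) (S : Tensor a b c) :
    unfold2 (tucker A B C S) = B * ((C.map star ⊗ₖ A.map star) * (unfold2 S)ᴴ)ᴴ := by
  rw [tucker_eq_left, ← left2_left1, unfold2_left2, unfold2_left1, unfold2_left3,
    Matrix.conjTranspose_mul,
    conjTranspose_map_star_kronecker, Matrix.conjTranspose_conjTranspose, Matrix.mul_assoc,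
    ← Matrix.transpose_mul, ← Matrix.mul_kronecker_mul, Matrix.one_mul, Matrix.mul_one]

lemma unfold3_tucker (A : Matrix (Fin a') (Fin a) ℂ) (B : Matrix (Fin b') (Fin b) ℂ)
    (C : Matrix (Fin c') (Fin c) ℂ) (S : Tensor a b c) :
    unfold3 (tucker A B C S) = C * ((B.map star ⊗ₖ A.map star) * (unfold3 S)ᴴ)ᴴ := by
  rw [tucker_eq_left, ← left3_left2, ← left3_left1, unfold3_left3, unfold3_left1, unfold3_left2,
    Matrix.conjTranspose_mul,
    conjTranspose_map_star_kronecker, Matrix.conjTranspose_conjTranspose, Matrix.mul_assoc,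
    ← Matrix.transpose_mul, ← Matrix.mul_kronecker_mul, Matrix.one_mul, Matrix.mul_one]

lemma norm_tvec_left1_le (A : Matrix (Fin a') (Fin a) ℂ) (Z : Tensor a b c) :
    ‖tvec (left1 A Z)‖ ≤ ‖A‖ * ‖tvec Z‖ := by
  rw [← frobNorm_unfold1, ← frobNorm_unfold1, unfold1_left1]; exact frobNorm_mul_le_opNorm_mul _ _

lemma norm_tvec_left2_le (A : Matrix (Fin b') (Fin b) ℂ) (Z : Tensor a b c) :
    ‖tvec (left2 A Z)‖ ≤ ‖A‖ * ‖tvec Z‖ := by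
  rw [← frobNorm_unfold2, ← frobNorm_unfold2, unfold2_left2]; exact frobNorm_mul_le_opNorm_mul _ _

lemma norm_tvec_left3_le (A : Matrix (Fin c') (Fin c) ℂ) (Z : Tensor a b c) :
    ‖tvec (left3 A Z)‖ ≤ ‖A‖ * ‖tvec Z‖ := by
  rw [← frobNorm_unfold3, ← frobNorm_unfold3, unfold3_left3]; exact frobNorm_mul_le_opNorm_mul _ _

/-- A linear map of tensors as a linear map of the Hilbert space of tensors. -/
def tlift (f : Tensor a b c →ₗ[ℂ] Tensor a b c) :
    EuclideanSpace ℂ (Fin a × Fin b × Fin c) →ₗ[ℂ] EuclideanSpace ℂ (Fin a × Fin b × Fin c) :=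
  tvec.conj f

lemma tlift_tvec (f : Tensor a b c →ₗ[ℂ] Tensor a b c) (Z : Tensor a b c) :
    tlift f (tvec Z) = tvec (f Z) := by
  rw [tlift, LinearEquiv.conj_apply_apply, LinearEquiv.symm_apply_apply]

lemma forall_tvec {p : EuclideanSpace ℂ (Fin a × Fin b × Fin c) → Prop}
    (h : ∀ Z : Tensor a b c, p (tvec Z)) : ∀ x, p x := fun x => by
  have := h (tvec.symm x); rwa [LinearEquiv.apply_symm_apply] at this

lemma tlift_isSymmetric {f : Tensor a b c →ₗ[ℂ] Tensor a b c}
    (h : ∀ Z Y, inner ℂ (tvec (f Z)) (tvec Y) = inner ℂ (tvec Z) (tvec (f Y))) :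
    (tlift f).IsSymmetric :=
  forall_tvec fun Z => forall_tvec fun Y => by rw [tlift_tvec, tlift_tvec, h]

lemma tlift_left1_isSymmetric {A : Matrix (Fin a) (Fin a) ℂ} (hA : Aᴴ = A) :
    (tlift (left1 A : Tensor a b c →ₗ[ℂ] _)).IsSymmetric := tlift_isSymmetric fun Z Y => by
  rw [inner_tvec_unfold1, inner_tvec_unfold1, unfold1_left1, unfold1_left1,
    Matrix.conjTranspose_mul, hA, Matrix.mul_assoc]

lemma tlift_left2_isSymmetric {A : Matrix (Fin b) (Fin b) ℂ} (hA : Aᴴ = A) :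
    (tlift (left2 A : Tensor a b c →ₗ[ℂ] _)).IsSymmetric := tlift_isSymmetric fun Z Y => by
  rw [inner_tvec_unfold2, inner_tvec_unfold2, unfold2_left2, unfold2_left2,
    Matrix.conjTranspose_mul, hA, Matrix.mul_assoc]

lemma tlift_left3_isSymmetric {A : Matrix (Fin c) (Fin c) ℂ} (hA : Aᴴ = A) :
    (tlift (left3 A : Tensor a b c →ₗ[ℂ] _)).IsSymmetric := tlift_isSymmetric fun Z Y => by
  rw [inner_tvec_unfold3, inner_tvec_unfold3, unfold3_left3, unfold3_left3,
    Matrix.conjTranspose_mul, hA, Matrix.mul_assoc]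

lemma tlift_right1_isSymmetric {M : Matrix (Fin c × Fin b) (Fin c × Fin b) ℂ} (hM : Mᴴ = M) :
    (tlift (right1 M : Tensor a b c →ₗ[ℂ] _)).IsSymmetric := tlift_isSymmetric fun Z Y => by
  rw [inner_tvec_unfold1, inner_tvec_unfold1, unfold1_right1, unfold1_right1,
    Matrix.conjTranspose_mul, hM, Matrix.mul_assoc, Matrix.trace_mul_comm, Matrix.mul_assoc]

lemma tlift_right2_isSymmetric {M : Matrix (Fin c × Fin a) (Fin c × Fin a) ℂ} (hM : Mᴴ = M) :
    (tlift (right2 M : Tensor a b c →ₗ[ℂ] _)).IsSymmetric := tlift_isSymmetric fun Z Y => by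
  rw [inner_tvec_unfold2, inner_tvec_unfold2, unfold2_right2, unfold2_right2,
    Matrix.conjTranspose_mul, hM, Matrix.mul_assoc, Matrix.trace_mul_comm, Matrix.mul_assoc]

lemma tlift_right3_isSymmetric {M : Matrix (Fin b × Fin a) (Fin b × Fin a) ℂ} (hM : Mᴴ = M) :
    (tlift (right3 M : Tensor a b c →ₗ[ℂ] _)).IsSymmetric := tlift_isSymmetric fun Z Y => by
  rw [inner_tvec_unfold3, inner_tvec_unfold3, unfold3_right3, unfold3_right3,
    Matrix.conjTranspose_mul, hM, Matrix.mul_assoc, Matrix.trace_mul_comm, Matrix.mul_assoc]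

end Tensors

/-! ### One scaled gradient step -/

section GradientStep

open scoped Matrix.Norms.L2Operator

lemma mul_colProj_of_mul_eq {ι ρ : Type*} [Fintype ι] [Fintype ρ] [DecidableEq ρ]
    {T : Matrix ι ι ℂ} {X : Matrix ι ρ ℂ} (h : T * X = X) : T * colProj X = colProj X := by
  rw [colProj, ← Matrix.mul_assoc, ← Matrix.mul_assoc, h]

lemma colProj_mul_of_mul_eq {ι ρ : Type*} [Fintype ι] [Fintype ρ] [DecidableEq ρ] [DecidableEq ι]
    {T : Matrix ι ι ℂ} {X : Matrix ι ρ ℂ} (hT : Tᴴ = T) (h : T * X = X) :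
    colProj X * T = colProj X := by
  have h2 := congrArg Matrix.conjTranspose (mul_colProj_of_mul_eq h)
  rwa [Matrix.conjTranspose_mul, conjTranspose_colProj, hT] at h2

section Kron

variable {α β γ δ ε : Type*} [Fintype α] [Fintype β] [Fintype γ] [Fintype δ] [Fintype ε]
  [DecidableEq α] [DecidableEq β] [DecidableEq γ] [DecidableEq δ]

lemma transpose_eq_map_star {P : Matrix α α ℂ} (hP : Pᴴ = P) : Pᵀ = P.map star := by
  conv_lhs => rw [← hP]
  ext i j; simp [Matrix.conjTranspose_apply]

lemma map_star_mul (P : Matrix α β ℂ) (B : Matrix β γ ℂ) :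
    P.map star * B.map star = (P * B).map star := by
  ext i j; simp [Matrix.mul_apply]

lemma conjTranspose_transpose_of_hermitian {T : Matrix α α ℂ} (h : Tᴴ = T) : Tᵀᴴ = Tᵀ := by
  ext i j
  have := congrFun (congrFun h j) i
  simpa [Matrix.conjTranspose_apply] using this

lemma one_kronecker_transpose_hermitian {P : Matrix α α ℂ} (hP : Pᴴ = P) :
    ((1 : Matrix β β ℂ) ⊗ₖ P)ᵀᴴ = ((1 : Matrix β β ℂ) ⊗ₖ P)ᵀ :=
  conjTranspose_transpose_of_hermitian (by
    rw [Matrix.conjTranspose_kronecker, hP, Matrix.conjTranspose_one])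

lemma kronecker_one_transpose_hermitian {P : Matrix α α ℂ} (hP : Pᴴ = P) :
    (P ⊗ₖ (1 : Matrix β β ℂ))ᵀᴴ = (P ⊗ₖ (1 : Matrix β β ℂ))ᵀ :=
  conjTranspose_transpose_of_hermitian (by
    rw [Matrix.conjTranspose_kronecker, hP, Matrix.conjTranspose_one])

/-- Mode products act on matricized columns by transposes, and the transpose of a Hermitian P is its
entrywise conjugate. It therefore fixes the conjugate of every B that P fixes. This is the source of
all relations between pᵢ and qⱼ with i ≠ j. -/
lemma one_kronecker_transpose_mul {P : Matrix α α ℂ} {B : Matrix α β ℂ} (hP : Pᴴ = P)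
    (hPB : P * B = B) (C : Matrix γ δ ℂ) (G : Matrix (δ × β) ε ℂ) :
    ((1 : Matrix γ γ ℂ) ⊗ₖ P)ᵀ * ((C.map star ⊗ₖ B.map star) * G) =
      (C.map star ⊗ₖ B.map star) * G := by
  rw [← Matrix.mul_assoc]
  congr 1
  have : ((1 : Matrix γ γ ℂ) ⊗ₖ P)ᵀ = (1 : Matrix γ γ ℂ)ᵀ ⊗ₖ Pᵀ :=
    (Matrix.kroneckerMap_transpose _ _ _).symm
  rw [this, ← Matrix.mul_kronecker_mul, Matrix.transpose_one, Matrix.one_mul,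
    transpose_eq_map_star hP, map_star_mul, hPB]

lemma kronecker_one_transpose_mul {P : Matrix γ γ ℂ} {C : Matrix γ δ ℂ} (hP : Pᴴ = P)
    (hPC : P * C = C) (B : Matrix α β ℂ) (G : Matrix (δ × β) ε ℂ) :
    (P ⊗ₖ (1 : Matrix α α ℂ))ᵀ * ((C.map star ⊗ₖ B.map star) * G) =
      (C.map star ⊗ₖ B.map star) * G := by
  rw [← Matrix.mul_assoc]
  congr 1
  have : (P ⊗ₖ (1 : Matrix α α ℂ))ᵀ = Pᵀ ⊗ₖ (1 : Matrix α α ℂ)ᵀ :=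
    (Matrix.kroneckerMap_transpose _ _ _).symm
  rw [this, ← Matrix.mul_kronecker_mul, Matrix.transpose_one, Matrix.one_mul,
    transpose_eq_map_star hP, map_star_mul, hPC]

end Kron

namespace Factors

variable {n₁ n₂ s r m : ℕ}

/-- All factors, as well as the complementary factors of the three matricizations, have full column
rank. -/
structure Regular (F : Factors n₁ n₂ s r) : Prop where
  L : IsUnit (F.Lᴴ * F.L).det
  R : IsUnit (F.Rᴴ * F.R).det
  V : IsUnit (F.Vᴴ * F.V).det
  breveL : IsUnit (F.breveLᴴ * F.breveL).det
  breveR : IsUnit (F.breveRᴴ * F.breveR).det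
  breveV : IsUnit (F.breveVᴴ * F.breveV).det

variable (F : Factors n₁ n₂ s r)

lemma unfold1_toTensor : unfold1 F.toTensor = F.L * F.breveLᴴ := unfold1_tucker _ _ _ _
lemma unfold2_toTensor : unfold2 F.toTensor = F.R * F.breveRᴴ := unfold2_tucker _ _ _ _
lemma unfold3_toTensor : unfold3 F.toTensor = F.V * F.breveVᴴ := unfold3_tucker _ _ _ _

variable {F}

lemma transpose_R_mul_breveL (h : IsUnit (F.Rᴴ * F.R).det) :
    ((1 : Matrix (Fin s) (Fin s) ℂ) ⊗ₖ colProj F.R)ᵀ * F.breveL = F.breveL :=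
  one_kronecker_transpose_mul conjTranspose_colProj (colProj_mul_self h) _ _

lemma transpose_V_mul_breveL (h : IsUnit (F.Vᴴ * F.V).det) :
    (colProj F.V ⊗ₖ (1 : Matrix (Fin n₂) (Fin n₂) ℂ))ᵀ * F.breveL = F.breveL :=
  kronecker_one_transpose_mul conjTranspose_colProj (colProj_mul_self h) _ _

lemma transpose_L_mul_breveR (h : IsUnit (F.Lᴴ * F.L).det) :
    ((1 : Matrix (Fin s) (Fin s) ℂ) ⊗ₖ colProj F.L)ᵀ * F.breveR = F.breveR :=
  one_kronecker_transpose_mul conjTranspose_colProj (colProj_mul_self h) _ _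

lemma transpose_V_mul_breveR (h : IsUnit (F.Vᴴ * F.V).det) :
    (colProj F.V ⊗ₖ (1 : Matrix (Fin n₁) (Fin n₁) ℂ))ᵀ * F.breveR = F.breveR :=
  kronecker_one_transpose_mul conjTranspose_colProj (colProj_mul_self h) _ _

lemma transpose_L_mul_breveV (h : IsUnit (F.Lᴴ * F.L).det) :
    ((1 : Matrix (Fin n₂) (Fin n₂) ℂ) ⊗ₖ colProj F.L)ᵀ * F.breveV = F.breveV :=
  one_kronecker_transpose_mul conjTranspose_colProj (colProj_mul_self h) _ _

lemma transpose_R_mul_breveV (h : IsUnit (F.Rᴴ * F.R).det) :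
    (colProj F.R ⊗ₖ (1 : Matrix (Fin n₁) (Fin n₁) ℂ))ᵀ * F.breveV = F.breveV :=
  kronecker_one_transpose_mul conjTranspose_colProj (colProj_mul_self h) _ _

/-- The projections attached to a regular factor quadruple. -/
def projections (h : F.Regular) :
    TuckerProjections (EuclideanSpace ℂ (Fin n₁ × Fin n₂ × Fin s)) where
  p₁ := tlift (left1 (colProj F.L))
  p₂ := tlift (left2 (colProj F.R))
  p₃ := tlift (left3 (colProj F.V))
  q₁ := tlift (right1 (colProj F.breveL))
  q₂ := tlift (right2 (colProj F.breveR))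
  q₃ := tlift (right3 (colProj F.breveV))
  symm_p₁ := tlift_left1_isSymmetric conjTranspose_colProj
  symm_p₂ := tlift_left2_isSymmetric conjTranspose_colProj
  symm_p₃ := tlift_left3_isSymmetric conjTranspose_colProj
  symm_q₁ := tlift_right1_isSymmetric conjTranspose_colProj
  symm_q₂ := tlift_right2_isSymmetric conjTranspose_colProj
  symm_q₃ := tlift_right3_isSymmetric conjTranspose_colProj
  p₁p₁ := forall_tvec fun Z => by simp only [tlift_tvec, left1_left1, colProj_mul_colProj h.L]
  p₂p₂ := forall_tvec fun Z => by simp only [tlift_tvec, left2_left2, colProj_mul_colProj h.R]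
  p₃p₃ := forall_tvec fun Z => by simp only [tlift_tvec, left3_left3, colProj_mul_colProj h.V]
  q₁q₁ := forall_tvec fun Z => by
    simp only [tlift_tvec]; congr 1; apply unfold1_injective
    simp only [unfold1_right1, Matrix.mul_assoc, colProj_mul_colProj h.breveL]
  q₂q₂ := forall_tvec fun Z => by
    simp only [tlift_tvec]; congr 1; apply unfold2_injective
    simp only [unfold2_right2, Matrix.mul_assoc, colProj_mul_colProj h.breveR]
  q₃q₃ := forall_tvec fun Z => by
    simp only [tlift_tvec]; congr 1; apply unfold3_injective
    simp only [unfold3_right3, Matrix.mul_assoc, colProj_mul_colProj h.breveV]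
  p₂p₁ := forall_tvec fun Z => by simp only [tlift_tvec, left2_left1]
  p₃p₁ := forall_tvec fun Z => by simp only [tlift_tvec, left3_left1]
  p₃p₂ := forall_tvec fun Z => by simp only [tlift_tvec, left3_left2]
  q₁p₁ := forall_tvec fun Z => by
    simp only [tlift_tvec]; congr 1; apply unfold1_injective
    simp only [unfold1_right1, unfold1_left1, Matrix.mul_assoc]
  q₂p₂ := forall_tvec fun Z => by
    simp only [tlift_tvec]; congr 1; apply unfold2_injective
    simp only [unfold2_right2, unfold2_left2, Matrix.mul_assoc]
  q₃p₃ := forall_tvec fun Z => by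
    simp only [tlift_tvec]; congr 1; apply unfold3_injective
    simp only [unfold3_right3, unfold3_left3, Matrix.mul_assoc]
  q₁p₂ := forall_tvec fun Z => by
    simp only [tlift_tvec]; congr 1; apply unfold1_injective
    rw [unfold1_right1, unfold1_right1, unfold1_left2, Matrix.mul_assoc,
      mul_colProj_of_mul_eq (transpose_R_mul_breveL h.R)]
  q₁p₃ := forall_tvec fun Z => by
    simp only [tlift_tvec]; congr 1; apply unfold1_injective
    rw [unfold1_right1, unfold1_right1, unfold1_left3, Matrix.mul_assoc,
      mul_colProj_of_mul_eq (transpose_V_mul_breveL h.V)]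
  q₂p₁ := forall_tvec fun Z => by
    simp only [tlift_tvec]; congr 1; apply unfold2_injective
    rw [unfold2_right2, unfold2_right2, unfold2_left1, Matrix.mul_assoc,
      mul_colProj_of_mul_eq (transpose_L_mul_breveR h.L)]
  q₂p₃ := forall_tvec fun Z => by
    simp only [tlift_tvec]; congr 1; apply unfold2_injective
    rw [unfold2_right2, unfold2_right2, unfold2_left3, Matrix.mul_assoc,
      mul_colProj_of_mul_eq (transpose_V_mul_breveR h.V)]
  q₃p₁ := forall_tvec fun Z => by
    simp only [tlift_tvec]; congr 1; apply unfold3_injective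
    rw [unfold3_right3, unfold3_right3, unfold3_left1, Matrix.mul_assoc,
      mul_colProj_of_mul_eq (transpose_L_mul_breveV h.L)]
  q₃p₂ := forall_tvec fun Z => by
    simp only [tlift_tvec]; congr 1; apply unfold3_injective
    rw [unfold3_right3, unfold3_right3, unfold3_left2, Matrix.mul_assoc,
      mul_colProj_of_mul_eq (transpose_R_mul_breveV h.R)]
  p₂q₁ := forall_tvec fun Z => by
    simp only [tlift_tvec]; congr 1; apply unfold1_injective
    rw [unfold1_left2, unfold1_right1, Matrix.mul_assoc, colProj_mul_of_mul_eq
      (one_kronecker_transpose_hermitian conjTranspose_colProj)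
      (transpose_R_mul_breveL h.R)]
  p₃q₁ := forall_tvec fun Z => by
    simp only [tlift_tvec]; congr 1; apply unfold1_injective
    rw [unfold1_left3, unfold1_right1, Matrix.mul_assoc, colProj_mul_of_mul_eq
      (kronecker_one_transpose_hermitian conjTranspose_colProj)
      (transpose_V_mul_breveL h.V)]
  p₁q₂ := forall_tvec fun Z => by
    simp only [tlift_tvec]; congr 1; apply unfold2_injective
    rw [unfold2_left1, unfold2_right2, Matrix.mul_assoc, colProj_mul_of_mul_eq
      (one_kronecker_transpose_hermitian conjTranspose_colProj)
      (transpose_L_mul_breveR h.L)]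
  p₃q₂ := forall_tvec fun Z => by
    simp only [tlift_tvec]; congr 1; apply unfold2_injective
    rw [unfold2_left3, unfold2_right2, Matrix.mul_assoc, colProj_mul_of_mul_eq
      (kronecker_one_transpose_hermitian conjTranspose_colProj)
      (transpose_V_mul_breveR h.V)]
  p₁q₃ := forall_tvec fun Z => by
    simp only [tlift_tvec]; congr 1; apply unfold3_injective
    rw [unfold3_left1, unfold3_right3, Matrix.mul_assoc, colProj_mul_of_mul_eq
      (one_kronecker_transpose_hermitian conjTranspose_colProj)
      (transpose_L_mul_breveV h.L)]
  p₂q₃ := forall_tvec fun Z => by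
    simp only [tlift_tvec]; congr 1; apply unfold3_injective
    rw [unfold3_left2, unfold3_right3, Matrix.mul_assoc, colProj_mul_of_mul_eq
      (kronecker_one_transpose_hermitian conjTranspose_colProj)
      (transpose_R_mul_breveV h.R)]

/-- The factors of a tensor close to one of multilinear rank `(r, r, r)` are well conditioned. -/
theorem regular_of_close {Zs : Tensor n₁ n₂ s} {σ e : ℝ} (he : e < σ)
    (hrank : mulRank Zs = (r, r, r)) (hσ : σ ≤ sigmaMin Zs)
    (hclose : ‖tvec (F.toTensor - Zs)‖ ≤ e) :
    F.Regular ∧ ‖pinvFactor F.L F.breveL‖ ≤ 1 / (σ - e) ∧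
      ‖pinvFactor F.R F.breveR‖ ≤ 1 / (σ - e) ∧ ‖pinvFactor F.V F.breveV‖ ≤ 1 / (σ - e) := by
  simp only [mulRank, Prod.mk.injEq] at hrank
  obtain ⟨h1, h2, h3⟩ := hrank
  obtain ⟨hL, hbL, hY1⟩ := factorization_of_close (L := F.L) (B := F.breveL) he
    (hσ.trans (min_le_left _ _)) (by simpa using h1) (by
      rw [← unfold1_toTensor, ← unfold1_sub]
      exact (opNorm_le_frobNorm _).trans ((frobNorm_unfold1 _).trans_le hclose))
  obtain ⟨hR, hbR, hY2⟩ := factorization_of_close (L := F.R) (B := F.breveR) he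
    (hσ.trans ((min_le_right _ _).trans (min_le_left _ _))) (by simpa using h2) (by
      rw [← unfold2_toTensor, ← unfold2_sub]
      exact (opNorm_le_frobNorm _).trans ((frobNorm_unfold2 _).trans_le hclose))
  obtain ⟨hV, hbV, hY3⟩ := factorization_of_close (L := F.V) (B := F.breveV) he
    (hσ.trans ((min_le_right _ _).trans (min_le_right _ _))) (by simpa using h3) (by
      rw [← unfold3_toTensor, ← unfold3_sub]
      exact (opNorm_le_frobNorm _).trans ((frobNorm_unfold3 _).trans_le hclose))
  exact ⟨⟨hL, hR, hV, hbL, hbR, hbV⟩, hY1, hY2, hY3⟩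

/-- The preconditioned update of a factor is left multiplication by a square matrix. This lets the
step be followed on the tensor, whatever the choice of factors. -/
lemma factor_update {ι κ : Type*} [Fintype ι] [Fintype κ] [DecidableEq ι] {L : Matrix ι (Fin r) ℂ}
    {B : Matrix κ (Fin r) ℂ} (hL : IsUnit (Lᴴ * L).det) (M : Matrix ι κ ℂ) (η : ℂ) :
    L - η • (M * B * (Bᴴ * B)⁻¹) = (1 - η • (M * pinvFactor L B)) * L := by
  have h : M * pinvFactor L B * L = M * B * (Bᴴ * B)⁻¹ := by
    rw [pinvFactor]
    simp only [Matrix.mul_assoc]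
    rw [Matrix.nonsing_inv_mul _ hL, Matrix.mul_one]
  rw [Matrix.sub_mul, Matrix.one_mul, Matrix.smul_mul, h]

lemma tucker_sub (A : Matrix (Fin n₁) (Fin r) ℂ) (B : Matrix (Fin n₂) (Fin r) ℂ)
    (C : Matrix (Fin s) (Fin r) ℂ) (S S' : Tensor r r r) :
    tucker A B C (S - S') = tucker A B C S - tucker A B C S' := by
  simp only [tucker_eq_left, map_sub]

lemma tucker_smul (A : Matrix (Fin n₁) (Fin r) ℂ) (B : Matrix (Fin n₂) (Fin r) ℂ)
    (C : Matrix (Fin s) (Fin r) ℂ) (t : ℂ) (S : Tensor r r r) :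
    tucker A B C (t • S) = t • tucker A B C S := by
  simp only [tucker_eq_left, map_smul]

/-- The core update becomes p₁p₂p₃ applied to the gradient, since L (LᴴL)⁻¹ Lᴴ is the projection
onto the column space of L. -/
lemma toTensor_gradStep (h : F.Regular) (X : Matrix (Fin s) (Fin (n₁ + n₂ - 1)) ℂ) (η : ℝ)
    (Ω : Fin m → Fin s × Fin (n₁ + n₂ - 1)) :
    (gradStep X η Ω F).toTensor =
      left1 (1 - (η : ℂ) • (unfold1 (gradTensor X Ω F) * pinvFactor F.L F.breveL))
        (left2 (1 - (η : ℂ) • (unfold2 (gradTensor X Ω F) * pinvFactor F.R F.breveR))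
          (left3 (1 - (η : ℂ) • (unfold3 (gradTensor X Ω F) * pinvFactor F.V F.breveV))
            (F.toTensor - (η : ℂ) • left1 (colProj F.L) (left2 (colProj F.R)
              (left3 (colProj F.V) (gradTensor X Ω F)))))) := by
  rw [toTensor, gradStep]
  simp only
  rw [factor_update h.L, factor_update h.R, factor_update h.V, ← tucker_tucker, tucker_eq_left,
    tucker_sub, tucker_smul, tucker_tucker, tucker_tucker, ← colProj, ← colProj, ← colProj,
    tucker_eq_left (colProj F.L), toTensor]

/-- The pseudo-inverse absorbs the projection onto the column space of B, so only the part qᵢE of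
the gradient matters. -/
lemma opNorm_mul_pinvFactor_le {ι κ : Type*} [Fintype ι] [Fintype κ] [DecidableEq ι]
    [DecidableEq κ] {L : Matrix ι (Fin r) ℂ} {B : Matrix κ (Fin r) ℂ}
    (hB : IsUnit (Bᴴ * B).det) (M : Matrix ι κ ℂ) :
    ‖M * pinvFactor L B‖ ≤ frobNorm (M * colProj B) * ‖pinvFactor L B‖ := by
  rw [← colProj_mul_pinvFactor hB, ← Matrix.mul_assoc]
  refine (Matrix.l2_opNorm_mul _ _).trans ?_
  rw [colProj_mul_pinvFactor hB]
  gcongr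
  exact opNorm_le_frobNorm _

lemma sub_proj_eq {ι κ : Type*} [Fintype ι] [Fintype κ] [DecidableEq ι]
    [DecidableEq κ] (P : Matrix ι ι ℂ) (Q : Matrix κ κ ℂ) (D : Matrix ι κ ℂ) :
    (1 - P) * D * (1 - Q) = D - P * D - (D - P * D) * Q := by
  rw [Matrix.sub_mul, Matrix.one_mul, Matrix.mul_sub, Matrix.mul_one]

/-- The bridge from the algorithm to `TuckerProjections.step_contraction`. The two noise bounds are
the only probabilistic input. -/
theorem gradStep_contraction {Zs : Tensor n₁ n₂ s} {Fs : Factors n₁ n₂ s r}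
    (hFs : Zs = Fs.toTensor) (hrank : mulRank Zs = (r, r, r))
    {X : Matrix (Fin s) (Fin (n₁ + n₂ - 1)) ℂ} {η : ℝ} (h0 : 0 ≤ η) (h1 : η ≤ 0.4)
    {Ω : Fin m → Fin s × Fin (n₁ + n₂ - 1)} {σ : ℝ} (hσ0 : 0 < σ) (hσ : σ ≤ sigmaMin Zs)
    (hclose : ‖tvec (F.toTensor - Zs)‖ ≤ σ / 200)
    (hN1 : ‖tvec (left1 (colProj F.L) (gradTensor X Ω F - (F.toTensor - Zs)))‖ ≤
      1 / 50 * ‖tvec (F.toTensor - Zs)‖)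
    (hN2 : ‖tvec (left2 (colProj F.R) (gradTensor X Ω F - (F.toTensor - Zs)))‖ ≤
      1 / 50 * ‖tvec (F.toTensor - Zs)‖) :
    ‖tvec ((gradStep X η Ω F).toTensor - Zs)‖ ≤ (1 - 0.5 * η) * ‖tvec (F.toTensor - Zs)‖ := by
  set e := ‖tvec (F.toTensor - Zs)‖ with he
  have he0 : 0 ≤ e := norm_nonneg _
  obtain ⟨hreg, hY1, hY2, hY3⟩ := regular_of_close (F := F) (e := σ / 200) (by linarith) hrank hσ
    hclose
  set E := gradTensor X Ω F with hE
  set N := E - (F.toTensor - Zs) with hN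
  have hEN : E = (F.toTensor - Zs) + N := by rw [hN]; abel
  set T := projections hreg with hT
  have tp1 : ∀ Z, T.p₁ (tvec Z) = tvec (left1 (colProj F.L) Z) := tlift_tvec _
  have tp2 : ∀ Z, T.p₂ (tvec Z) = tvec (left2 (colProj F.R) Z) := tlift_tvec _
  have tp3 : ∀ Z, T.p₃ (tvec Z) = tvec (left3 (colProj F.V) Z) := tlift_tvec _
  have tq1 : ∀ Z, T.q₁ (tvec Z) = tvec (right1 (colProj F.breveL) Z) := tlift_tvec _
  have tq2 : ∀ Z, T.q₂ (tvec Z) = tvec (right2 (colProj F.breveR) Z) := tlift_tvec _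
  have tq3 : ∀ Z, T.q₃ (tvec Z) = tvec (right3 (colProj F.breveV) Z) := tlift_tvec _
  have q1 := norm_le_of_symm_idem T.symm_q₁ T.q₁q₁
  have q2 := norm_le_of_symm_idem T.symm_q₂ T.q₂q₂
  have q3 := norm_le_of_symm_idem T.symm_q₃ T.q₃q₃
  have hN1' : ‖T.p₁ (tvec N)‖ ≤ 1 / 50 * e := by rw [tp1]; exact hN1
  have hN2' : ‖T.p₂ (tvec N)‖ ≤ 1 / 50 * e := by rw [tp2]; exact hN2
  have hqE : ∀ q : EuclideanSpace ℂ (Fin n₁ × Fin n₂ × Fin s) →ₗ[ℂ]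
      EuclideanSpace ℂ (Fin n₁ × Fin n₂ × Fin s), (∀ x, ‖q x‖ ≤ ‖x‖) →
      ‖q (tvec N)‖ ≤ 1 / 50 * e → ‖q (tvec E)‖ ≤ 51 / 50 * e := by
    intro q hq hqN
    rw [hEN, map_add, map_add]
    refine (norm_add_le _ _).trans ?_
    have := hq (tvec (F.toTensor - Zs))
    linarith
  have hE1 : frobNorm (unfold1 E * colProj F.breveL) ≤ 51 / 50 * e := by
    rw [← unfold1_right1, frobNorm_unfold1, ← tq1]
    exact hqE _ q1 (by rw [← T.q₁p₂]; exact (q1 _).trans hN2')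
  have hE2 : frobNorm (unfold2 E * colProj F.breveR) ≤ 51 / 50 * e := by
    rw [← unfold2_right2, frobNorm_unfold2, ← tq2]
    exact hqE _ q2 (by rw [← T.q₂p₁]; exact (q2 _).trans hN1')
  have hE3 : frobNorm (unfold3 E * colProj F.breveV) ≤ 51 / 50 * e := by
    rw [← unfold3_right3, frobNorm_unfold3, ← tq3]
    exact hqE _ q3 (by rw [← T.q₃p₁]; exact (q3 _).trans hN1')
  -- With e ≤ σ/200 the left side is at most (1.02/200)/(199/200), about 0.0051.
  have hnum : 51 / 50 * e * (1 / (σ - σ / 200)) ≤ 1 / 50 := by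
    rw [mul_one_div, div_le_iff₀ (by linarith)]
    linarith
  have hσp : (0 : ℝ) ≤ 1 / (σ - σ / 200) := by
    apply div_nonneg zero_le_one; linarith
  have hA1 : ‖unfold1 E * pinvFactor F.L F.breveL‖ ≤ 1 / 50 :=
    (opNorm_mul_pinvFactor_le hreg.breveL _).trans
      ((mul_le_mul hE1 hY1 (norm_nonneg _) (by positivity)).trans hnum)
  have hA2 : ‖unfold2 E * pinvFactor F.R F.breveR‖ ≤ 1 / 50 :=
    (opNorm_mul_pinvFactor_le hreg.breveR _).trans
      ((mul_le_mul hE2 hY2 (norm_nonneg _) (by positivity)).trans hnum)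
  have hA3 : ‖unfold3 E * pinvFactor F.V F.breveV‖ ≤ 1 / 50 :=
    (opNorm_mul_pinvFactor_le hreg.breveV _).trans
      ((mul_le_mul hE3 hY3 (norm_nonneg _) (by positivity)).trans hnum)
  have hrk := hrank
  simp only [mulRank, Prod.mk.injEq] at hrk
  obtain ⟨r1, r2, r3⟩ := hrk
  -- The second-order normal part is at most e/200 in each mode. The weaker e/100 suffices, because
  -- three modes then add up to the 3/100 required for the contraction.
  have hquad : e ^ 2 / σ ≤ 1 / 100 * e := by
    rw [div_le_iff₀ hσ0]
    nlinarith
  have hn1 : ‖tvec (F.toTensor - Zs) - T.p₁ (tvec (F.toTensor - Zs)) -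
      T.q₁ (tvec (F.toTensor - Zs) - T.p₁ (tvec (F.toTensor - Zs)))‖ ≤ 1 / 100 * e := by
    rw [tp1, ← map_sub, tq1, ← map_sub, ← frobNorm_unfold1, unfold1_sub, unfold1_right1,
      unfold1_sub, unfold1_left1, ← sub_proj_eq]
    have h := frobNorm_normal_le (Ms := unfold1 Zs) (Ls := Fs.L) (Bs := Fs.breveL) hσ0
      (hσ.trans (min_le_left _ _)) (by simpa using r1) (by rw [hFs, unfold1_toTensor])
      hreg.L hreg.breveL
    rw [← unfold1_toTensor, ← unfold1_sub, frobNorm_unfold1] at h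
    exact h.trans hquad
  have hn2 : ‖tvec (F.toTensor - Zs) - T.p₂ (tvec (F.toTensor - Zs)) -
      T.q₂ (tvec (F.toTensor - Zs) - T.p₂ (tvec (F.toTensor - Zs)))‖ ≤ 1 / 100 * e := by
    rw [tp2, ← map_sub, tq2, ← map_sub, ← frobNorm_unfold2, unfold2_sub, unfold2_right2,
      unfold2_sub, unfold2_left2, ← sub_proj_eq]
    have h := frobNorm_normal_le (Ms := unfold2 Zs) (Ls := Fs.R) (Bs := Fs.breveR) hσ0
      (hσ.trans ((min_le_right _ _).trans (min_le_left _ _))) (by simpa using r2)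
      (by rw [hFs, unfold2_toTensor]) hreg.R hreg.breveR
    rw [← unfold2_toTensor, ← unfold2_sub, frobNorm_unfold2] at h
    exact h.trans hquad
  have hn3 : ‖tvec (F.toTensor - Zs) - T.p₃ (tvec (F.toTensor - Zs)) -
      T.q₃ (tvec (F.toTensor - Zs) - T.p₃ (tvec (F.toTensor - Zs)))‖ ≤ 1 / 100 * e := by
    rw [tp3, ← map_sub, tq3, ← map_sub, ← frobNorm_unfold3, unfold3_sub, unfold3_right3,
      unfold3_sub, unfold3_left3, ← sub_proj_eq]
    have h := frobNorm_normal_le (Ms := unfold3 Zs) (Ls := Fs.V) (Bs := Fs.breveV) hσ0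
      (hσ.trans ((min_le_right _ _).trans (min_le_right _ _))) (by simpa using r3)
      (by rw [hFs, unfold3_toTensor]) hreg.V hreg.breveV
    rw [← unfold3_toTensor, ← unfold3_sub, frobNorm_unfold3] at h
    exact h.trans hquad
  have hnormal := T.norm_normalPart_le hn1 hn2 hn3
  have hstep := T.step_contraction h0 h1 (Z := tvec F.toTensor) (Zs := tvec Zs) (N := tvec N)
    (C := tvec (left1 (colProj F.L) (left2 (colProj F.R) (left3 (colProj F.V) E))))
    (by rw [← map_sub]; exact hN1') (by rw [← map_sub]; exact hN2')
    (A₁ := tlift (left1 (unfold1 E * pinvFactor F.L F.breveL)))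
    (A₂ := tlift (left2 (unfold2 E * pinvFactor F.R F.breveR)))
    (A₃ := tlift (left3 (unfold3 E * pinvFactor F.V F.breveV)))
    (forall_tvec fun Z => by
      rw [tlift_tvec]; exact (norm_tvec_left1_le _ _).trans (by gcongr))
    (forall_tvec fun Z => by
      rw [tlift_tvec]; exact (norm_tvec_left2_le _ _).trans (by gcongr))
    (forall_tvec fun Z => by
      rw [tlift_tvec]; exact (norm_tvec_left3_le _ _).trans (by gcongr))
    (by
      rw [tlift_tvec, ← map_sub, ← map_add, ← hEN, tq1]
      congr 1; apply unfold1_injective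
      rw [unfold1_left1, unfold1_right1, unfold1_toTensor, Matrix.mul_assoc,
        pinvFactor_mul hreg.L])
    (by
      rw [tlift_tvec, ← map_sub, ← map_add, ← hEN, tq2]
      congr 1; apply unfold2_injective
      rw [unfold2_left2, unfold2_right2, unfold2_toTensor, Matrix.mul_assoc,
        pinvFactor_mul hreg.R])
    (by
      rw [tlift_tvec, ← map_sub, ← map_add, ← hEN, tq3]
      congr 1; apply unfold3_injective
      rw [unfold3_left3, unfold3_right3, unfold3_toTensor, Matrix.mul_assoc,
        pinvFactor_mul hreg.V])
    (by rw [← map_sub, ← map_add, ← hEN, TuckerProjections.core, tp3, tp2, tp1])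
    (by rw [← map_sub]; linarith)
  rw [toTensor_gradStep hreg, left1_one_sub_smul, left2_one_sub_smul, left3_one_sub_smul]
  simp only [← map_smul, tlift_tvec, ← map_sub] at hstep ⊢
  exact hstep

end Factors

end GradientStep

/-! ### The scaled projection does not increase the distance to incoherent tensors -/

section Projection

/-- A discriminant condition for the next lemma. The difference of the two sides is (1 - lm)(l - m)²
+ ((1 - l)(1 - m))²(lm + l + m). -/
lemma shrink_scalar_ineq {l m : ℝ} (hl : 0 < l) (hl1 : l ≤ 1) (hm : 0 < m) (hm1 : m ≤ 1) :
    (1 - l * m) ^ 2 * (l * m) ≤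
      (1 - (l * m) ^ 2 - l * (1 - l) - m * (1 - m)) * (l + m - 2 * (l * m)) := by
  have h1 : 0 ≤ (1 - l * m) * (l - m) ^ 2 :=
    mul_nonneg (by nlinarith [mul_le_one₀ hl1 hm.le hm1]) (sq_nonneg _)
  have h2 : 0 ≤ ((1 - l) * (1 - m)) ^ 2 * (l * m + l + m) := by positivity
  nlinarith [h1, h2]

/-- An entrywise estimate whose last two terms play the role of Lagrange multiplier terms. They have
no sign for a single entry, but become nonpositive after summation over a slice that has been
shrunk. -/
lemma norm_shrink_sub_sq_le {l m : ℝ} (hl : 0 < l) (hl1 : l ≤ 1) (hm : 0 < m) (hm1 : m ≤ 1)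
    (z x : ℂ) :
    ‖((l : ℂ) * (m : ℂ)) * z - x‖ ^ 2 ≤ ‖z - x‖ ^ 2 +
      (1 - l) / l * (‖x‖ ^ 2 - l ^ 2 * ‖z‖ ^ 2) + (1 - m) / m * (‖x‖ ^ 2 - m ^ 2 * ‖z‖ ^ 2) := by
  have e1 : ∀ w : ℂ, ‖w‖ ^ 2 = w.re ^ 2 + w.im ^ 2 := fun w => by
    rw [← Complex.normSq_eq_norm_sq, Complex.normSq_apply]; ring
  simp only [e1, Complex.sub_re, Complex.sub_im, Complex.mul_re, Complex.mul_im, Complex.ofReal_re,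
    Complex.ofReal_im]
  obtain ⟨a, b⟩ := z
  obtain ⟨c, d⟩ := x
  simp only
  have hp : 0 < l * m := mul_pos hl hm
  have key := shrink_scalar_ineq hl hl1 hm hm1
  set w := 1 - l * m with hw
  set C := 1 - (l * m) ^ 2 - l * (1 - l) - m * (1 - m) with hC
  set τ := l + m - 2 * (l * m) with hτ
  have hτ0 : 0 ≤ τ := by nlinarith
  have hx : (1 - l) / l + (1 - m) / m = τ / (l * m) := by rw [hτ]; field_simp; ring
  have hl2 : (1 - l) / l * l ^ 2 = l * (1 - l) := by field_simp
  have hm2 : (1 - m) / m * m ^ 2 = m * (1 - m) := by field_simp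
  suffices h : 0 ≤ C * (a ^ 2 + b ^ 2) - 2 * w * (a * c + b * d) +
      τ / (l * m) * (c ^ 2 + d ^ 2) by
    rw [← hx] at h
    have e2 : (1 - l) / l * (c ^ 2 + d ^ 2 - l ^ 2 * (a ^ 2 + b ^ 2)) =
      (1 - l) / l * (c ^ 2 + d ^ 2) - l * (1 - l) * (a ^ 2 + b ^ 2) := by rw [← hl2]; ring
    have e3 : (1 - m) / m * (c ^ 2 + d ^ 2 - m ^ 2 * (a ^ 2 + b ^ 2)) =
      (1 - m) / m * (c ^ 2 + d ^ 2) - m * (1 - m) * (a ^ 2 + b ^ 2) := by rw [← hm2]; ring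
    rw [e2, e3]
    rw [hC, hw] at h
    nlinarith [h]
  rcases hτ0.eq_or_lt with h0 | hpos
  · have hl' : l = 1 := by nlinarith
    have hm' : m = 1 := by nlinarith
    rw [← h0, hC, hw, hl', hm']; norm_num
  -- Completing the square: multiplied by its positive last coefficient, the quadratic form is a sum
  -- of squares plus the discriminant term handled by `shrink_scalar_ineq`.
  · have hmul : τ / (l * m) * (C * (a ^ 2 + b ^ 2) - 2 * w * (a * c + b * d) +
        τ / (l * m) * (c ^ 2 + d ^ 2)) = (C * (τ / (l * m)) - w ^ 2) * (a ^ 2 + b ^ 2) +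
        ((w * a - τ / (l * m) * c) ^ 2 + (w * b - τ / (l * m) * d) ^ 2) := by ring
    have h1 : 0 ≤ C * (τ / (l * m)) - w ^ 2 := by
      rw [← mul_div_assoc, sub_nonneg, le_div_iff₀ hp]; exact key
    have h2 : 0 < τ / (l * m) := div_pos hpos hp
    refine (mul_nonneg_iff_of_pos_left h2).1 ?_
    rw [hmul]; positivity

variable {a b c : ℕ}

lemma rowNorm_unfold1_sq (Z : Tensor a b c) (i : Fin a) :
    rowNorm (unfold1 Z) i ^ 2 = ∑ j, ∑ k, ‖Z i j k‖ ^ 2 := by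
  rw [rowNorm_sq, Fintype.sum_prod_type, Finset.sum_comm]; rfl

lemma rowNorm_unfold2_sq (Z : Tensor a b c) (j : Fin b) :
    rowNorm (unfold2 Z) j ^ 2 = ∑ i, ∑ k, ‖Z i j k‖ ^ 2 := by
  rw [rowNorm_sq, Fintype.sum_prod_type, Finset.sum_comm]; rfl

/-- Both families of factors are computed from the same unshrunk Z, so two successive contractions
cannot be chained: after shrinking in mode 1, the factors m need no longer be admissible. Summing
the entrywise estimate treats both modes at once. -/
theorem norm_tvec_shrink_sub_le {l : Fin a → ℝ} {m : Fin b → ℝ} (Z X : Tensor a b c)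
    (hl : ∀ i, 0 < l i) (hl1 : ∀ i, l i ≤ 1) (hm : ∀ i, 0 < m i) (hm1 : ∀ i, m i ≤ 1)
    (hlX : ∀ i, l i < 1 → rowNorm (unfold1 X) i ≤ l i * rowNorm (unfold1 Z) i)
    (hmX : ∀ i, m i < 1 → rowNorm (unfold2 X) i ≤ m i * rowNorm (unfold2 Z) i) :
    ‖tvec ((fun i j k => ((l i : ℂ) * (m j : ℂ)) * Z i j k) - X : Tensor a b c)‖ ≤
      ‖tvec (Z - X)‖ := by
  refine le_of_sq_le_sq ?_ (norm_nonneg _)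
  rw [norm_tvec_sq, norm_tvec_sq]
  have h1 : ∑ i, ∑ j, ∑ k, (1 - l i) / l i * (‖X i j k‖ ^ 2 - l i ^ 2 * ‖Z i j k‖ ^ 2) ≤ 0 := by
    refine Finset.sum_nonpos fun i _ => ?_
    simp only [← Finset.mul_sum, Finset.sum_sub_distrib]
    rw [← rowNorm_unfold1_sq, ← rowNorm_unfold1_sq]
    rcases (hl1 i).eq_or_lt with h | h
    · simp [h]
    · refine mul_nonpos_of_nonneg_of_nonpos (div_nonneg (by linarith) (hl i).le) ?_
      have := pow_le_pow_left₀ (rowNorm_nonneg _ _) (hlX i h) 2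
      rw [mul_pow] at this; linarith
  have h2 : ∑ i, ∑ j, ∑ k, (1 - m j) / m j * (‖X i j k‖ ^ 2 - m j ^ 2 * ‖Z i j k‖ ^ 2) ≤ 0 := by
    rw [Finset.sum_comm]
    refine Finset.sum_nonpos fun j _ => ?_
    simp only [← Finset.mul_sum, Finset.sum_sub_distrib]
    rw [← rowNorm_unfold2_sq, ← rowNorm_unfold2_sq]
    rcases (hm1 j).eq_or_lt with h | h
    · simp [h]
    · refine mul_nonpos_of_nonneg_of_nonpos (div_nonneg (by linarith) (hm j).le) ?_
      have := pow_le_pow_left₀ (rowNorm_nonneg _ _) (hmX j h) 2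
      rw [mul_pow] at this; linarith
  calc _ ≤ ∑ i, ∑ j, ∑ k, (‖Z i j k - X i j k‖ ^ 2 +
        (1 - l i) / l i * (‖X i j k‖ ^ 2 - l i ^ 2 * ‖Z i j k‖ ^ 2) +
        (1 - m j) / m j * (‖X i j k‖ ^ 2 - m j ^ 2 * ‖Z i j k‖ ^ 2)) := by
        gcongr with i _ j _ k _
        exact norm_shrink_sub_sq_le (hl i) (hl1 i) (hm j) (hm1 j) _ _
    _ ≤ _ := by
        simp only [Finset.sum_add_distrib]
        have : ∑ i, ∑ j, ∑ k, ‖Z i j k - X i j k‖ ^ 2 = ∑ i, ∑ j, ∑ k, ‖(Z - X) i j k‖ ^ 2 := rfl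
        linarith

namespace Factors

lemma shrink_pos {B : ℝ} (hB : 0 < B) (n : ℕ) {t : ℝ} (ht : 0 ≤ t) : 0 < shrink B n t := by
  unfold shrink
  split_ifs with h
  · exact one_pos
  · have : 0 < √(n : ℝ) * t := lt_of_le_of_ne (by positivity) (Ne.symm h)
    exact lt_min one_pos (by positivity)

lemma shrink_le_one (B : ℝ) (n : ℕ) (t : ℝ) : shrink B n t ≤ 1 := by
  unfold shrink
  split_ifs
  · exact le_rfl
  · exact min_le_left _ _

lemma shrink_mul_le {B : ℝ} (hB : 0 < B) {n : ℕ} (hn : 0 < n) {t : ℝ} (ht : 0 ≤ t) :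
    shrink B n t * t ≤ B / √(n : ℝ) := by
  have hn' : 0 < √(n : ℝ) := Real.sqrt_pos.2 (by exact_mod_cast hn)
  unfold shrink
  split_ifs with h
  · have : t = 0 := by simpa [hn'.ne'] using h
    rw [this, mul_zero]; positivity
  · have ht' : 0 < t := lt_of_le_of_ne ht fun h' => h (by rw [← h', mul_zero])
    calc _ ≤ B / (√(n : ℝ) * t) * t := by gcongr; exact min_le_right _ _
      _ = _ := by field_simp

lemma le_shrink_mul {B : ℝ} {n : ℕ} {t : ℝ} (h : shrink B n t < 1) :
    B / √(n : ℝ) ≤ shrink B n t * t := by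
  unfold shrink at h ⊢
  split_ifs with h0
  · rw [if_pos h0] at h; exact absurd h (lt_irrefl _)
  · rw [if_neg h0] at h
    have h1 : min 1 (B / (√(n : ℝ) * t)) = B / (√(n : ℝ) * t) := by
      rcases min_choice (1 : ℝ) (B / (√(n : ℝ) * t)) with h' | h'
      · rw [h'] at h; exact absurd h (lt_irrefl _)
      · exact h'
    rw [h1]
    have : t ≠ 0 := fun h' => h0 (by rw [h', mul_zero])
    apply le_of_eq; field_simp

variable {n₁ n₂ s r : ℕ}

/-- The scaling uses the norms of the rows of L L̆ᴴ, which are the slice norms of the tensor. Hence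
the projection depends on the tensor alone, not on its factorization. -/
lemma toTensor_project (B : ℝ) (F : Factors n₁ n₂ s r) :
    (project B F).toTensor = fun i j k =>
      ((shrink B (n₁ + n₂ - 1) (rowNorm (unfold1 F.toTensor) i) : ℂ) *
        (shrink B (n₁ + n₂ - 1) (rowNorm (unfold2 F.toTensor) j) : ℂ)) * F.toTensor i j k := by
  funext i j k
  rw [unfold1_toTensor, unfold2_toTensor, toTensor, toTensor, tucker, tucker]
  simp only [Finset.mul_sum, project, Matrix.of_apply]
  refine Finset.sum_congr rfl fun _ _ => Finset.sum_congr rfl fun _ _ =>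
    Finset.sum_congr rfl fun _ _ => ?_
  ring

/-- The scaled projection does not increase the distance to a tensor whose horizontal and lateral
slices have norm at most `B / √n`. -/
theorem norm_tvec_project_sub_le {B : ℝ} (hB : 0 < B) (F : Factors n₁ n₂ s r)
    {Zs : Tensor n₁ n₂ s}
    (h1 : ∀ i, rowNorm (unfold1 Zs) i ≤ B / √((n₁ + n₂ - 1 : ℕ) : ℝ))
    (h2 : ∀ i, rowNorm (unfold2 Zs) i ≤ B / √((n₁ + n₂ - 1 : ℕ) : ℝ)) :
    ‖tvec ((project B F).toTensor - Zs)‖ ≤ ‖tvec (F.toTensor - Zs)‖ := by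
  rw [toTensor_project]
  exact norm_tvec_shrink_sub_le _ _ (fun _ => shrink_pos hB _ (rowNorm_nonneg _ _))
    (fun _ => shrink_le_one _ _ _) (fun _ => shrink_pos hB _ (rowNorm_nonneg _ _))
    (fun _ => shrink_le_one _ _ _)
    (fun i hi => (h1 i).trans (le_shrink_mul hi))
    (fun i hi => (h2 i).trans (le_shrink_mul hi))

lemma rowNorm_unfold1_project_le {B : ℝ} (hB : 0 < B) (hn : 0 < n₁ + n₂ - 1)
    (F : Factors n₁ n₂ s r) (i : Fin n₁) :
    rowNorm (unfold1 (project B F).toTensor) i ≤ B / √((n₁ + n₂ - 1 : ℕ) : ℝ) := by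
  refine le_trans ?_ (shrink_mul_le hB hn (rowNorm_nonneg (unfold1 F.toTensor) i))
  have hp := shrink_pos hB (n₁ + n₂ - 1) (rowNorm_nonneg (unfold1 F.toTensor) i)
  refine le_of_sq_le_sq ?_ (mul_nonneg hp.le (rowNorm_nonneg _ _))
  rw [mul_pow, rowNorm_unfold1_sq, rowNorm_unfold1_sq, toTensor_project]
  simp only [Finset.mul_sum]
  gcongr with j _ k _
  have hm := shrink_pos hB (n₁ + n₂ - 1) (rowNorm_nonneg (unfold2 F.toTensor) j)
  rw [norm_mul, norm_mul, Complex.norm_real, Complex.norm_real, Real.norm_of_nonneg hp.le,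
    Real.norm_of_nonneg hm.le, ← mul_pow]
  gcongr
  exact mul_le_of_le_one_right hp.le (shrink_le_one _ _ _)

lemma rowNorm_unfold2_project_le {B : ℝ} (hB : 0 < B) (hn : 0 < n₁ + n₂ - 1)
    (F : Factors n₁ n₂ s r) (i : Fin n₂) :
    rowNorm (unfold2 (project B F).toTensor) i ≤ B / √((n₁ + n₂ - 1 : ℕ) : ℝ) := by
  refine le_trans ?_ (shrink_mul_le hB hn (rowNorm_nonneg (unfold2 F.toTensor) i))
  have hp := shrink_pos hB (n₁ + n₂ - 1) (rowNorm_nonneg (unfold2 F.toTensor) i)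
  refine le_of_sq_le_sq ?_ (mul_nonneg hp.le (rowNorm_nonneg _ _))
  rw [mul_pow, rowNorm_unfold2_sq, rowNorm_unfold2_sq, toTensor_project]
  simp only [Finset.mul_sum]
  gcongr with j _ k _
  have hm := shrink_pos hB (n₁ + n₂ - 1) (rowNorm_nonneg (unfold1 F.toTensor) j)
  rw [norm_mul, norm_mul, Complex.norm_real, Complex.norm_real, Real.norm_of_nonneg hp.le,
    Real.norm_of_nonneg hm.le, ← mul_pow]
  gcongr
  exact mul_le_of_le_one_left hp.le (shrink_le_one _ _ _)

end Factors

end Projection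

/-! ### The weighted Hankel lifting is an isometry -/

section Lifting

variable {n₁ n₂ s m : ℕ}

/-- The skew-diagonal of a position. -/
def skewIdx (i₁ : Fin n₁) (i₂ : Fin n₂) : Fin (n₁ + n₂ - 1) :=
  ⟨i₁.val + i₂.val, by have := i₁.isLt; have := i₂.isLt; omega⟩

lemma val_add_eq_iff (i₁ : Fin n₁) (i₂ : Fin n₂) (a : Fin (n₁ + n₂ - 1)) :
    i₁.val + i₂.val = a.val ↔ skewIdx i₁ i₂ = a := by
  rw [Fin.ext_iff]; rfl

lemma skewLen_pos (h1 : 0 < n₁) (h2 : 0 < n₂) (a : Fin (n₁ + n₂ - 1)) :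
    0 < skewLen n₁ n₂ a := by
  have ha := a.isLt
  refine Finset.card_pos.2 ⟨(⟨min a.val (n₁ - 1), by omega⟩, ⟨a.val - min a.val (n₁ - 1), by omega⟩), ?_⟩
  simp only [Finset.mem_filter, Finset.mem_univ, true_and]
  omega

lemma skewLen_eq_sum (a : ℕ) :
    ∑ i₁ : Fin n₁, ∑ i₂ : Fin n₂, (if i₁.val + i₂.val = a then 1 else 0) = skewLen n₁ n₂ a := by
  rw [skewLen, Finset.card_filter, Fintype.sum_prod_type]

lemma sum_skew {M : Type*} [AddCommMonoid M] (f : Fin n₁ → Fin n₂ → Fin (n₁ + n₂ - 1) → M) :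
    ∑ a, ∑ i₁, ∑ i₂, (if i₁.val + i₂.val = a.val then f i₁ i₂ a else 0) =
      ∑ i₁, ∑ i₂, f i₁ i₂ (skewIdx i₁ i₂) := by
  rw [Finset.sum_comm]
  refine Finset.sum_congr rfl fun i₁ _ => ?_
  rw [Finset.sum_comm]
  refine Finset.sum_congr rfl fun i₂ _ => ?_
  simp only [val_add_eq_iff]
  rw [Finset.sum_ite_eq]
  simp

lemma liftG_apply (X : Matrix (Fin s) (Fin (n₁ + n₂ - 1)) ℂ) (i₁ : Fin n₁) (i₂ : Fin n₂)
    (j : Fin s) : (liftG X : Tensor n₁ n₂ s) i₁ i₂ j =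
      (((√(skewLen n₁ n₂ (skewIdx i₁ i₂)))⁻¹ : ℝ) : ℂ) * X j (skewIdx i₁ i₂) := rfl

/-- The weighted Hankel lifting as a linear map. -/
def liftGₗ (n₁ n₂ s : ℕ) : Matrix (Fin s) (Fin (n₁ + n₂ - 1)) ℂ →ₗ[ℂ] Tensor n₁ n₂ s where
  toFun := liftG
  map_add' X Y := by funext i j k; simp only [Pi.add_apply, liftG_apply, Matrix.add_apply]; ring
  map_smul' t X := by
    funext i j k
    simp only [Pi.smul_apply, liftG_apply, Matrix.smul_apply, smul_eq_mul, RingHom.id_apply]; ring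

lemma liftGₗ_apply (X : Matrix (Fin s) (Fin (n₁ + n₂ - 1)) ℂ) : liftGₗ n₁ n₂ s X = liftG X := rfl

/-- The adjoint of the weighted Hankel lifting as a linear map. -/
def adjGₗ (n₁ n₂ s : ℕ) : Tensor n₁ n₂ s →ₗ[ℂ] Matrix (Fin s) (Fin (n₁ + n₂ - 1)) ℂ where
  toFun := adjG
  map_add' X Y := by
    ext j a
    simp only [adjG, Matrix.of_apply, Matrix.add_apply, ← mul_add, ← Finset.sum_add_distrib,
      Pi.add_apply]
    congr 1
    refine Finset.sum_congr rfl fun _ _ => Finset.sum_congr rfl fun _ _ => ?_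
    split_ifs <;> simp
  map_smul' t X := by
    ext j a
    simp only [adjG, Matrix.of_apply, Matrix.smul_apply, Pi.smul_apply, smul_eq_mul,
      RingHom.id_apply]
    rw [mul_left_comm, Finset.mul_sum]
    simp only [Finset.mul_sum, mul_ite, mul_zero]

lemma adjG_sub (Z Y : Tensor n₁ n₂ s) : adjG (Z - Y) = adjG Z - adjG Y := map_sub (adjGₗ n₁ n₂ s) Z Y

lemma liftG_sub (X Y : Matrix (Fin s) (Fin (n₁ + n₂ - 1)) ℂ) :
    (liftG (X - Y) : Tensor n₁ n₂ s) = liftG X - liftG Y := map_sub (liftGₗ n₁ n₂ s) X Y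

lemma inner_mvec {ι κ : Type*} [Fintype ι] [Fintype κ] (X Y : Matrix ι κ ℂ) :
    inner ℂ (mvec X) (mvec Y) = ∑ i, ∑ j, star (X i j) * Y i j := by
  rw [← Fintype.sum_prod_type', PiLp.inner_apply]
  refine Finset.sum_congr rfl fun _ _ => ?_
  rw [RCLike.inner_apply, mul_comm]; rfl

lemma inner_tvec_liftG (Z : Tensor n₁ n₂ s) (X : Matrix (Fin s) (Fin (n₁ + n₂ - 1)) ℂ) :
    inner ℂ (tvec Z) (tvec (liftG X)) = inner ℂ (mvec (adjG Z)) (mvec X) := by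
  rw [inner_tvec, inner_mvec]
  have h : ∀ j a, star (adjG Z j a) * X j a = ∑ i₁ : Fin n₁, ∑ i₂ : Fin n₂,
      if i₁.val + i₂.val = a.val then
        star (Z i₁ i₂ j) * ((((√(skewLen n₁ n₂ a))⁻¹ : ℝ) : ℂ) * X j a) else 0 := by
    intro j a
    rw [adjG, Matrix.of_apply, star_mul', star_sum, mul_assoc, mul_left_comm, Finset.sum_mul]
    refine Finset.sum_congr rfl fun i₁ _ => ?_
    rw [star_sum, Finset.sum_mul]
    refine Finset.sum_congr rfl fun i₂ _ => ?_
    split_ifs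
    · congr 2
      simp
    · simp
  simp only [h, sum_skew]
  conv_rhs => rw [Finset.sum_comm]
  refine Finset.sum_congr rfl fun i₁ _ => ?_
  rw [Finset.sum_comm]
  rfl

/-- The a-th skew-diagonal has w_a entries, and the weight 1/√w_a is applied once by the lifting and
once by its adjoint. -/
lemma adjG_liftG (h1 : 0 < n₁) (h2 : 0 < n₂) (X : Matrix (Fin s) (Fin (n₁ + n₂ - 1)) ℂ) :
    adjG (liftG X : Tensor n₁ n₂ s) = X := by
  ext j a
  have hw : (0 : ℝ) < skewLen n₁ n₂ a := by exact_mod_cast skewLen_pos h1 h2 a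
  have h : ∀ (i₁ : Fin n₁) (i₂ : Fin n₂),
      (if i₁.val + i₂.val = a.val then (liftG X : Tensor n₁ n₂ s) i₁ i₂ j else 0) =
        (((if i₁.val + i₂.val = a.val then 1 else 0 : ℕ) : ℂ)) *
          ((((√(skewLen n₁ n₂ a))⁻¹ : ℝ) : ℂ) * X j a) := by
    intro i₁ i₂
    split_ifs with hi
    · rw [liftG_apply, (val_add_eq_iff _ _ _).1 hi]; simp
    · simp
  rw [adjG, Matrix.of_apply]
  simp only [h, ← Finset.sum_mul, ← Nat.cast_sum]
  rw [skewLen_eq_sum]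
  have h3 : (((√(skewLen n₁ n₂ a))⁻¹ : ℝ) : ℂ) * (((√(skewLen n₁ n₂ a))⁻¹ : ℝ) : ℂ) *
      ((skewLen n₁ n₂ a : ℕ) : ℂ) = 1 := by
    rw [← Complex.ofReal_natCast, ← Complex.ofReal_mul, ← Complex.ofReal_mul, ← mul_inv,
      Real.mul_self_sqrt hw.le, inv_mul_cancel₀ hw.ne', Complex.ofReal_one]
  linear_combination (X j a) * h3

lemma norm_tvec_liftG (h1 : 0 < n₁) (h2 : 0 < n₂) (X : Matrix (Fin s) (Fin (n₁ + n₂ - 1)) ℂ) :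
    ‖tvec (liftG X : Tensor n₁ n₂ s)‖ = frobNorm X := by
  have h := inner_tvec_liftG (liftG X : Tensor n₁ n₂ s) X
  rw [adjG_liftG h1 h2, inner_self_eq_norm_sq_to_K, inner_self_eq_norm_sq_to_K,
    ← frobNorm_eq_norm_mvec] at h
  have h' : ‖tvec (liftG X : Tensor n₁ n₂ s)‖ ^ 2 = frobNorm X ^ 2 := by exact_mod_cast h
  exact (pow_left_inj₀ (norm_nonneg _) (frobNorm_nonneg _) two_ne_zero).1 h'

lemma frobNorm_adjG_le (h1 : 0 < n₁) (h2 : 0 < n₂) (Z : Tensor n₁ n₂ s) :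
    frobNorm (adjG Z) ≤ ‖tvec Z‖ := by
  have h := inner_tvec_liftG Z (adjG Z)
  have h3 := norm_inner_le_norm (𝕜 := ℂ) (tvec Z) (tvec (liftG (adjG Z) : Tensor n₁ n₂ s))
  rw [h, inner_self_eq_norm_sq_to_K, ← frobNorm_eq_norm_mvec, norm_tvec_liftG h1 h2] at h3
  have h4 : frobNorm (adjG Z) ^ 2 ≤ ‖tvec Z‖ * frobNorm (adjG Z) := by
    refine le_trans (le_of_eq ?_) h3
    simp
  rcases (frobNorm_nonneg (adjG Z)).eq_or_lt with h5 | h5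
  · rw [← h5]; exact norm_nonneg _
  · nlinarith

lemma unweight_reweight (h1 : 0 < n₁) (h2 : 0 < n₂) (X : Matrix (Fin s) (Fin (n₁ + n₂ - 1)) ℂ) :
    unweight n₁ n₂ (reweight n₁ n₂ X) = X := by
  ext j a
  have hw : (0 : ℝ) < √(skewLen n₁ n₂ a) :=
    Real.sqrt_pos.2 (by exact_mod_cast skewLen_pos h1 h2 a)
  rw [unweight, reweight, Matrix.of_apply, Matrix.of_apply, ← mul_assoc, ← Complex.ofReal_mul,
    inv_mul_cancel₀ hw.ne', Complex.ofReal_one, one_mul]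

lemma liftG_reweight (h1 : 0 < n₁) (h2 : 0 < n₂) (X : Matrix (Fin s) (Fin (n₁ + n₂ - 1)) ℂ) :
    (liftG (reweight n₁ n₂ X) : Tensor n₁ n₂ s) = hankel X := by
  rw [liftG, unweight_reweight h1 h2]

lemma adjG_hankel (h1 : 0 < n₁) (h2 : 0 < n₂) (X : Matrix (Fin s) (Fin (n₁ + n₂ - 1)) ℂ) :
    adjG (hankel X : Tensor n₁ n₂ s) = reweight n₁ n₂ X := by
  rw [← liftG_reweight h1 h2, adjG_liftG h1 h2]

lemma frobNorm_unweight_le (h1 : 0 < n₁) (h2 : 0 < n₂)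
    (X : Matrix (Fin s) (Fin (n₁ + n₂ - 1)) ℂ) : frobNorm (unweight n₁ n₂ X) ≤ frobNorm X := by
  unfold frobNorm
  gcongr with j _ a _
  have hw : (1 : ℝ) ≤ √(skewLen n₁ n₂ a) :=
    Real.one_le_sqrt.2 (by exact_mod_cast skewLen_pos h1 h2 a)
  rw [unweight, Matrix.of_apply, norm_mul, Complex.norm_real, norm_inv,
    Real.norm_of_nonneg (by positivity)]
  exact mul_le_of_le_one_left (norm_nonneg _) (inv_le_one_of_one_le₀ hw)

/-- The error of the estimate is controlled by the error of the lifted tensor. -/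
lemma frobNorm_estimate_sub_le {r : ℕ} (h1 : 0 < n₁) (h2 : 0 < n₂) (F : Factors n₁ n₂ s r)
    (X : Matrix (Fin s) (Fin (n₁ + n₂ - 1)) ℂ) :
    frobNorm (F.estimate - X) ≤ ‖tvec (F.toTensor - hankel X)‖ := by
  have h : F.estimate - X = unweight n₁ n₂ (adjG (F.toTensor - hankel X)) := by
    conv_lhs => rw [← unweight_reweight h1 h2 X, ← adjG_hankel h1 h2, Factors.estimate]
    rw [adjG_sub]
    ext j a
    simp only [unweight, Matrix.of_apply, Matrix.sub_apply, mul_sub]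
  rw [h]
  exact (frobNorm_unweight_le h1 h2 _).trans (frobNorm_adjG_le h1 h2 _)

lemma sampleOp_eq_sum {n : ℕ} (Ω : Fin m → Fin s × Fin n) (Y : Matrix (Fin s) (Fin n) ℂ) :
    sampleOp Ω Y = ∑ i, Y (Ω i).1 (Ω i).2 • Matrix.single (Ω i).1 (Ω i).2 (1 : ℂ) := by
  ext j a
  rw [sampleOp, Matrix.of_apply, Matrix.sum_apply]
  refine Finset.sum_congr rfl fun i _ => ?_
  rw [Matrix.smul_apply, Matrix.single_apply]
  by_cases h : Ω i = (j, a)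
  · simp [h]
  · rw [if_neg h, if_neg fun h' => h (Prod.ext h'.1 h'.2), smul_zero]

lemma matrix_eq_sum_single' {n : ℕ} (Y : Matrix (Fin s) (Fin n) ℂ) :
    Y = ∑ x : Fin s × Fin n, Y x.1 x.2 • Matrix.single x.1 x.2 (1 : ℂ) := by
  conv_lhs => rw [Matrix.matrix_eq_sum_single Y]
  rw [Fintype.sum_prod_type]
  simp [Matrix.smul_single]

/-- Concentration of the sampling operator after a linear map. -/
theorem ncard_norm_sampleOp_sub_ge {n : ℕ} {E : Type*} [NormedAddCommGroup E]
    [InnerProductSpace ℂ E] (hs : 0 < s) (hn : 0 < n) (hm : 0 < m)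
    (T : Matrix (Fin s) (Fin n) ℂ →ₗ[ℂ] E) (Y : Matrix (Fin s) (Fin n) ℂ) {β y f t l : ℝ}
    (hβ0 : 0 ≤ β) (hβ : ∀ j a, ‖T (Matrix.single j a 1)‖ ≤ β) (hy : ∀ j a, ‖Y j a‖ ≤ y)
    (hf : frobNorm Y ^ 2 ≤ f) (ht : 0 < t) (hl : 0 < l)
    (h1 : 4 * l * (β * y) ≤ t * ((m : ℝ) / (s * n)))
    (h2 : 4 * l * (β ^ 2 * f) ≤ t ^ 2 * ((m : ℝ) / (s * n))) :
    (Set.ncard {Ω : Fin m → Fin s × Fin n |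
      t ≤ ‖T (((((m : ℝ) / (s * n))⁻¹ : ℝ) : ℂ) • sampleOp Ω Y - Y)‖} : ℝ) ≤
      2 * Real.exp (-l) * ((s : ℝ) * n) ^ m := by
  let _ : InnerProductSpace ℝ E := InnerProductSpace.complexToReal
  have : Nonempty (Fin s × Fin n) := ⟨(⟨0, hs⟩, ⟨0, hn⟩)⟩
  have hs' : (0 : ℝ) < s := by exact_mod_cast hs
  have hn' : (0 : ℝ) < n := by exact_mod_cast hn
  have hm' : (0 : ℝ) < m := by exact_mod_cast hm
  set p : ℝ := (m : ℝ) / (s * n) with hp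
  have hp0 : 0 < p := by positivity
  have hcard : (Fintype.card (Fin s × Fin n) : ℝ) = s * n := by simp
  -- One draw contributes p⁻¹ Y(x) T(e_x). As p = m/(sn), the mean of m draws is exactly T Y; the
  -- size bound is p⁻¹βy and the total variance bound is p⁻¹β²f.
  set ξ : Fin s × Fin n → E := fun x => ((p⁻¹ : ℝ) : ℂ) • Y x.1 x.2 • T (Matrix.single x.1 x.2 1)
    with hξ
  have hξn : ∀ x, ‖ξ x‖ ≤ p⁻¹ * (‖Y x.1 x.2‖ * β) := fun x => by
    rw [hξ]
    simp only
    rw [norm_smul, norm_smul, Complex.norm_real, Real.norm_of_nonneg (by positivity)]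
    have := hβ x.1 x.2
    gcongr
  have key := card_norm_sum_sub_mean_ge ξ m (M := p⁻¹ * (y * β)) (v := p⁻¹ * (β ^ 2 * f))
    (t := t) (l := l) ht hl
    (fun x => (hξn x).trans (by have := hy x.1 x.2; gcongr)) (by
      have h3 : ∑ x, ‖ξ x‖ ^ 2 ≤ p⁻¹ ^ 2 * β ^ 2 * f := by
        calc ∑ x, ‖ξ x‖ ^ 2 ≤ ∑ x : Fin s × Fin n, (p⁻¹ * (‖Y x.1 x.2‖ * β)) ^ 2 := by
              gcongr with x; exact hξn x
          _ = p⁻¹ ^ 2 * β ^ 2 * frobNorm Y ^ 2 := by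
              rw [frobNorm_sq, Fintype.sum_prod_type, Finset.mul_sum]
              refine Finset.sum_congr rfl fun _ _ => ?_
              rw [Finset.mul_sum]
              exact Finset.sum_congr rfl fun _ _ => by ring
          _ ≤ _ := by gcongr
      rw [hcard, ← hp]
      calc p * ∑ x, ‖ξ x‖ ^ 2 ≤ p * (p⁻¹ ^ 2 * β ^ 2 * f) := by gcongr
        _ = _ := by field_simp)
    (by
      rw [le_div_iff₀ (by positivity), inv_mul_eq_div, div_mul_eq_mul_div, div_le_iff₀ hp0]
      linarith)
    (by
      rw [le_div_iff₀ (by positivity), inv_mul_eq_div, div_mul_eq_mul_div, div_le_iff₀ hp0]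
      linarith)
  rw [hcard] at key
  refine le_trans (le_of_eq ?_) key
  congr 2
  ext Ω
  have e1 : T (((p⁻¹ : ℝ) : ℂ) • sampleOp Ω Y - Y) =
      ∑ i, ξ (Ω i) - ((m : ℝ) / (s * n)) • ∑ x, ξ x := by
    rw [map_sub, map_smul, sampleOp_eq_sum, map_sum, Finset.smul_sum]
    congr 1
    · simp only [map_smul, hξ]
    · conv_lhs => rw [matrix_eq_sum_single' Y]
      rw [map_sum, Finset.smul_sum]
      refine Finset.sum_congr rfl fun x _ => ?_
      rw [map_smul, hξ]
      simp only
      rw [← hp, ← Complex.coe_smul, smul_smul, ← Complex.ofReal_mul, mul_inv_cancel₀ hp0.ne',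
        Complex.ofReal_one, one_smul]
  exact ⟨fun h => h.trans_eq (congrArg norm e1), fun h => h.trans_eq (congrArg norm e1.symm)⟩

end Lifting

/-! ### The sampling noise of one gradient step -/

section Noise

open scoped Matrix.Norms.L2Operator

variable {n₁ n₂ s r m : ℕ}

lemma sum_norm_sq_sum_ite_le {a : ℕ} {P : Matrix (Fin a) (Fin a) ℂ} {ν : ℝ}
    (hP : ∀ i', ∑ i, ‖P i i'‖ ^ 2 ≤ ν) (q : Fin a → Prop) [DecidablePred q]
    (hq : ∀ i i', q i → q i' → i = i') :
    ∑ i, ‖∑ i', (if q i' then P i i' else 0)‖ ^ 2 ≤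
      ν * ((∑ i', (if q i' then 1 else 0) : ℕ) : ℝ) := by
  by_cases h : ∃ i₀, q i₀
  · obtain ⟨i₀, h0⟩ := h
    have hqi : ∀ i', q i' ↔ i' = i₀ := fun i' => ⟨fun h' => hq _ _ h' h0, fun h' => h' ▸ h0⟩
    simp only [hqi]
    simpa using hP i₀
  · push Not at h
    simp [h]

lemma left1_liftG_single (P : Matrix (Fin n₁) (Fin n₁) ℂ) (j : Fin s) (a : Fin (n₁ + n₂ - 1))
    (i : Fin n₁) (i₂ : Fin n₂) (k : Fin s) :
    left1 P (liftG (Matrix.single j a 1) : Tensor n₁ n₂ s) i i₂ k =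
      if k = j then (((√(skewLen n₁ n₂ a))⁻¹ : ℝ) : ℂ) *
        ∑ i', (if i'.val + i₂.val = a.val then P i i' else 0) else 0 := by
  rw [left1_apply]
  simp only [liftG_apply, Matrix.single_apply, val_add_eq_iff, Finset.mul_sum]
  by_cases h : k = j
  · rw [if_pos h]
    refine Finset.sum_congr rfl fun i' _ => ?_
    by_cases h' : skewIdx i' i₂ = a
    · simp [h, h', mul_comm]
    · rw [if_neg h', if_neg (fun h'' => h' h''.2.symm)]; simp
  · rw [if_neg h]
    refine Finset.sum_eq_zero fun i' _ => ?_
    rw [if_neg (fun h'' => h h''.1.symm)]; simp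

lemma left2_liftG_single (P : Matrix (Fin n₂) (Fin n₂) ℂ) (j : Fin s) (a : Fin (n₁ + n₂ - 1))
    (i₁ : Fin n₁) (i : Fin n₂) (k : Fin s) :
    left2 P (liftG (Matrix.single j a 1) : Tensor n₁ n₂ s) i₁ i k =
      if k = j then (((√(skewLen n₁ n₂ a))⁻¹ : ℝ) : ℂ) *
        ∑ i', (if i₁.val + i'.val = a.val then P i i' else 0) else 0 := by
  rw [left2_apply]
  simp only [liftG_apply, Matrix.single_apply, val_add_eq_iff, Finset.mul_sum]
  by_cases h : k = j
  · rw [if_pos h]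
    refine Finset.sum_congr rfl fun i' _ => ?_
    by_cases h' : skewIdx i₁ i' = a
    · simp [h, h', mul_comm]
    · rw [if_neg h', if_neg (fun h'' => h' h''.2.symm)]; simp
  · rw [if_neg h]
    refine Finset.sum_eq_zero fun i' _ => ?_
    rw [if_neg (fun h'' => h h''.1.symm)]; simp

lemma norm_sq_invSqrt_mul (w : ℕ) (z : ℂ) :
    ‖(((√(w : ℝ))⁻¹ : ℝ) : ℂ) * z‖ ^ 2 = (w : ℝ)⁻¹ * ‖z‖ ^ 2 := by
  rw [norm_mul, mul_pow, Complex.norm_real, norm_inv, Real.norm_of_nonneg (by positivity), inv_pow,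
    Real.sq_sqrt (by positivity)]

/-- The atom has w_a entries equal to 1/√w_a, and each i₂ meets the skew-diagonal at most once. So P
contributes one column of squared norm at most β² per entry, and the w_a contributions are divided
by w_a. -/
lemma norm_tvec_left1_liftG_single_le (h1 : 0 < n₁) (h2 : 0 < n₂) {P : Matrix (Fin n₁) (Fin n₁) ℂ}
    {β : ℝ} (hβ : 0 ≤ β) (hP : ∀ i', ∑ i, ‖P i i'‖ ^ 2 ≤ β ^ 2) (j : Fin s)
    (a : Fin (n₁ + n₂ - 1)) :
    ‖tvec (left1 P (liftG (Matrix.single j a 1) : Tensor n₁ n₂ s))‖ ≤ β := by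
  have hw : (0 : ℝ) < skewLen n₁ n₂ a := by exact_mod_cast skewLen_pos h1 h2 a
  refine le_of_sq_le_sq ?_ hβ
  rw [norm_tvec_sq]
  simp only [left1_liftG_single, apply_ite (fun z : ℂ => ‖z‖ ^ 2), norm_zero, ne_eq,
    OfNat.ofNat_ne_zero, not_false_eq_true, zero_pow, Finset.sum_ite_eq', Finset.mem_univ, if_true,
    norm_sq_invSqrt_mul, ← Finset.mul_sum]
  have hw2 : skewLen n₁ n₂ a =
      ∑ i₂ : Fin n₂, ∑ i₁ : Fin n₁, (if i₁.val + i₂.val = a.val then 1 else 0) := by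
    rw [← skewLen_eq_sum, Finset.sum_comm]
  rw [inv_mul_le_iff₀ hw, Finset.sum_comm, hw2, mul_comm, Nat.cast_sum, Finset.mul_sum]
  refine Finset.sum_le_sum fun i₂ _ => sum_norm_sq_sum_ite_le hP _ fun i i' h h' => ?_
  exact Fin.ext (by omega)

lemma norm_tvec_left2_liftG_single_le (h1 : 0 < n₁) (h2 : 0 < n₂) {P : Matrix (Fin n₂) (Fin n₂) ℂ}
    {β : ℝ} (hβ : 0 ≤ β) (hP : ∀ i', ∑ i, ‖P i i'‖ ^ 2 ≤ β ^ 2) (j : Fin s)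
    (a : Fin (n₁ + n₂ - 1)) :
    ‖tvec (left2 P (liftG (Matrix.single j a 1) : Tensor n₁ n₂ s))‖ ≤ β := by
  have hw : (0 : ℝ) < skewLen n₁ n₂ a := by exact_mod_cast skewLen_pos h1 h2 a
  refine le_of_sq_le_sq ?_ hβ
  rw [norm_tvec_sq]
  simp only [left2_liftG_single, apply_ite (fun z : ℂ => ‖z‖ ^ 2), norm_zero, ne_eq,
    OfNat.ofNat_ne_zero, not_false_eq_true, zero_pow, Finset.sum_ite_eq', Finset.mem_univ, if_true,
    norm_sq_invSqrt_mul, ← Finset.mul_sum]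
  rw [inv_mul_le_iff₀ hw, ← skewLen_eq_sum, mul_comm, Nat.cast_sum, Finset.mul_sum]
  refine Finset.sum_le_sum fun i₁ _ => sum_norm_sq_sum_ite_le hP _ fun i i' h h' => ?_
  exact Fin.ext (by omega)

lemma inner_left1 {a b c : ℕ} {P : Matrix (Fin a) (Fin a) ℂ} (hP : Pᴴ = P) (Z Y : Tensor a b c) :
    inner ℂ (tvec (left1 P Z)) (tvec Y) = inner ℂ (tvec Z) (tvec (left1 P Y)) := by
  have := tlift_left1_isSymmetric (b := b) (c := c) hP (tvec Z) (tvec Y)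
  rwa [tlift_tvec, tlift_tvec] at this

lemma inner_left2 {a b c : ℕ} {P : Matrix (Fin b) (Fin b) ℂ} (hP : Pᴴ = P) (Z Y : Tensor a b c) :
    inner ℂ (tvec (left2 P Z)) (tvec Y) = inner ℂ (tvec Z) (tvec (left2 P Y)) := by
  have := tlift_left2_isSymmetric (a := a) (c := c) hP (tvec Z) (tvec Y)
  rwa [tlift_tvec, tlift_tvec] at this

lemma norm_inner_tvec_single (Z : Tensor n₁ n₂ s) (j : Fin s) (a : Fin (n₁ + n₂ - 1)) :
    ‖inner ℂ (tvec Z) (tvec (liftG (Matrix.single j a 1) : Tensor n₁ n₂ s))‖ = ‖adjG Z j a‖ := by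
  rw [inner_tvec_liftG, inner_mvec]
  have h : ∀ i b, star (adjG Z i b) * (Matrix.single j a (1 : ℂ)) i b =
      if j = i then (if a = b then star (adjG Z i b) else 0) else 0 := by
    intro i b
    rw [Matrix.single_apply]
    by_cases h1 : j = i <;> by_cases h2 : a = b <;> simp [h1, h2]
  simp only [h]
  simp

/-- Entrywise bound for `G*` of the difference of two tensors whose mode-1 column space,
respectively mode-2 column space, is incoherent. -/
lemma norm_adjG_sub_apply_le {P : Matrix (Fin n₁) (Fin n₁) ℂ} {Q : Matrix (Fin n₂) (Fin n₂) ℂ}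
    (hP : Pᴴ = P) (hPP : P * P = P) (hQ : Qᴴ = Q) {Z Zs : Tensor n₁ n₂ s} (hPZ : left1 P Z = Z)
    (hQZ : left2 Q Zs = Zs) {β : ℝ} (j : Fin s) (a : Fin (n₁ + n₂ - 1))
    (h1 : ‖tvec (left1 P (liftG (Matrix.single j a 1) : Tensor n₁ n₂ s))‖ ≤ β)
    (h2 : ‖tvec (left2 Q (liftG (Matrix.single j a 1) : Tensor n₁ n₂ s))‖ ≤ β) :
    ‖adjG (Z - Zs) j a‖ ≤ 2 * β * ‖tvec (Z - Zs)‖ := by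
  set D := Z - Zs with hD
  set g : Tensor n₁ n₂ s := liftG (Matrix.single j a 1) with hg
  have hres : ‖tvec (D - left1 P D)‖ ≤ ‖tvec D‖ := by
    have e : D - left1 P D = left1 (1 - P) D := by
      have := left1_one_sub_smul 1 P D
      rw [one_smul, one_smul] at this; exact this.symm
    rw [e]
    refine (norm_tvec_left1_le _ _).trans ?_
    exact mul_le_of_le_one_left (norm_nonneg _) (opNorm_one_sub_le_one hP hPP)
  -- Because P fixes Z, (1 - P)D equals -(1 - P)Zs, which still lies in the mode-2 column space of
  -- Zs. One half of D is thus incoherent in mode 1 through the iterate, the other in mode 2 through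
  -- the signal.
  have hdec : D = left1 P D + left2 Q (D - left1 P D) := by
    have e : D - left1 P D = left1 P Zs - Zs := by
      rw [hD, map_sub, hPZ]; abel
    have e2 : left2 Q (left1 P Zs - Zs) = left1 P Zs - Zs := by
      rw [map_sub, hQZ, left2_left1, hQZ]
    rw [e, e2, ← e]; abel
  rw [← norm_inner_tvec_single, ← hg]
  have h3 : inner ℂ (tvec D) (tvec g) = inner ℂ (tvec D) (tvec (left1 P g)) +
      inner ℂ (tvec (D - left1 P D)) (tvec (left2 Q g)) := by
    conv_lhs => rw [hdec, map_add, inner_add_left, inner_left1 hP, inner_left2 hQ]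
  rw [h3]
  refine (norm_add_le _ _).trans ?_
  have e1 : ‖inner ℂ (tvec D) (tvec (left1 P g))‖ ≤ ‖tvec D‖ * β :=
    (norm_inner_le_norm _ _).trans (by gcongr)
  have e2 : ‖inner ℂ (tvec (D - left1 P D)) (tvec (left2 Q g))‖ ≤ ‖tvec D‖ * β :=
    (norm_inner_le_norm _ _).trans (by gcongr)
  linarith

lemma sum_col_sq_eq {a : ℕ} {P : Matrix (Fin a) (Fin a) ℂ} (hP : Pᴴ = P) (i' : Fin a) :
    ∑ i, ‖P i i'‖ ^ 2 = rowNorm P i' ^ 2 := by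
  rw [rowNorm_sq]
  refine Finset.sum_congr rfl fun i _ => ?_
  conv_lhs => rw [← hP, Matrix.conjTranspose_apply, norm_star]

/-- The projection is L Bᴴ times its pseudo-inverse. Small slices and a lower bound for the nonzero
singular values therefore give incoherent column spaces, without any condition on the factors
themselves. -/
lemma rowNorm_colProj_le {ι κ ρ : Type*} [Fintype ι] [Fintype κ] [Fintype ρ] [DecidableEq ι]
    [DecidableEq κ] [DecidableEq ρ] {L : Matrix ι ρ ℂ} {B : Matrix κ ρ ℂ}
    (hB : IsUnit (Bᴴ * B).det) {β t : ℝ} {i : ι} (h1 : rowNorm (L * Bᴴ) i ≤ β)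
    (h2 : ‖pinvFactor L B‖ ≤ t) : rowNorm (colProj L) i ≤ β * t := by
  rw [← mul_pinvFactor hB]
  exact (rowNorm_mul_le _ _ _).trans
    (mul_le_mul h1 h2 (norm_nonneg _) ((rowNorm_nonneg _ _).trans h1))

lemma opNorm_le_one_of_orthonormal {ι ρ : Type*} [Fintype ι] [Fintype ρ] [DecidableEq ι]
    [DecidableEq ρ] {L : Matrix ι ρ ℂ} (hL : Lᴴ * L = 1) : ‖L‖ ≤ 1 := by
  have h : ‖L‖ * ‖L‖ ≤ 1 := by
    rw [← Matrix.l2_opNorm_conjTranspose_mul_self, hL]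
    exact opNorm_le_one_of_projection (by simp) (by simp)
  nlinarith [norm_nonneg L]

lemma rowNorm_colProj_of_orthonormal_le {ι ρ : Type*} [Fintype ι] [Fintype ρ] [DecidableEq ι]
    [DecidableEq ρ] {L : Matrix ι ρ ℂ} (hL : Lᴴ * L = 1) (i : ι) :
    rowNorm (colProj L) i ≤ rowNorm L i := by
  rw [colProj_of_orthonormal hL]
  refine (rowNorm_mul_le _ _ _).trans (mul_le_of_le_one_right (rowNorm_nonneg _ _) ?_)
  rw [Matrix.l2_opNorm_conjTranspose]
  exact opNorm_le_one_of_orthonormal hL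

namespace Factors

/-- The signal is a Hankel tensor, hence fixed by G G*, so the term (1 - G G*)Z equals (1 - G G*)(Z
- Z⋆). What remains is the sampling error of p⁻¹P_Ω applied to G*(Z - Z⋆). -/
lemma gradTensor_sub (h1 : 0 < n₁) (h2 : 0 < n₂) (X : Matrix (Fin s) (Fin (n₁ + n₂ - 1)) ℂ)
    (Ω : Fin m → Fin s × Fin (n₁ + n₂ - 1)) (F : Factors n₁ n₂ s r) :
    gradTensor X Ω F - (F.toTensor - hankel X) =
      liftG (((((m : ℝ) / (s * (n₁ + n₂ - 1 : ℕ)))⁻¹ : ℝ) : ℂ) •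
        sampleOp Ω (adjG (F.toTensor - hankel X)) - adjG (F.toTensor - hankel X)) := by
  rw [gradTensor, adjG_sub, adjG_hankel h1 h2, liftG_sub, liftG_sub, liftG_reweight h1 h2,
    ← liftGₗ_apply (_ • _), map_smul, liftGₗ_apply]
  abel

/-- One gradient step contracts the error with high probability. -/
theorem ncard_not_gradStep_contraction_le (hn1 : 0 < n₁) (hn2 : 0 < n₂) (hs : 0 < s) (hm : 0 < m)
    {X : Matrix (Fin s) (Fin (n₁ + n₂ - 1)) ℂ} {Fs : Factors n₁ n₂ s r}
    (hFs : hankel X = Fs.toTensor) (hR : Fs.Rᴴ * Fs.R = 1)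
    (hrank : mulRank (hankel X : Tensor n₁ n₂ s) = (r, r, r))
    {η : ℝ} (h0 : 0 ≤ η) (h1 : η ≤ 0.4) {σ : ℝ} (hσ0 : 0 < σ)
    (hσ : σ ≤ sigmaMin (hankel X : Tensor n₁ n₂ s)) {F : Factors n₁ n₂ s r}
    (hclose : ‖tvec (F.toTensor - hankel X)‖ ≤ σ / 200) {β l : ℝ} (hl : 0 < l) (hβ0 : 0 ≤ β)
    (hF1 : ∀ i, rowNorm (unfold1 F.toTensor) i ≤ β * (σ - σ / 200))
    (hF2 : ∀ i, rowNorm (unfold2 F.toTensor) i ≤ β * (σ - σ / 200))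
    (hRs : ∀ i, rowNorm Fs.R i ≤ β)
    (hl2 : 10000 * l * β ^ 2 ≤ (m : ℝ) / (s * (n₁ + n₂ - 1 : ℕ))) :
    (Set.ncard {Ω : Fin m → Fin s × Fin (n₁ + n₂ - 1) |
      ¬ ‖tvec ((gradStep X η Ω F).toTensor - hankel X)‖ ≤
        (1 - 0.5 * η) * ‖tvec (F.toTensor - hankel X)‖} : ℝ) ≤
      4 * Real.exp (-l) * ((s : ℝ) * (n₁ + n₂ - 1 : ℕ)) ^ m := by
  obtain ⟨hreg, hY1, hY2, -⟩ := regular_of_close (F := F) (e := σ / 200) (by linarith) hrank hσ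
    hclose
  have hσ' : 0 < σ - σ / 200 := by linarith
  have hP1 : ∀ i', ∑ i, ‖colProj F.L i i'‖ ^ 2 ≤ β ^ 2 := fun i' => by
    rw [sum_col_sq_eq conjTranspose_colProj]
    refine pow_le_pow_left₀ (rowNorm_nonneg _ _) ?_ 2
    have h := hF1 i'
    rw [unfold1_toTensor] at h
    refine (rowNorm_colProj_le hreg.breveL h hY1).trans (le_of_eq ?_)
    rw [mul_assoc, mul_one_div_cancel hσ'.ne', mul_one]
  have hP2 : ∀ i', ∑ i, ‖colProj F.R i i'‖ ^ 2 ≤ β ^ 2 := fun i' => by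
    rw [sum_col_sq_eq conjTranspose_colProj]
    refine pow_le_pow_left₀ (rowNorm_nonneg _ _) ?_ 2
    have h := hF2 i'
    rw [unfold2_toTensor] at h
    refine (rowNorm_colProj_le hreg.breveR h hY2).trans (le_of_eq ?_)
    rw [mul_assoc, mul_one_div_cancel hσ'.ne', mul_one]
  have hQ : ∀ i', ∑ i, ‖colProj Fs.R i i'‖ ^ 2 ≤ β ^ 2 := fun i' => by
    rw [sum_col_sq_eq conjTranspose_colProj]
    exact pow_le_pow_left₀ (rowNorm_nonneg _ _)
      ((rowNorm_colProj_of_orthonormal_le hR i').trans (hRs i')) 2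
  have hRu : IsUnit (Fs.Rᴴ * Fs.R).det := by rw [hR]; simp
  have hy : ∀ j a, ‖adjG (F.toTensor - hankel X) j a‖ ≤
      2 * β * ‖tvec (F.toTensor - hankel X)‖ := fun j a =>
    norm_adjG_sub_apply_le (P := colProj F.L) (Q := colProj Fs.R) conjTranspose_colProj
      (colProj_mul_colProj hreg.L) conjTranspose_colProj
      (unfold1_injective (by
        rw [unfold1_left1, unfold1_toTensor, ← Matrix.mul_assoc, colProj_mul_self hreg.L]))
      (unfold2_injective (by
        rw [hFs, unfold2_left2, unfold2_toTensor, ← Matrix.mul_assoc, colProj_mul_self hRu]))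
      j a (norm_tvec_left1_liftG_single_le hn1 hn2 hβ0 hP1 j a)
      (norm_tvec_left2_liftG_single_le hn1 hn2 hβ0 hQ j a)
  set e := ‖tvec (F.toTensor - hankel X)‖ with he
  set Y := adjG (F.toTensor - hankel X) with hY
  have hYe : frobNorm Y ^ 2 ≤ e ^ 2 :=
    pow_le_pow_left₀ (frobNorm_nonneg _) (frobNorm_adjG_le hn1 hn2 _) 2
  have he0 : 0 ≤ e := norm_nonneg _
  set p : ℝ := (m : ℝ) / (s * (n₁ + n₂ - 1 : ℕ)) with hp
  -- At the exact solution the Bernstein threshold e/50 would be 0, which is not allowed; there the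
  -- noise vanishes identically.
  rcases he0.eq_or_lt with h | hpos
  · have hY0 : Y = 0 := by
      rw [hY, norm_eq_zero.1 h.symm |> (LinearEquiv.map_eq_zero_iff tvec).1]
      exact map_zero (adjGₗ n₁ n₂ s)
    have hempty : {Ω : Fin m → Fin s × Fin (n₁ + n₂ - 1) |
        ¬ ‖tvec ((gradStep X η Ω F).toTensor - hankel X)‖ ≤ (1 - 0.5 * η) * e} = ∅ := by
      refine Set.eq_empty_of_forall_notMem fun Ω hΩ => hΩ ?_
      have hN : gradTensor X Ω F - (F.toTensor - hankel X) = 0 := by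
        rw [gradTensor_sub hn1 hn2, ← hY, hY0]
        have : sampleOp Ω (0 : Matrix (Fin s) (Fin (n₁ + n₂ - 1)) ℂ) = 0 := by
          rw [sampleOp_eq_sum]; simp
        rw [this, smul_zero, sub_zero]
        exact map_zero (liftGₗ n₁ n₂ s)
      exact gradStep_contraction hFs hrank h0 h1 hσ0 hσ hclose (by rw [hN]; simp)
        (by rw [hN]; simp)
    rw [hempty, Set.ncard_empty]
    simp only [CharP.cast_eq_zero]
    positivity
  · have hn : 0 < n₁ + n₂ - 1 := by omega
    -- With threshold e/50 the variance condition asks for p ≥ 4·50² l β², the constant 10000 of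
    -- `hl2`. The size condition asks only for 400 l β².
    have hA1 : 4 * l * (β * (2 * β * e)) ≤ 1 / 50 * e * p := by
      have := mul_le_mul_of_nonneg_left hl2 (show 0 ≤ 1 / 50 * e by positivity)
      have h3 : 0 ≤ l * β ^ 2 * e := by positivity
      nlinarith
    have hA2 : 4 * l * (β ^ 2 * e ^ 2) ≤ (1 / 50 * e) ^ 2 * p := by
      have := mul_le_mul_of_nonneg_left hl2 (show 0 ≤ (1 / 50 * e) ^ 2 by positivity)
      nlinarith
    have k1 := ncard_norm_sampleOp_sub_ge hs hn hm
      (tvec.toLinearMap ∘ₗ left1 (colProj F.L) ∘ₗ liftGₗ n₁ n₂ s) Y hβ0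
      (norm_tvec_left1_liftG_single_le hn1 hn2 hβ0 hP1) hy hYe
      (show 0 < 1 / 50 * e by positivity) hl hA1 hA2
    have k2 := ncard_norm_sampleOp_sub_ge hs hn hm
      (tvec.toLinearMap ∘ₗ left2 (colProj F.R) ∘ₗ liftGₗ n₁ n₂ s) Y hβ0
      (norm_tvec_left2_liftG_single_le hn1 hn2 hβ0 hP2) hy hYe
      (show 0 < 1 / 50 * e by positivity) hl hA1 hA2
    set S1 := {Ω : Fin m → Fin s × Fin (n₁ + n₂ - 1) | 1 / 50 * e ≤
      ‖(tvec.toLinearMap ∘ₗ left1 (colProj F.L) ∘ₗ liftGₗ n₁ n₂ s)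
        (((p⁻¹ : ℝ) : ℂ) • sampleOp Ω Y - Y)‖} with hS1
    set S2 := {Ω : Fin m → Fin s × Fin (n₁ + n₂ - 1) | 1 / 50 * e ≤
      ‖(tvec.toLinearMap ∘ₗ left2 (colProj F.R) ∘ₗ liftGₗ n₁ n₂ s)
        (((p⁻¹ : ℝ) : ℂ) • sampleOp Ω Y - Y)‖} with hS2
    have hsub : {Ω : Fin m → Fin s × Fin (n₁ + n₂ - 1) |
        ¬ ‖tvec ((gradStep X η Ω F).toTensor - hankel X)‖ ≤ (1 - 0.5 * η) * e} ⊆ S1 ∪ S2 := by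
      intro Ω hΩ
      by_contra hc
      rw [Set.mem_union, not_or] at hc
      have c1 := not_le.1 (fun h' => hc.1 h' : ¬ 1 / 50 * e ≤ _)
      have c2 := not_le.1 (fun h' => hc.2 h' : ¬ 1 / 50 * e ≤ _)
      refine hΩ (gradStep_contraction hFs hrank h0 h1 hσ0 hσ hclose ?_ ?_)
      · rw [gradTensor_sub hn1 hn2]; exact c1.le
      · rw [gradTensor_sub hn1 hn2]; exact c2.le
    have h3 : (Set.ncard {Ω : Fin m → Fin s × Fin (n₁ + n₂ - 1) |
        ¬ ‖tvec ((gradStep X η Ω F).toTensor - hankel X)‖ ≤ (1 - 0.5 * η) * e} : ℝ) ≤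
        S1.ncard + S2.ncard := by
      exact_mod_cast (Set.ncard_le_ncard hsub (Set.toFinite _)).trans (Set.ncard_union_le _ _)
    linarith

end Factors

end Noise

/-! ### The operator norm of Hankel tensors -/

section Fourier

open scoped Matrix.Norms.L2Operator

/-- The discrete Fourier kernel. -/
def fourierKernel (n l k : ℕ) : ℂ := (Complex.exp (2 * Real.pi * Complex.I / n) ^ k) ^ l

variable {n : ℕ}

lemma norm_fourierKernel (hn : 0 < n) (l k : ℕ) : ‖fourierKernel n l k‖ = 1 := by
  have h := (Complex.isPrimitiveRoot_exp n hn.ne').norm'_eq_one hn.ne'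
  rw [fourierKernel, norm_pow, norm_pow, h, one_pow, one_pow]

lemma fourierKernel_add (l i k : ℕ) :
    fourierKernel n l (i + k) = fourierKernel n l i * fourierKernel n l k := by
  rw [fourierKernel, pow_add, mul_pow]; rfl

lemma sum_star_fourierKernel_mul (hn : 0 < n) {a b : ℕ} (ha : a < n) (hb : b < n) :
    ∑ l : Fin n, star (fourierKernel n l a) * fourierKernel n l b = if a = b then (n : ℂ) else 0 := by
  set ζ := Complex.exp (2 * Real.pi * Complex.I / n) with hζ
  have hp : IsPrimitiveRoot ζ n := Complex.isPrimitiveRoot_exp n hn.ne'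
  have h1 : star ζ * ζ = 1 := by
    have := hp.norm'_eq_one hn.ne'
    rw [Complex.star_def, Complex.conj_mul', this]; simp
  have e : ∀ l : Fin n, star (fourierKernel n l a) * fourierKernel n l b =
      (star ζ ^ a * ζ ^ b) ^ (l : ℕ) := fun l => by
    rw [fourierKernel, fourierKernel, ← hζ, star_pow, star_pow, ← mul_pow]
  simp only [e]
  rw [Fin.sum_univ_eq_sum_range (fun l => (star ζ ^ a * ζ ^ b) ^ l) n]
  split_ifs with hab
  · rw [hab, ← mul_pow, h1]; simp
  · have hne : star ζ ^ a * ζ ^ b ≠ 1 := by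
      intro h
      apply hab
      refine hp.pow_inj ha hb ?_
      calc ζ ^ a = ζ ^ a * (star ζ ^ a * ζ ^ b) := by rw [h, mul_one]
        _ = (star ζ * ζ) ^ a * ζ ^ b := by rw [mul_pow]; ring
        _ = ζ ^ b := by rw [h1, one_pow, one_mul]
    have hn1 : (star ζ ^ a * ζ ^ b) ^ n = 1 := by
      rw [mul_pow, ← pow_mul, ← pow_mul, mul_comm a, mul_comm b, pow_mul, pow_mul, ← star_pow,
        hp.pow_eq_one]; simp
    rw [geom_sum_eq hne, hn1, sub_self, zero_div]

/-- Parseval for a vector of length d ≤ n extended by zeros. -/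
lemma sum_norm_sq_fourier (hn : 0 < n) {d : ℕ} (hd : d ≤ n) (u : Fin d → ℂ) :
    ∑ l : Fin n, ‖∑ i, u i * star (fourierKernel n l i)‖ ^ 2 = n * ∑ i, ‖u i‖ ^ 2 := by
  have e : ∀ z : ℂ, ((‖z‖ ^ 2 : ℝ) : ℂ) = z * star z := fun z => by
    rw [Complex.star_def, Complex.mul_conj']; push_cast; rfl
  apply Complex.ofReal_injective
  push_cast
  simp only [← Complex.ofReal_pow, e, star_sum, Finset.sum_mul_sum, star_mul', star_star]
  rw [Finset.sum_comm, Finset.mul_sum]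
  refine Finset.sum_congr rfl fun i _ => ?_
  rw [Finset.sum_comm]
  have h : ∀ i' : Fin d, ∑ l : Fin n, u i * star (fourierKernel n l i) *
      (star (u i') * fourierKernel n l i') = if i = i' then n * (u i * star (u i)) else 0 := by
    intro i'
    have h2 : ∀ l : Fin n, u i * star (fourierKernel n l i) *
      (star (u i') * fourierKernel n l i') = u i * star (u i') *
        (star (fourierKernel n l i) * fourierKernel n l i') := fun l => by ring
    simp only [h2]
    rw [← Finset.mul_sum, sum_star_fourierKernel_mul hn (i.isLt.trans_le hd) (i'.isLt.trans_le hd)]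
    by_cases hi : i = i'
    · subst hi; simp; ring
    · rw [if_neg hi, if_neg (fun h => hi (Fin.ext h)), mul_zero]
  simp only [h]
  simp

lemma eq_sum_fourier (hn : 0 < n) (x : Fin n → ℂ) (a : Fin n) :
    (n : ℂ) * x a = ∑ l : Fin n, (∑ b, x b * fourierKernel n l b) * star (fourierKernel n l a) := by
  simp only [Finset.sum_mul]
  rw [Finset.sum_comm]
  have h : ∀ b : Fin n, ∑ l : Fin n, x b * fourierKernel n l b * star (fourierKernel n l a) =
      if a = b then n * x b else 0 := by
    intro b
    have h2 : ∀ l : Fin n, x b * fourierKernel n l b * star (fourierKernel n l a) =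
      x b * (star (fourierKernel n l a) * fourierKernel n l b) := fun l => by ring
    simp only [h2]
    rw [← Finset.mul_sum, sum_star_fourierKernel_mul hn a.isLt b.isLt]
    by_cases hi : a = b
    · simp [hi, mul_comm]
    · rw [if_neg hi, if_neg (fun h => hi (Fin.ext h)), mul_zero]
  simp only [h]
  simp

lemma norm_sum_mul_sq_le {ι : Type*} [Fintype ι] (f g : ι → ℂ) :
    ‖∑ i, f i * g i‖ ^ 2 ≤ (∑ i, ‖f i‖ ^ 2) * ∑ i, ‖g i‖ ^ 2 := by
  calc ‖∑ i, f i * g i‖ ^ 2 ≤ (∑ i, ‖f i‖ * ‖g i‖) ^ 2 := by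
        gcongr
        exact (norm_sum_le _ _).trans (le_of_eq (by simp))
    _ ≤ _ := Finset.sum_mul_sq_le_sq_mul_sq _ _ _

/-- The trilinear form of a Hankel tensor is bounded by the largest Fourier coefficient. -/
theorem norm_hankel_form_sq_le (hn : 0 < n) {s d₁ d₂ : ℕ} (h1 : d₁ ≤ n) (h2 : d₂ ≤ n)
    (E : Matrix (Fin s) (Fin n) ℂ) (idx : Fin d₁ → Fin d₂ → Fin n)
    (hidx : ∀ i k, (idx i k).val = i.val + k.val) {N : ℝ}
    (hE : ∀ l : Fin n, ∑ j, ‖∑ b, E j b * fourierKernel n l b‖ ^ 2 ≤ N ^ 2) (u : Fin d₁ → ℂ)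
    (W : Fin s → Fin d₂ → ℂ) :
    ‖∑ i, u i * ∑ j, ∑ k, E j (idx i k) * W j k‖ ^ 2 ≤
      N ^ 2 * ((∑ i, ‖u i‖ ^ 2) * ∑ j, ∑ k, ‖W j k‖ ^ 2) := by
  have hn' : (0 : ℝ) < n := by exact_mod_cast hn
  set Eh : Fin s → Fin n → ℂ := fun j l => ∑ b, E j b * fourierKernel n l b with hEh
  set uh : Fin n → ℂ := fun l => ∑ i, u i * star (fourierKernel n l i) with huh
  set Wh : Fin s → Fin n → ℂ := fun j l => ∑ k, W j k * star (fourierKernel n l k) with hWh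
  -- Fourier inversion of E at i + k turns the kernel into a product of a function of i and a
  -- function of k. In frequency the Hankel form is diagonal, and Cauchy–Schwarz with Parseval on
  -- both sides finishes.
  have key : (n : ℂ) * ∑ i, u i * ∑ j, ∑ k, E j (idx i k) * W j k =
      ∑ l, uh l * ∑ j, Eh j l * Wh j l := by
    have e1 : ∀ i j k, (n : ℂ) * (u i * (E j (idx i k) * W j k)) =
        ∑ l, Eh j l * (u i * star (fourierKernel n l i)) * (W j k * star (fourierKernel n l k)) := by
      intro i j k
      calc (n : ℂ) * (u i * (E j (idx i k) * W j k)) = ((n : ℂ) * E j (idx i k)) * (u i * W j k) := by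
            ring
        _ = _ := by
            rw [eq_sum_fourier hn, Finset.sum_mul]
            refine Finset.sum_congr rfl fun l _ => ?_
            rw [hidx, fourierKernel_add, star_mul', hEh]
            ring
    simp only [Finset.mul_sum, e1]
    simp only [huh, hWh, Finset.mul_sum, Finset.sum_mul]
    rw [Finset.sum_congr rfl fun i _ => Finset.sum_congr rfl fun j _ => Finset.sum_comm]
    rw [Finset.sum_congr rfl fun i _ => Finset.sum_comm, Finset.sum_comm]
    refine Finset.sum_congr rfl fun l _ => ?_
    rw [Finset.sum_comm]
    refine Finset.sum_congr rfl fun j _ => ?_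
    rw [Finset.sum_comm]
    refine Finset.sum_congr rfl fun k _ => Finset.sum_congr rfl fun i _ => ?_
    ring
  have hg : ∀ l, ‖∑ j, Eh j l * Wh j l‖ ^ 2 ≤ N ^ 2 * ∑ j, ‖Wh j l‖ ^ 2 := fun l =>
    (norm_sum_mul_sq_le _ _).trans (by have := hE l; gcongr)
  have hmain : (n : ℝ) ^ 2 * ‖∑ i, u i * ∑ j, ∑ k, E j (idx i k) * W j k‖ ^ 2 ≤
      (n * ∑ i, ‖u i‖ ^ 2) * (N ^ 2 * ∑ j, (n * ∑ k, ‖W j k‖ ^ 2)) := by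
    have hnorm : ∀ z : ℂ, (n : ℝ) * ‖z‖ = ‖(n : ℂ) * z‖ := fun z => by simp
    rw [← mul_pow, hnorm, key, ← sum_norm_sq_fourier hn h1]
    refine (norm_sum_mul_sq_le _ _).trans ?_
    gcongr
    calc ∑ l, ‖∑ j, Eh j l * Wh j l‖ ^ 2 ≤ ∑ l, N ^ 2 * ∑ j, ‖Wh j l‖ ^ 2 := by
          gcongr with l; exact hg l
      _ = _ := by
          rw [← Finset.mul_sum, Finset.sum_comm]
          simp only [hWh, sum_norm_sq_fourier hn h2]
  rw [← Finset.mul_sum] at hmain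
  have : (n : ℝ) ^ 2 * ‖∑ i, u i * ∑ j, ∑ k, E j (idx i k) * W j k‖ ^ 2 ≤
      (n : ℝ) ^ 2 * (N ^ 2 * ((∑ i, ‖u i‖ ^ 2) * ∑ j, ∑ k, ‖W j k‖ ^ 2)) := by
    refine hmain.trans (le_of_eq ?_); ring
  exact le_of_mul_le_mul_left this (by positivity)

lemma opNorm_le_of_form {ι κ : Type*} [Fintype ι] [Fintype κ] [DecidableEq ι] [DecidableEq κ]
    {M : Matrix ι κ ℂ} {N : ℝ} (hN : 0 ≤ N)
    (h : ∀ (u : ι → ℂ) (w : κ → ℂ), ‖∑ i, u i * ∑ k, M i k * w k‖ ^ 2 ≤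
      N ^ 2 * ((∑ i, ‖u i‖ ^ 2) * ∑ k, ‖w k‖ ^ 2)) : ‖M‖ ≤ N := by
  refine opNorm_le_of_forall hN fun v => ?_
  have hv := h (fun i => star (Matrix.toEuclideanLin M v i)) v
  have e1 : ∀ i, ∑ k, M i k * v k = Matrix.toEuclideanLin M v i := fun i => by
    simp [Matrix.toLpLin_apply, Matrix.mulVec, dotProduct]
  simp only [e1, norm_star] at hv
  have e2 : ∑ i, star (Matrix.toEuclideanLin M v i) * Matrix.toEuclideanLin M v i =
      ((‖Matrix.toEuclideanLin M v‖ ^ 2 : ℝ) : ℂ) := by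
    rw [EuclideanSpace.norm_sq_eq]
    push_cast
    refine Finset.sum_congr rfl fun i _ => ?_
    rw [Complex.star_def, Complex.conj_mul']
  rw [e2, ← EuclideanSpace.norm_sq_eq, ← EuclideanSpace.norm_sq_eq, Complex.norm_real,
    Real.norm_of_nonneg (by positivity)] at hv
  rcases (norm_nonneg (Matrix.toEuclideanLin M v)).eq_or_lt with h0 | h0
  · rw [← h0]; positivity
  · refine le_of_sq_le_sq ?_ (by positivity)
    have h3 : 0 < ‖Matrix.toEuclideanLin M v‖ ^ 2 := by positivity
    refine le_of_mul_le_mul_left ?_ h3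
    nlinarith

variable {n₁ n₂ s : ℕ}

/-- Modes 1 and 2 separate one Hankel index from the other, as the Fourier factorization needs. No
bound in mode 3 is sought; the sequential initialization is designed to avoid it. -/
lemma opNorm_unfold1_hankel_le (h1 : 0 < n₁) (h2 : 0 < n₂)
    (E : Matrix (Fin s) (Fin (n₁ + n₂ - 1)) ℂ) {N : ℝ} (hN : 0 ≤ N)
    (hE : ∀ l : Fin (n₁ + n₂ - 1),
      ∑ j, ‖∑ b, E j b * fourierKernel (n₁ + n₂ - 1) l b‖ ^ 2 ≤ N ^ 2) :
    ‖unfold1 (hankel E : Tensor n₁ n₂ s)‖ ≤ N := by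
  refine opNorm_le_of_form hN fun u w => ?_
  have h := norm_hankel_form_sq_le (by omega) (by omega) (by omega) E
    (fun i k : Fin _ => skewIdx i k) (fun _ _ => rfl) hE u (fun j k => w (j, k))
  simp only [← Fintype.sum_prod_type'] at h
  exact h

lemma opNorm_unfold2_hankel_le (h1 : 0 < n₁) (h2 : 0 < n₂)
    (E : Matrix (Fin s) (Fin (n₁ + n₂ - 1)) ℂ) {N : ℝ} (hN : 0 ≤ N)
    (hE : ∀ l : Fin (n₁ + n₂ - 1),
      ∑ j, ‖∑ b, E j b * fourierKernel (n₁ + n₂ - 1) l b‖ ^ 2 ≤ N ^ 2) :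
    ‖unfold2 (hankel E : Tensor n₁ n₂ s)‖ ≤ N := by
  refine opNorm_le_of_form hN fun u w => ?_
  have h := norm_hankel_form_sq_le (by omega) (by omega) (by omega) E
    (fun (k : Fin n₂) (i : Fin n₁) => skewIdx i k) (fun k i => Nat.add_comm _ _) hE u
    (fun j k => w (j, k))
  simp only [← Fintype.sum_prod_type'] at h
  exact h

end Fourier

/-! ### Spectral initialization -/

section Initialization

open scoped Matrix.Norms.L2Operator

/-- Orthonormal columns give Bᴴ = Lᴴ(L Bᴴ), so B is no larger than the product. -/
lemma rowNorm_mul_conjTranspose_le {ι κ ρ : Type*} [Fintype ι] [Fintype κ] [Fintype ρ]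
    [DecidableEq ι] [DecidableEq κ] [DecidableEq ρ] {L : Matrix ι ρ ℂ} (hL : Lᴴ * L = 1)
    (B : Matrix κ ρ ℂ) (i : ι) : rowNorm (L * Bᴴ) i ≤ rowNorm L i * ‖L * Bᴴ‖ := by
  refine (rowNorm_mul_le _ _ _).trans ?_
  refine mul_le_mul_of_nonneg_left ?_ (rowNorm_nonneg _ _)
  have e : Bᴴ = Lᴴ * (L * Bᴴ) := by rw [← Matrix.mul_assoc, hL, Matrix.one_mul]
  conv_lhs => rw [e]
  refine (Matrix.l2_opNorm_mul _ _).trans (mul_le_of_le_one_left (norm_nonneg _) ?_)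
  rw [Matrix.l2_opNorm_conjTranspose]
  exact opNorm_le_one_of_orthonormal hL

lemma norm_apply_le_of_left2 {a b c : ℕ} {Q : Matrix (Fin b) (Fin b) ℂ} {Z : Tensor a b c}
    (h : left2 Q Z = Z) (i₁ : Fin a) (i₂ : Fin b) (j : Fin c) :
    ‖Z i₁ i₂ j‖ ≤ rowNorm Q i₂ * rowNorm (unfold1 Z) i₁ := by
  refine le_of_sq_le_sq ?_ (mul_nonneg (rowNorm_nonneg _ _) (rowNorm_nonneg _ _))
  have e : Z i₁ i₂ j = ∑ k, Q i₂ k * Z i₁ k j := by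
    conv_lhs => rw [← h, left2_apply]
  rw [e, mul_pow, rowNorm_sq, rowNorm_unfold1_sq]
  refine (norm_sum_mul_sq_le _ _).trans ?_
  gcongr with k
  exact Finset.single_le_sum (f := fun x => ‖Z i₁ k x‖ ^ 2) (fun _ _ => by positivity)
    (Finset.mem_univ j)

variable {n₁ n₂ s r m : ℕ}

lemma exists_skewIdx_eq (h1 : 0 < n₁) (h2 : 0 < n₂) (a : Fin (n₁ + n₂ - 1)) :
    ∃ (i₁ : Fin n₁) (i₂ : Fin n₂), skewIdx i₁ i₂ = a := by
  have ha := a.isLt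
  refine ⟨⟨min a.val (n₁ - 1), by omega⟩, ⟨a.val - min a.val (n₁ - 1), by omega⟩, ?_⟩
  apply Fin.ext
  simp only [skewIdx]
  omega

lemma sum_le_sum_comp_of_surjective {α β : Type*} [Fintype α] [Fintype β] {f : β → α}
    (hf : Function.Surjective f) {g : α → ℝ} (hg : ∀ a, 0 ≤ g a) : ∑ a, g a ≤ ∑ b, g (f b) := by
  have e : ∑ a, g a = ∑ b ∈ Finset.univ.map ⟨Function.surjInv hf, Function.injective_surjInv hf⟩,
      g (f b) := by
    rw [Finset.sum_map]
    exact Finset.sum_congr rfl fun a _ => by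
      rw [Function.Embedding.coeFn_mk, Function.surjInv_eq hf]
  rw [e]
  exact Finset.sum_le_sum_of_subset_of_nonneg (Finset.subset_univ _) fun b _ _ => hg _

/-- Two slices of a Hankel tensor contain all entries of the lifted matrix. -/
lemma frobNorm_sq_le_of_slices (h1 : 0 < n₁) (h2 : 0 < n₂)
    (X : Matrix (Fin s) (Fin (n₁ + n₂ - 1)) ℂ) {y : ℝ}
    (hy1 : ∀ i, rowNorm (unfold1 (hankel X : Tensor n₁ n₂ s)) i ≤ y)
    (hy2 : ∀ i, rowNorm (unfold2 (hankel X : Tensor n₁ n₂ s)) i ≤ y) :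
    frobNorm X ^ 2 ≤ 2 * y ^ 2 := by
  set g : Fin (n₁ + n₂ - 1) → ℝ := fun a => ∑ j, ‖X j a‖ ^ 2 with hg
  have hg0 : ∀ a, 0 ≤ g a := fun a => by rw [hg]; positivity
  have e1 : ∀ i₁ : Fin n₁, ∑ i₂ : Fin n₂, g (skewIdx i₁ i₂) ≤ y ^ 2 := fun i₁ => by
    have := pow_le_pow_left₀ (rowNorm_nonneg _ _) (hy1 i₁) 2
    rwa [rowNorm_unfold1_sq] at this
  have e2 : ∀ i₂ : Fin n₂, ∑ i₁ : Fin n₁, g (skewIdx i₁ i₂) ≤ y ^ 2 := fun i₂ => by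
    have := pow_le_pow_left₀ (rowNorm_nonneg _ _) (hy2 i₂) 2
    rwa [rowNorm_unfold2_sq] at this
  rw [frobNorm_sq, Finset.sum_comm]
  change ∑ a, g a ≤ _
  -- The first and the last slice along the shorter mode have the longer length, and together they
  -- meet all n skew-diagonals.
  rcases Nat.lt_or_ge n₂ n₁ with h | h
  · let f : Fin n₁ ⊕ Fin n₁ → Fin (n₁ + n₂ - 1) :=
      Sum.elim (fun i => skewIdx i ⟨0, h2⟩) (fun i => skewIdx i ⟨n₂ - 1, by omega⟩)
    have hf : Function.Surjective f := fun a => by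
      have ha := a.isLt
      by_cases hlt : a.val < n₁
      · exact ⟨Sum.inl ⟨a.val, hlt⟩, Fin.ext (by simp [f, skewIdx])⟩
      · exact ⟨Sum.inr ⟨a.val - (n₂ - 1), by omega⟩, Fin.ext (by simp [f, skewIdx]; omega)⟩
    refine (sum_le_sum_comp_of_surjective hf hg0).trans ?_
    rw [Fintype.sum_sum_type]
    have := e2 ⟨0, h2⟩
    have := e2 ⟨n₂ - 1, by omega⟩
    simp only [f, Sum.elim_inl, Sum.elim_inr]
    linarith
  · let f : Fin n₂ ⊕ Fin n₂ → Fin (n₁ + n₂ - 1) :=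
      Sum.elim (fun i => skewIdx ⟨0, h1⟩ i) (fun i => skewIdx ⟨n₁ - 1, by omega⟩ i)
    have hf : Function.Surjective f := fun a => by
      have ha := a.isLt
      by_cases hlt : a.val < n₂
      · exact ⟨Sum.inl ⟨a.val, hlt⟩, Fin.ext (by simp [f, skewIdx])⟩
      · exact ⟨Sum.inr ⟨a.val - (n₁ - 1), by omega⟩, Fin.ext (by simp [f, skewIdx]; omega)⟩
    refine (sum_le_sum_comp_of_surjective hf hg0).trans ?_
    rw [Fintype.sum_sum_type]
    have := e1 ⟨0, h1⟩
    have := e1 ⟨n₁ - 1, by omega⟩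
    simp only [f, Sum.elim_inl, Sum.elim_inr]
    linarith

namespace Factors

/-- Deterministic analysis of the sequential spectral initialization. -/
theorem norm_spectral_sub_le (svd : SVDRoutine r) {Z Zs : Tensor n₁ n₂ s} (hr : 0 < r)
    (hr1 : r ≤ n₁) (hr2 : r ≤ n₂) (hr3 : r ≤ s) (hrank : mulRank Zs = (r, r, r)) {δ : ℝ}
    (h1 : ‖unfold1 (Z - Zs)‖ ≤ δ) (h2 : ‖unfold2 (Z - Zs)‖ ≤ δ) :
    ‖tvec ((spectral svd Z).toTensor - Zs)‖ ≤ 7 * r * δ := by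
  simp only [mulRank, Prod.mk.injEq] at hrank
  obtain ⟨k1, k2, k3⟩ := hrank
  have hδ : 0 ≤ δ := (norm_nonneg _).trans h1
  have hL := svd.isTop (unfold1 Z) hr1
  have hR := svd.isTop (unfold2 Z) hr2
  set L := svd.top (unfold1 Z) with hLdef
  set R := svd.top (unfold2 Z) with hRdef
  have hV := svd.isTop (unfold3 (left1 Lᴴ Z)) hr3
  set V := svd.top (unfold3 (left1 Lᴴ Z)) with hVdef
  have hL1 : ‖L‖ ≤ 1 := opNorm_le_one_of_orthonormal hL.1
  have hLA : ‖Lᴴ‖ ≤ 1 := by rw [Matrix.l2_opNorm_conjTranspose]; exact hL1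
  have hproj : ∀ {a : ℕ} {U : Matrix (Fin a) (Fin r) ℂ}, Uᴴ * U = 1 → ‖U * Uᴴ‖ ≤ 1 := fun h => by
    refine opNorm_le_one_of_projection (by simp) ?_
    rw [Matrix.mul_assoc, ← Matrix.mul_assoc _ _ (_ᴴ), h, Matrix.one_mul]
  have n2 : ∀ W : Tensor n₁ n₂ s, ‖tvec (left2 (R * Rᴴ) W)‖ ≤ ‖tvec W‖ := fun W =>
    (norm_tvec_left2_le _ _).trans (mul_le_of_le_one_left (norm_nonneg _) (hproj hR.1))
  have n3 : ∀ {d : ℕ} (W : Tensor d n₂ s), ‖tvec (left3 (V * Vᴴ) W)‖ ≤ ‖tvec W‖ := fun W =>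
    (norm_tvec_left3_le _ _).trans (mul_le_of_le_one_left (norm_nonneg _) (hproj hV.1))
  have n1 : ∀ W : Tensor n₁ n₂ s, ‖tvec (left1 (L * Lᴴ) W)‖ ≤ ‖tvec (left1 Lᴴ W)‖ := fun W => by
    rw [← left1_left1]
    exact (norm_tvec_left1_le _ _).trans (mul_le_of_le_one_left (norm_nonneg _) hL1)
  have n1' : ∀ W : Tensor n₁ n₂ s, ‖tvec (left1 Lᴴ W)‖ ≤ ‖tvec W‖ := fun W =>
    (norm_tvec_left1_le _ _).trans (mul_le_of_le_one_left (norm_nonneg _) hLA)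
  have htensor : (spectral svd Z).toTensor =
      left1 (L * Lᴴ) (left2 (R * Rᴴ) (left3 (V * Vᴴ) Z)) := by
    have e : tucker Lᴴ (1 : Matrix (Fin n₂) (Fin n₂) ℂ) (1 : Matrix (Fin s) (Fin s) ℂ) Z =
        left1 Lᴴ Z := by rw [tucker_eq_left, left2_one, left3_one]
    rw [toTensor, spectral]
    simp only
    rw [← hLdef, e, ← hVdef, ← hRdef, tucker_tucker, tucker_eq_left]
  -- Compression by Lᴴ leaves r rows, so the operator bound becomes a Frobenius bound. Unlike the
  -- operator norm, the Frobenius norm is the same in every matricization and can be used in mode 3.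
  have e1 : ‖tvec (left1 Lᴴ (Z - Zs))‖ ≤ √r * δ := by
    rw [← frobNorm_unfold1, unfold1_left1]
    refine (frobNorm_le_sqrt_rank_mul _).trans ?_
    have hrk : (Lᴴ * unfold1 (Z - Zs)).rank ≤ r := by
      simpa using (Lᴴ * unfold1 (Z - Zs)).rank_le_card_height
    have hop : ‖Lᴴ * unfold1 (Z - Zs)‖ ≤ δ :=
      (Matrix.l2_opNorm_mul _ _).trans ((mul_le_of_le_one_left (norm_nonneg _) hLA).trans h1)
    gcongr
  have e2 : ‖tvec (Zs - left1 (L * Lᴴ) Zs)‖ ≤ √r * (2 * δ) := by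
    rw [← frobNorm_unfold1, unfold1_sub, unfold1_left1]
    have := frobNorm_one_sub_mul_le_of_top hL k1.le (show ‖unfold1 Z - unfold1 Zs‖ ≤ δ from h1)
    rwa [Matrix.sub_mul, Matrix.one_mul] at this
  have e3 : ‖tvec (Zs - left2 (R * Rᴴ) Zs)‖ ≤ √r * (2 * δ) := by
    rw [← frobNorm_unfold2, unfold2_sub, unfold2_left2]
    have := frobNorm_one_sub_mul_le_of_top hR k2.le (show ‖unfold2 Z - unfold2 Zs‖ ≤ δ from h2)
    rwa [Matrix.sub_mul, Matrix.one_mul] at this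
  -- The factor V is computed from the compressed tensor, whose error is √r δ by `e1`. Restoring the
  -- Frobenius norm costs a second √r, which makes this the dominant term.
  have e4 : ‖tvec (left1 Lᴴ Zs - left3 (V * Vᴴ) (left1 Lᴴ Zs))‖ ≤ √r * (2 * (√r * δ)) := by
    rw [← frobNorm_unfold3, unfold3_sub, unfold3_left3]
    have hrk : (unfold3 (left1 Lᴴ Zs)).rank ≤ r := by
      rw [unfold3_left1]
      exact (Matrix.rank_mul_le_left _ _).trans k3.le
    have hop : ‖unfold3 (left1 Lᴴ Z) - unfold3 (left1 Lᴴ Zs)‖ ≤ √r * δ := by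
      rw [← unfold3_sub, ← map_sub]
      exact (opNorm_le_frobNorm _).trans ((frobNorm_unfold3 _).trans_le e1)
    have := frobNorm_one_sub_mul_le_of_top hV hrk hop
    rwa [Matrix.sub_mul, Matrix.one_mul] at this
  -- Projected noise minus the parts of the signal missed by V, R and L. The four norms are at most
  -- √r δ, 2rδ, 2√r δ and 2√r δ, in total at most 7rδ.
  have hdec : (spectral svd Z).toTensor - Zs =
      left3 (V * Vᴴ) (left2 (R * Rᴴ) (left1 (L * Lᴴ) (Z - Zs))) -
        left2 (R * Rᴴ) (left1 (L * Lᴴ) (Zs - left3 (V * Vᴴ) Zs)) -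
        left1 (L * Lᴴ) (Zs - left2 (R * Rᴴ) Zs) - (Zs - left1 (L * Lᴴ) Zs) := by
    rw [htensor]
    simp only [map_sub, left2_left1, left3_left1, left3_left2]
    abel
  have f1 : ‖tvec (left3 (V * Vᴴ) (left2 (R * Rᴴ) (left1 (L * Lᴴ) (Z - Zs))))‖ ≤ √r * δ :=
    (n3 _).trans ((n2 _).trans ((n1 _).trans e1))
  have f2 : ‖tvec (left2 (R * Rᴴ) (left1 (L * Lᴴ) (Zs - left3 (V * Vᴴ) Zs)))‖ ≤
      √r * (2 * (√r * δ)) := by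
    refine (n2 _).trans ((n1 _).trans ?_)
    rw [map_sub, ← left3_left1]
    exact e4
  have f3 : ‖tvec (left1 (L * Lᴴ) (Zs - left2 (R * Rᴴ) Zs))‖ ≤ √r * (2 * δ) :=
    (n1 _).trans ((n1' _).trans e3)
  rw [hdec]
  have hr' : (1 : ℝ) ≤ r := by exact_mod_cast hr
  have hsr : √(r : ℝ) ≤ r := by
    rw [Real.sqrt_le_left (by positivity)]; nlinarith
  have hrr : √(r : ℝ) * √(r : ℝ) = r := Real.mul_self_sqrt (by positivity)
  have hm : √(r : ℝ) * δ ≤ r * δ := by gcongr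
  have hq : √(r : ℝ) * (2 * (√r * δ)) = 2 * (r * δ) := by linear_combination 2 * δ * hrr
  have tri : ∀ a b c d : Tensor n₁ n₂ s, ‖tvec (a - b - c - d)‖ ≤
      ‖tvec a‖ + ‖tvec b‖ + ‖tvec c‖ + ‖tvec d‖ := fun a b c d => by
    simp only [map_sub]
    refine (norm_sub_le _ _).trans (add_le_add ((norm_sub_le _ _).trans ?_) le_rfl)
    exact add_le_add (norm_sub_le _ _) le_rfl
  refine (tri _ _ _ _).trans ?_
  linarith

/-- Sampling commutes with the reweighting, which then cancels in the lifting. The error is the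
Hankel lifting of an unweighted sampling error. -/
lemma initTensor_sub (h1 : 0 < n₁) (h2 : 0 < n₂) (X : Matrix (Fin s) (Fin (n₁ + n₂ - 1)) ℂ)
    (Ω : Fin m → Fin s × Fin (n₁ + n₂ - 1)) :
    initTensor X Ω - hankel X = (hankel (((((m : ℝ) / (s * (n₁ + n₂ - 1 : ℕ)))⁻¹ : ℝ) : ℂ) •
      sampleOp Ω X - X) : Tensor n₁ n₂ s) := by
  have e : sampleOp Ω (reweight n₁ n₂ X) = reweight n₁ n₂ (sampleOp Ω X) := by
    ext j a
    simp only [sampleOp, reweight, Matrix.of_apply, Finset.mul_sum, mul_ite, mul_zero]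
  rw [initTensor, e, liftG_reweight h1 h2]
  rfl

/-- The `l`-th discrete Fourier coefficient of the rows of a matrix. -/
def fourierCoeff (s n : ℕ) (l : Fin n) : Matrix (Fin s) (Fin n) ℂ →ₗ[ℂ] EuclideanSpace ℂ (Fin s) where
  toFun E := WithLp.toLp 2 fun j => ∑ b, E j b * fourierKernel n l b
  map_add' E E' := by
    ext j; simp [add_mul, Finset.sum_add_distrib]
  map_smul' t E := by
    ext j; simp [Finset.mul_sum, mul_assoc]

lemma norm_fourierCoeff_sq {n : ℕ} (l : Fin n) (E : Matrix (Fin s) (Fin n) ℂ) :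
    ‖fourierCoeff s n l E‖ ^ 2 = ∑ j, ‖∑ b, E j b * fourierKernel n l b‖ ^ 2 := by
  rw [EuclideanSpace.norm_sq_eq]; rfl

lemma norm_fourierCoeff_single {n : ℕ} (hn : 0 < n) (l : Fin n) (j : Fin s) (a : Fin n) :
    ‖fourierCoeff s n l (Matrix.single j a 1)‖ ≤ 1 := by
  refine le_of_sq_le_sq ?_ zero_le_one
  rw [norm_fourierCoeff_sq]
  have h : ∀ i, ∑ b, Matrix.single j a (1 : ℂ) i b * fourierKernel n l b =
      if j = i then fourierKernel n l a else 0 := by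
    intro i
    by_cases hi : j = i
    · simp [Matrix.single_apply, hi]
    · simp [hi]
  simp only [h, apply_ite (fun z : ℂ => ‖z‖ ^ 2), norm_fourierKernel hn]
  simp

/-- The spectral initialization is accurate with high probability. -/
theorem ncard_not_spectral_close_le (svd : SVDRoutine r) (hr : 0 < r) (hr1 : r ≤ n₁) (hr2 : r ≤ n₂)
    (hr3 : r ≤ s) (hm : 0 < m) {X : Matrix (Fin s) (Fin (n₁ + n₂ - 1)) ℂ}
    (hrank : mulRank (hankel X : Tensor n₁ n₂ s) = (r, r, r)) {y f δ l : ℝ} (hy : ∀ j a, ‖X j a‖ ≤ y)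
    (hf : frobNorm X ^ 2 ≤ f) (hδ : 0 < δ) (hl : 0 < l)
    (h1 : 4 * l * y ≤ δ * ((m : ℝ) / (s * (n₁ + n₂ - 1 : ℕ))))
    (h2 : 4 * l * f ≤ δ ^ 2 * ((m : ℝ) / (s * (n₁ + n₂ - 1 : ℕ)))) :
    (Set.ncard {Ω : Fin m → Fin s × Fin (n₁ + n₂ - 1) |
      ¬ ‖tvec ((spectral svd (initTensor X Ω)).toTensor - (hankel X : Tensor n₁ n₂ s))‖ ≤
        7 * r * δ} : ℝ) ≤
      (n₁ + n₂ - 1 : ℕ) * (2 * Real.exp (-l) * ((s : ℝ) * (n₁ + n₂ - 1 : ℕ)) ^ m) := by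
  have hn1 : 0 < n₁ := by omega
  have hn2 : 0 < n₂ := by omega
  have hn : 0 < n₁ + n₂ - 1 := by omega
  set p : ℝ := (m : ℝ) / (s * (n₁ + n₂ - 1 : ℕ)) with hp
  -- One event for each frequency, each handled by the vector Bernstein bound. The union bound costs
  -- a factor n.
  let S : Fin (n₁ + n₂ - 1) → Set (Fin m → Fin s × Fin (n₁ + n₂ - 1)) := fun k => {Ω |
    δ ≤ ‖fourierCoeff s (n₁ + n₂ - 1) k (((p⁻¹ : ℝ) : ℂ) • sampleOp Ω X - X)‖}
  have hS : ∀ k, ((S k).ncard : ℝ) ≤ 2 * Real.exp (-l) * ((s : ℝ) * (n₁ + n₂ - 1 : ℕ)) ^ m :=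
    fun k => ncard_norm_sampleOp_sub_ge (by omega) hn hm (fourierCoeff s (n₁ + n₂ - 1) k) X
      zero_le_one (norm_fourierCoeff_single hn k) hy hf hδ hl (by rwa [one_mul])
      (by rwa [one_pow, one_mul])
  have hsub : {Ω : Fin m → Fin s × Fin (n₁ + n₂ - 1) |
      ¬ ‖tvec ((spectral svd (initTensor X Ω)).toTensor - (hankel X : Tensor n₁ n₂ s))‖ ≤
        7 * r * δ} ⊆ ⋃ k, S k := by
    intro Ω hΩ
    by_contra hc
    have hc' : ∀ k, ¬ δ ≤ ‖fourierCoeff s (n₁ + n₂ - 1) k (((p⁻¹ : ℝ) : ℂ) • sampleOp Ω X - X)‖ :=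
      fun k hk => hc (Set.mem_iUnion.2 ⟨k, hk⟩)
    have hE : ∀ k : Fin (n₁ + n₂ - 1), ∑ j, ‖∑ b, (((p⁻¹ : ℝ) : ℂ) • sampleOp Ω X - X) j b *
        fourierKernel (n₁ + n₂ - 1) k b‖ ^ 2 ≤ δ ^ 2 := fun k => by
      rw [← norm_fourierCoeff_sq]
      exact pow_le_pow_left₀ (norm_nonneg _) (not_le.1 (hc' k)).le 2
    refine hΩ (norm_spectral_sub_le svd hr hr1 hr2 hr3 hrank ?_ ?_)
    · rw [initTensor_sub hn1 hn2]
      exact opNorm_unfold1_hankel_le hn1 hn2 _ hδ.le hE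
    · rw [initTensor_sub hn1 hn2]
      exact opNorm_unfold2_hankel_le hn1 hn2 _ hδ.le hE
  have h3 : (Set.ncard (⋃ k, S k) : ℝ) ≤ ∑ k, ((S k).ncard : ℝ) := by
    have := Set.ncard_iUnion_le_of_fintype S
    exact_mod_cast this
  calc _ ≤ (Set.ncard (⋃ k, S k) : ℝ) := by
        exact_mod_cast Set.ncard_le_ncard hsub (Set.toFinite _)
    _ ≤ ∑ k, ((S k).ncard : ℝ) := h3
    _ ≤ ∑ _k : Fin (n₁ + n₂ - 1), 2 * Real.exp (-l) * ((s : ℝ) * (n₁ + n₂ - 1 : ℕ)) ^ m :=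
        Finset.sum_le_sum fun k _ => hS k
    _ = _ := by simp

end Factors

end Initialization

/-! ### Counting sample batches -/

section Counting

open Classical in
lemma ncard_eq_sum {α : Type*} [Fintype α] (A : Set α) :
    (A.ncard : ℝ) = ∑ x, if x ∈ A then 1 else 0 := by
  rw [Set.ncard_eq_toFinset_card', Finset.sum_boole, Set.filter_mem_univ_eq_toFinset]

/-- A fresh coordinate is bad for few choices of all coordinates. -/
theorem ncard_fresh_le {β : Type*} [Fintype β] [Nonempty β] {K : ℕ} (i : Fin (K + 1))
    (T : (Fin (K + 1) → β) → Set β)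
    (hT : ∀ Ω Ω', (∀ j, j ≠ i → Ω j = Ω' j) → T Ω = T Ω') {q : ℝ}
    (hq : ∀ Ω, ((T Ω).ncard : ℝ) ≤ q * Fintype.card β) :
    (Set.ncard {Ω | Ω i ∈ T Ω} : ℝ) ≤ q * (Fintype.card β : ℝ) ^ (K + 1) := by
  classical
  -- Sum over the fresh coordinate first: the bad set does not depend on it and may be frozen. This
  -- is independence in counting form.
  rw [ncard_eq_sum, ← (Fin.insertNthEquiv (fun _ => β) i).sum_comp, Fintype.sum_prod_type,
    Finset.sum_comm]
  have b₀ : β := Classical.arbitrary β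
  have h : ∀ ω : Fin K → β, ∑ b, (if (Fin.insertNthEquiv (fun _ => β) i) (b, ω) ∈
      {Ω : Fin (K + 1) → β | Ω i ∈ T Ω} then (1 : ℝ) else 0) ≤ q * Fintype.card β := by
    intro ω
    refine le_trans (le_of_eq ?_) (hq (i.insertNth b₀ ω))
    rw [ncard_eq_sum]
    refine Finset.sum_congr rfl fun b _ => ?_
    have e : T (i.insertNth b ω) = T (i.insertNth (α := fun _ => β) b₀ ω) := by
      refine hT _ _ fun j hj => ?_
      obtain ⟨k, rfl⟩ := Fin.exists_succAbove_eq hj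
      simp
    have : (Fin.insertNthEquiv (fun _ => β) i) (b, ω) ∈ {Ω : Fin (K + 1) → β | Ω i ∈ T Ω} ↔
        b ∈ T (i.insertNth (α := fun _ => β) b₀ ω) := by
      rw [← e]
      change (i.insertNth b ω : Fin (K + 1) → β) i ∈ T (i.insertNth b ω) ↔ _
      rw [Fin.insertNth_apply_same]
    simp only [this]
  refine (Finset.sum_le_sum fun ω _ => h ω).trans (le_of_eq ?_)
  simp only [Finset.sum_const, Finset.card_univ, Fintype.card_pi, Finset.prod_const,
    Fintype.card_fin, nsmul_eq_mul]
  push_cast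
  ring

lemma measureReal_eq_of_singleton {α : Type*} [Fintype α] [MeasurableSpace α]
    [MeasurableSingletonClass α] (μ : Measure α) [IsFiniteMeasure μ] {q : ℝ}
    (h : ∀ x, μ.real {x} = q) (A : Set α) : μ.real A = A.ncard * q := by
  classical
  have e : A = (A.toFinset : Set α) := by simp
  conv_lhs => rw [e]
  rw [← sum_measureReal_singleton, Finset.sum_congr rfl fun x _ => h x, Finset.sum_const,
    nsmul_eq_mul, Set.ncard_eq_toFinset_card']

lemma pi_real_singleton {ι : Type*} [Fintype ι] {α : Type*} [MeasurableSpace α]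
    (μ : Measure α) [IsProbabilityMeasure μ] {q : ℝ} (h : ∀ x, μ.real {x} = q) (f : ι → α) :
    (Measure.pi fun _ : ι => μ).real {f} = q ^ Fintype.card ι := by
  rw [Measure.real, Measure.pi_singleton, ENNReal.toReal_prod]
  simp only [← Measure.real_def, h, Finset.prod_const, Finset.card_univ]

instance isProbabilityMeasure_sampleLaw {s n m K : ℕ} [Nonempty (Fin s × Fin n)] : IsProbabilityMeasure (sampleLaw s n m K) := by
  unfold sampleLaw; infer_instance

lemma sampleLaw_real {s n m K : ℕ} (hs : 0 < s) (hn : 0 < n)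
    (A : Set (Fin (K + 1) → Fin m → Fin s × Fin n)) :
    (sampleLaw s n m K).real A = A.ncard / (((s : ℝ) * n) ^ m) ^ (K + 1) := by
  have : Nonempty (Fin s × Fin n) := ⟨(⟨0, hs⟩, ⟨0, hn⟩)⟩
  have h0 : ∀ x : Fin s × Fin n, (uniformOn (Set.univ : Set (Fin s × Fin n))).real {x} =
      ((s : ℝ) * n)⁻¹ := fun x => by
    rw [Measure.real, uniformOn_univ, Measure.count_singleton]
    simp
  have h1 : ∀ x : Fin m → Fin s × Fin n, (Measure.pi fun _ : Fin m =>
      uniformOn (Set.univ : Set (Fin s × Fin n))).real {x} = ((s : ℝ) * n)⁻¹ ^ m := fun x => by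
    rw [pi_real_singleton _ h0, Fintype.card_fin]
  have h2 : ∀ x : Fin (K + 1) → Fin m → Fin s × Fin n, (sampleLaw s n m K).real {x} =
      (((s : ℝ) * n)⁻¹ ^ m) ^ (K + 1) := fun x => by
    rw [sampleLaw, pi_real_singleton _ h1, Fintype.card_fin]
  rw [measureReal_eq_of_singleton _ h2, inv_pow, inv_pow, div_eq_mul_inv]

lemma sampleLaw_real_ge {s n m K : ℕ} (hs : 0 < s) (hn : 0 < n)
    {A : Set (Fin (K + 1) → Fin m → Fin s × Fin n)} {q : ℝ}
    (h : (Aᶜ.ncard : ℝ) ≤ q * (((s : ℝ) * n) ^ m) ^ (K + 1)) :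
    1 - q ≤ (sampleLaw s n m K).real A := by
  have : Nonempty (Fin s × Fin n) := ⟨(⟨0, hs⟩, ⟨0, hn⟩)⟩
  have h1 := probReal_compl_eq_one_sub (μ := sampleLaw s n m K) (Set.toFinite A).measurableSet
  rw [sampleLaw_real hs hn] at h1
  have hs' : (0 : ℝ) < s := by exact_mod_cast hs
  have hn' : (0 : ℝ) < n := by exact_mod_cast hn
  rw [← div_le_iff₀ (by positivity), h1] at h
  linarith

end Counting

/-! ### The iterates -/

section Iterates

variable {n₁ n₂ s r m K : ℕ}

namespace Factors

lemma iterate_zero (svd : SVDRoutine r) (X : Matrix (Fin s) (Fin (n₁ + n₂ - 1)) ℂ) (η B : ℝ)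
    (Ω : Fin (K + 1) → Fin m → Fin s × Fin (n₁ + n₂ - 1)) :
    iterate svd X η B Ω 0 = (project B (spectral svd (initTensor X (Ω 0))) : Factors n₁ n₂ s r) :=
  rfl

lemma iterate_succ (svd : SVDRoutine r) (X : Matrix (Fin s) (Fin (n₁ + n₂ - 1)) ℂ) (η B : ℝ)
    (Ω : Fin (K + 1) → Fin m → Fin s × Fin (n₁ + n₂ - 1)) (i : Fin K) :
    (iterate svd X η B Ω i.succ : Factors n₁ n₂ s r) =
      project B (gradStep X η (Ω i.succ) (iterate svd X η B Ω i.castSucc)) := by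
  rw [iterate, Fin.induction_succ]; rfl

/-- The `k`-th iterate depends only on the first batches. -/
lemma iterate_congr (svd : SVDRoutine r) (X : Matrix (Fin s) (Fin (n₁ + n₂ - 1)) ℂ) (η B : ℝ)
    {Ω Ω' : Fin (K + 1) → Fin m → Fin s × Fin (n₁ + n₂ - 1)} (k : Fin (K + 1)) :
    (∀ j ≤ k, Ω j = Ω' j) →
      (iterate svd X η B Ω k : Factors n₁ n₂ s r) = iterate svd X η B Ω' k := by
  induction k using Fin.induction with
  | zero => intro h; rw [iterate_zero, iterate_zero, h 0 le_rfl]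
  | succ i ih =>
    intro h
    rw [iterate_succ, iterate_succ, h _ le_rfl,
      ih fun j hj => h j (hj.trans (Fin.castSucc_lt_succ).le)]

lemma exists_iterate_eq_project (svd : SVDRoutine r) (X : Matrix (Fin s) (Fin (n₁ + n₂ - 1)) ℂ)
    (η B : ℝ) (Ω : Fin (K + 1) → Fin m → Fin s × Fin (n₁ + n₂ - 1)) (k : Fin (K + 1)) :
    ∃ F : Factors n₁ n₂ s r, iterate svd X η B Ω k = project B F := by
  induction k using Fin.cases with
  | zero => exact ⟨_, iterate_zero _ _ _ _ _⟩
  | succ i => exact ⟨_, iterate_succ _ _ _ _ _ _⟩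

/-- The error of the iterates decays linearly unless one of few bad samples is drawn. -/
theorem ncard_not_linear_convergence_le (svd : SVDRoutine r)
    {X : Matrix (Fin s) (Fin (n₁ + n₂ - 1)) ℂ} {η B ε σ qInit qStep : ℝ}
    (hs : 0 < s) (hn : 0 < n₁ + n₂ - 1) (h0 : 0 ≤ η) (h1 : η ≤ 0.4) (hB : 0 < B)
    (hε : ε ≤ 1 / 200) (hσ : 0 < σ) (hq0 : 0 ≤ qStep)
    (hZ1 : ∀ i, rowNorm (unfold1 (hankel X : Tensor n₁ n₂ s)) i ≤ B / √((n₁ + n₂ - 1 : ℕ) : ℝ))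
    (hZ2 : ∀ i, rowNorm (unfold2 (hankel X : Tensor n₁ n₂ s)) i ≤ B / √((n₁ + n₂ - 1 : ℕ) : ℝ))
    (hInit : (Set.ncard {Ω : Fin m → Fin s × Fin (n₁ + n₂ - 1) |
      ¬ ‖tvec ((spectral svd (initTensor X Ω)).toTensor - (hankel X : Tensor n₁ n₂ s))‖ ≤ ε * σ} : ℝ) ≤
        qInit * ((s : ℝ) * (n₁ + n₂ - 1 : ℕ)) ^ m)
    (hStep : ∀ F : Factors n₁ n₂ s r, ‖tvec (F.toTensor - hankel X)‖ ≤ σ / 200 →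
      (∀ i, rowNorm (unfold1 F.toTensor) i ≤ B / √((n₁ + n₂ - 1 : ℕ) : ℝ)) →
      (∀ i, rowNorm (unfold2 F.toTensor) i ≤ B / √((n₁ + n₂ - 1 : ℕ) : ℝ)) →
      (Set.ncard {Ω : Fin m → Fin s × Fin (n₁ + n₂ - 1) |
        ¬ ‖tvec ((gradStep X η Ω F).toTensor - hankel X)‖ ≤
          (1 - 0.5 * η) * ‖tvec (F.toTensor - hankel X)‖} : ℝ) ≤
        qStep * ((s : ℝ) * (n₁ + n₂ - 1 : ℕ)) ^ m) :
    (Set.ncard {Ω : Fin (K + 1) → Fin m → Fin s × Fin (n₁ + n₂ - 1) |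
      ¬ ∀ k : Fin (K + 1), ‖tvec ((iterate svd X η B Ω k : Factors n₁ n₂ s r).toTensor - hankel X)‖ ≤
        ε * σ * (1 - 0.5 * η) ^ (k : ℕ)} : ℝ) ≤
      (qInit + K * qStep) * (((s : ℝ) * (n₁ + n₂ - 1 : ℕ)) ^ m) ^ (K + 1) := by
  have : Nonempty (Fin s × Fin (n₁ + n₂ - 1)) := ⟨(⟨0, hs⟩, ⟨0, hn⟩)⟩
  have hcard : (Fintype.card (Fin m → Fin s × Fin (n₁ + n₂ - 1)) : ℝ) =
      ((s : ℝ) * (n₁ + n₂ - 1 : ℕ)) ^ m := by simp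
  set It : (Fin (K + 1) → Fin m → Fin s × Fin (n₁ + n₂ - 1)) → Fin (K + 1) → Factors n₁ n₂ s r :=
    fun Ω k => iterate svd X η B Ω k with hIt
  set S₀ : Set (Fin m → Fin s × Fin (n₁ + n₂ - 1)) := {Ω |
      ¬ ‖tvec ((spectral svd (initTensor X Ω)).toTensor - (hankel X : Tensor n₁ n₂ s))‖ ≤ ε * σ}
    with hS₀
  -- Closeness of the current iterate is part of the bad event, so the event is empty when closeness
  -- fails and the counting bound holds for every history.
  let T : Fin K → (Fin (K + 1) → Fin m → Fin s × Fin (n₁ + n₂ - 1)) →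
      Set (Fin m → Fin s × Fin (n₁ + n₂ - 1)) := fun i Ω => {w |
    ‖tvec ((It Ω i.castSucc).toTensor - hankel X)‖ ≤ σ / 200 ∧
      ¬ ‖tvec ((gradStep X η w (It Ω i.castSucc)).toTensor - hankel X)‖ ≤
          (1 - 0.5 * η) * ‖tvec ((It Ω i.castSucc).toTensor - hankel X)‖}
  have hB0 := ncard_fresh_le (0 : Fin (K + 1)) (fun _ => S₀) (fun _ _ _ => rfl) (q := qInit)
    (fun _ => by rw [hcard]; exact hInit)
  have hBi : ∀ i : Fin K, (Set.ncard {Ω | Ω i.succ ∈ T i Ω} : ℝ) ≤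
      qStep * (Fintype.card (Fin m → Fin s × Fin (n₁ + n₂ - 1)) : ℝ) ^ (K + 1) := fun i => by
    refine ncard_fresh_le i.succ (T i) (fun Ω Ω' h => ?_) (fun Ω => ?_)
    · have e : It Ω i.castSucc = It Ω' i.castSucc := iterate_congr _ _ _ _ _ fun j hj =>
        h j (ne_of_lt (hj.trans_lt Fin.castSucc_lt_succ))
      simp only [T, e]
    · rw [hcard]
      by_cases hc : ‖tvec ((It Ω i.castSucc).toTensor - hankel X)‖ ≤ σ / 200
      · obtain ⟨F, hF⟩ := exists_iterate_eq_project (n₁ := n₁) (n₂ := n₂) svd X η B Ω i.castSucc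
        have := hStep (It Ω i.castSucc) hc
          (fun j => by rw [hIt]; simp only; rw [hF]; exact rowNorm_unfold1_project_le hB hn F j)
          (fun j => by rw [hIt]; simp only; rw [hF]; exact rowNorm_unfold2_project_le hB hn F j)
        refine le_trans ?_ this
        exact_mod_cast Set.ncard_le_ncard (show T i Ω ⊆ _ from fun w hw => hw.2) (Set.toFinite _)
      · have : T i Ω = ∅ := Set.eq_empty_of_forall_notMem fun w hw => hc hw.1
        rw [this, Set.ncard_empty, Nat.cast_zero]
        positivity
  rw [hcard] at hB0
  simp only [hcard] at hBi
  have hρ0 : 0 ≤ 1 - 0.5 * η := by linarith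
  have hρ1 : 1 - 0.5 * η ≤ 1 := by linarith
  have hsub : {Ω : Fin (K + 1) → Fin m → Fin s × Fin (n₁ + n₂ - 1) |
      ¬ ∀ k : Fin (K + 1), ‖tvec ((It Ω k).toTensor - hankel X)‖ ≤
        ε * σ * (1 - 0.5 * η) ^ (k : ℕ)} ⊆ {Ω | Ω 0 ∈ S₀} ∪ ⋃ i, {Ω | Ω (Fin.succ i) ∈ T i Ω} := by
    intro Ω hΩ
    by_contra hc
    rw [Set.mem_union, not_or, Set.mem_iUnion, not_exists] at hc
    refine hΩ fun k => ?_
    induction k using Fin.induction with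
    | zero =>
      have h2 : ¬ Ω 0 ∈ S₀ := hc.1
      have h3 : ‖tvec ((spectral svd (initTensor X (Ω 0))).toTensor -
        (hankel X : Tensor n₁ n₂ s))‖ ≤ ε * σ := not_not.1 h2
      rw [Fin.val_zero, pow_zero, mul_one]
      exact (norm_tvec_project_sub_le hB _ hZ1 hZ2).trans h3
    | succ i ih =>
      -- The inductive bound keeps the iterate within σ/200, so a good batch must contract; the
      -- following projection cannot increase the error.
      have h2 : ¬ Ω i.succ ∈ T i Ω := hc.2 i
      have hpow : (1 - 0.5 * η) ^ (i.castSucc : ℕ) ≤ 1 := pow_le_one₀ hρ0 hρ1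
      have h3 : ‖tvec ((It Ω i.castSucc).toTensor - hankel X)‖ ≤ σ / 200 := by
        refine ih.trans ?_
        calc ε * σ * (1 - 0.5 * η) ^ (i.castSucc : ℕ) ≤ 1 / 200 * σ * 1 := by gcongr
          _ = _ := by ring
      have h4 : ‖tvec ((gradStep X η (Ω i.succ) (It Ω i.castSucc)).toTensor - hankel X)‖ ≤
          (1 - 0.5 * η) * ‖tvec ((It Ω i.castSucc).toTensor - hankel X)‖ := by
        by_contra h5
        exact h2 ⟨h3, h5⟩
      have h6 : It Ω i.succ = project B (gradStep X η (Ω i.succ) (It Ω i.castSucc)) :=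
        iterate_succ _ _ _ _ _ _
      rw [h6]
      refine (norm_tvec_project_sub_le hB _ hZ1 hZ2).trans (h4.trans ?_)
      calc _ ≤ (1 - 0.5 * η) * (ε * σ * (1 - 0.5 * η) ^ (i.castSucc : ℕ)) := by gcongr
        _ = _ := by rw [Fin.val_succ, Fin.val_castSucc, pow_succ]; ring
  have h5 : (Set.ncard (⋃ i : Fin K, {Ω | Ω (Fin.succ i) ∈ T i Ω}) : ℝ) ≤
      ∑ i : Fin K, (Set.ncard {Ω | Ω (Fin.succ i) ∈ T i Ω} : ℝ) := by
    exact_mod_cast Set.ncard_iUnion_le_of_fintype _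
  have h6 : (Set.ncard {Ω : Fin (K + 1) → Fin m → Fin s × Fin (n₁ + n₂ - 1) |
      ¬ ∀ k : Fin (K + 1), ‖tvec ((It Ω k).toTensor - hankel X)‖ ≤
        ε * σ * (1 - 0.5 * η) ^ (k : ℕ)} : ℝ) ≤ Set.ncard {Ω : Fin (K + 1) → _ | Ω 0 ∈ S₀} +
        Set.ncard (⋃ i : Fin K, {Ω | Ω (Fin.succ i) ∈ T i Ω}) := by
    exact_mod_cast (Set.ncard_le_ncard hsub (Set.toFinite _)).trans (Set.ncard_union_le _ _)
  have h7 := Finset.sum_le_sum fun (i : Fin K) (_ : i ∈ Finset.univ) => hBi i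
  rw [Finset.sum_const, Finset.card_univ, Fintype.card_fin, nsmul_eq_mul] at h7
  linarith

end Factors

end Iterates

/-! ### Singular values and incoherence of the lifted signal -/

section Signal

open scoped Matrix.Norms.L2Operator

lemma matSigmaMin_pos {ι κ : Type*} [Fintype ι] [Fintype κ] [DecidableEq κ] {M : Matrix ι κ ℂ}
    (h : 0 < M.rank) : 0 < matSigmaMin M := by
  classical
  rw [matSigmaMin, singVal, LinearMap.singularValues_pos_iff_lt_finrank_range,
    finrank_range_toEuclideanLin]
  omega

lemma matSigmaMin_le_matSigmaMax {ι κ : Type*} [Fintype ι] [Fintype κ] [DecidableEq κ]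
    (M : Matrix ι κ ℂ) : matSigmaMin M ≤ matSigmaMax M :=
  LinearMap.singularValues_antitone _ (Nat.zero_le _)

lemma sigmaMin_le_sigmaMax {a b c : ℕ} (Z : Tensor a b c) : sigmaMin Z ≤ sigmaMax Z :=
  (min_le_left _ _).trans ((matSigmaMin_le_matSigmaMax _).trans (le_max_left _ _))

lemma sigmaMin_pos {a b c r : ℕ} {Z : Tensor a b c} (hr : 0 < r) (h : mulRank Z = (r, r, r)) :
    0 < sigmaMin Z := by
  simp only [mulRank, Prod.mk.injEq] at h
  exact lt_min (matSigmaMin_pos (h.1 ▸ hr))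
    (lt_min (matSigmaMin_pos (h.2.1 ▸ hr)) (matSigmaMin_pos (h.2.2 ▸ hr)))

variable {n₁ n₂ s r : ℕ}

/-- Slices and entries of an incoherent Hankel tensor are small. -/
lemma signal_bounds (h1 : 0 < n₁) (h2 : 0 < n₂) {X : Matrix (Fin s) (Fin (n₁ + n₂ - 1)) ℂ}
    {Fs : Factors n₁ n₂ s r} (hFs : hankel X = Fs.toTensor) (hL : Fs.Lᴴ * Fs.L = 1)
    (hR : Fs.Rᴴ * Fs.R = 1) {β : ℝ} (hβ : 0 ≤ β) (hLβ : ∀ i, rowNorm Fs.L i ≤ β)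
    (hRβ : ∀ i, rowNorm Fs.R i ≤ β) :
    (∀ i, rowNorm (unfold1 (hankel X : Tensor n₁ n₂ s)) i ≤
      β * sigmaMax (hankel X : Tensor n₁ n₂ s)) ∧
    (∀ i, rowNorm (unfold2 (hankel X : Tensor n₁ n₂ s)) i ≤
      β * sigmaMax (hankel X : Tensor n₁ n₂ s)) ∧
    (∀ j a, ‖X j a‖ ≤ β ^ 2 * sigmaMax (hankel X : Tensor n₁ n₂ s)) := by
  have k1 : ∀ i, rowNorm (unfold1 (hankel X : Tensor n₁ n₂ s)) i ≤
      β * sigmaMax (hankel X : Tensor n₁ n₂ s) := fun i => by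
    have h := rowNorm_mul_conjTranspose_le hL Fs.breveL i
    rw [← Factors.unfold1_toTensor, ← hFs] at h
    exact h.trans (mul_le_mul (hLβ i) ((opNorm_le_matSigmaMax _).trans (le_max_left _ _))
      (norm_nonneg _) hβ)
  have k2 : ∀ i, rowNorm (unfold2 (hankel X : Tensor n₁ n₂ s)) i ≤
      β * sigmaMax (hankel X : Tensor n₁ n₂ s) := fun i => by
    have h := rowNorm_mul_conjTranspose_le hR Fs.breveR i
    rw [← Factors.unfold2_toTensor, ← hFs] at h
    exact h.trans (mul_le_mul (hRβ i) ((opNorm_le_matSigmaMax _).trans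
      ((le_max_left _ _).trans (le_max_right _ _))) (norm_nonneg _) hβ)
  refine ⟨k1, k2, fun j a => ?_⟩
  obtain ⟨i₁, i₂, rfl⟩ := exists_skewIdx_eq h1 h2 a
  have hRu : IsUnit (Fs.Rᴴ * Fs.R).det := by rw [hR]; simp
  have hQ : left2 (colProj Fs.R) (hankel X : Tensor n₁ n₂ s) = hankel X :=
    unfold2_injective (by
      rw [hFs, unfold2_left2, Factors.unfold2_toTensor, ← Matrix.mul_assoc, colProj_mul_self hRu])
  have h := norm_apply_le_of_left2 hQ i₁ i₂ j
  refine le_trans (le_of_eq rfl) (h.trans ?_)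
  rw [sq, mul_assoc]
  exact mul_le_mul ((rowNorm_colProj_of_orthonormal_le hR i₂).trans (hRβ i₂)) (k1 i₁)
    (rowNorm_nonneg _ _) hβ

/-- Positivity of μ₀ is not assumed. It follows from incoherence, since a nonzero factor needs a
positive row bound. -/
lemma pos_of_orthonormal_of_rowNorm_le {a : ℕ} {L : Matrix (Fin a) (Fin r) ℂ} (hr : 0 < r)
    (hL : Lᴴ * L = 1) {β : ℝ} (h : ∀ i, rowNorm L i ≤ β) : 0 < β := by
  by_contra hβ
  have h0 : L = 0 := by
    ext i j
    have := (norm_apply_le_rowNorm L i j).trans ((h i).trans (not_lt.1 hβ))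
    simpa using this
  have h1 := congrFun (congrFun hL ⟨0, hr⟩) ⟨0, hr⟩
  rw [h0] at h1
  simp at h1

end Signal

/-- The numerical consequences of the sample size condition. -/
lemma sample_size_bounds {p C CB l β σ S ε R : ℝ} (hCB : 1 < CB)
    (hC : C = 40000 * CB ^ 2) (hl : 0 < l) (hσ : 0 < σ) (hS : σ ≤ S) (hε : 0 < ε)
    (hε1 : ε ≤ 1) (hR : 1 ≤ R) (hp : C * (ε⁻¹ ^ 2 * β ^ 2 * R ^ 2 * (S / σ) ^ 2 * l) ≤ p) :
    4 * (3 * l) * (β ^ 2 * S) ≤ ε * σ / (7 * R) * p ∧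
    4 * (3 * l) * (2 * (β * S) ^ 2) ≤ (ε * σ / (7 * R)) ^ 2 * p ∧
    10000 * (3 * l) * (CB * β * S / (σ - σ / 200)) ^ 2 ≤ p := by
  set κ := S / σ with hκ
  have hκ1 : 1 ≤ κ := (one_le_div hσ).2 hS
  have hSκ : S = κ * σ := by rw [hκ]; field_simp
  have hi1 : 1 ≤ ε⁻¹ := (one_le_inv₀ hε).2 hε1
  have hR0 : 0 < R := by linarith
  have hCB2 : 1 ≤ CB ^ 2 := one_le_pow₀ hCB.le
  have hA : 0 ≤ β ^ 2 * l := by positivity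
  have hp' : 40000 * CB ^ 2 * (ε⁻¹ ^ 2 * R ^ 2 * κ ^ 2) * (β ^ 2 * l) ≤ p := by
    refine le_trans (le_of_eq ?_) hp
    rw [hC]; ring
  have hp1 : 40000 * (ε⁻¹ ^ 2 * R ^ 2 * κ ^ 2) * (β ^ 2 * l) ≤ p := by
    refine le_trans ?_ hp'
    refine mul_le_mul_of_nonneg_right (mul_le_mul_of_nonneg_right ?_ (by positivity)) hA
    linarith
  have hee : ε * ε⁻¹ = 1 := mul_inv_cancel₀ hε.ne'
  refine ⟨?_, ?_, ?_⟩
  -- The constant is 4·3·7, with 3 from `3 * l` and 7 from the initialization bound 7rδ.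
  · have e : 84 * R * (β ^ 2 * (κ * l)) ≤ ε * p := by
      have h1 : 40000 * (ε⁻¹ * R * κ) * (β ^ 2 * l) ≤ p := by
        refine le_trans ?_ hp1
        refine mul_le_mul_of_nonneg_right ?_ hA
        have : ε⁻¹ * R * κ ≤ (ε⁻¹ * R * κ) ^ 2 := by
          refine le_self_pow₀ ?_ two_ne_zero
          have : 1 ≤ ε⁻¹ * R := one_le_mul_of_one_le_of_one_le hi1 hR
          exact one_le_mul_of_one_le_of_one_le this hκ1
        nlinarith
      have h2 := mul_le_mul_of_nonneg_left h1 hε.le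
      have h3 : ε * (40000 * (ε⁻¹ * R * κ) * (β ^ 2 * l)) = 40000 * (R * (β ^ 2 * (κ * l))) := by
        linear_combination 40000 * R * κ * β ^ 2 * l * hee
      rw [h3] at h2
      have h4 : 0 ≤ R * (β ^ 2 * (κ * l)) := by positivity
      linarith
    rw [div_mul_eq_mul_div, le_div_iff₀ (by positivity), hSκ]
    have := mul_le_mul_of_nonneg_left e hσ.le
    linarith
  -- The constant is 4·3·2·7², with 2 from covering the signal by two slices.
  · have e : 1176 * R ^ 2 * (β ^ 2 * κ ^ 2 * l) ≤ ε ^ 2 * p := by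
      have h2 := mul_le_mul_of_nonneg_left hp1 (sq_nonneg ε)
      have h3 : ε ^ 2 * (40000 * (ε⁻¹ ^ 2 * R ^ 2 * κ ^ 2) * (β ^ 2 * l)) =
          40000 * (R ^ 2 * (β ^ 2 * κ ^ 2 * l)) := by
        have : ε ^ 2 * ε⁻¹ ^ 2 = 1 := by rw [← mul_pow, hee, one_pow]
        linear_combination 40000 * R ^ 2 * κ ^ 2 * β ^ 2 * l * this
      rw [h3] at h2
      have h4 : 0 ≤ R ^ 2 * (β ^ 2 * κ ^ 2 * l) := by positivity
      linarith
    rw [div_pow, div_mul_eq_mul_div, le_div_iff₀ (by positivity), hSκ]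
    have := mul_le_mul_of_nonneg_left e (sq_nonneg σ)
    linarith
  -- The requirement 30000·(200/199)² is below the 40000 in C; this condition determines that
  -- constant and its factor `CB ^ 2`.
  · have e1 : CB * β * S / (σ - σ / 200) = 200 / 199 * (CB * β * κ) := by
      rw [hSκ]; field_simp; ring
    rw [e1]
    refine le_trans ?_ hp'
    have h1 : (1 : ℝ) ≤ ε⁻¹ ^ 2 * R ^ 2 :=
      one_le_mul_of_one_le_of_one_le (one_le_pow₀ hi1) (one_le_pow₀ hR)
    have h2 : 0 ≤ CB ^ 2 * κ ^ 2 * (β ^ 2 * l) := by positivity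
    have h3 := mul_le_mul_of_nonneg_left h1 h2
    nlinarith

theorem theorem1 :
    ∃ εmax : ℝ, 0 < εmax ∧ ∃ c : ℝ, 0 < c ∧ ∀ CB : ℝ, ∃ C : ℝ, 0 < C ∧
      ∀ (n₁ n₂ s r K mhat m : ℕ) (X : Matrix (Fin s) (Fin (n₁ + n₂ - 1)) ℂ)
        (svd : SVDRoutine r) (μ₀ ε₀ η B : ℝ),
        0 < r →
        mulRank (hankel X : Tensor n₁ n₂ s) = (r, r, r) →
        IsIncoherent μ₀ r (hankel X : Tensor n₁ n₂ s) →
        0 < η → η ≤ 0.4 →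
        0 < ε₀ → ε₀ ≤ εmax →
        (1 + ε₀) ^ 3 ≤ CB →
        B = CB * √(μ₀ * cSym n₁ n₂ * r) * sigmaMax (hankel X : Tensor n₁ n₂ s) →
        m = (K + 1) * mhat →
        C * (K + 1) * ε₀⁻¹ ^ 2 * μ₀ * cSym n₁ n₂ * s * r ^ 3 *
            condNumber (hankel X : Tensor n₁ n₂ s) ^ 2 *
            Real.log ((K + 1) * (s * (n₁ + n₂ - 1 : ℕ))) ≤ (m : ℝ) →
        1 - c / ((s : ℝ) * (n₁ + n₂ - 1 : ℕ)) ^ 2 ≤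
          (sampleLaw s (n₁ + n₂ - 1) mhat K).real
            {Ω | ∀ k : Fin (K + 1),
              frobNorm ((Factors.iterate svd X η B Ω k).estimate - X) ≤
                3 * ε₀ * (1 - 0.5 * η) ^ (k : ℕ) * sigmaMin (hankel X : Tensor n₁ n₂ s)} := by
  refine ⟨1 / 200, by norm_num, 6, by norm_num, fun CB => ?_⟩
  -- For `CB` at most 1 the condition (1 + ε₀)³ ≤ C_B cannot hold, and any positive C will do.
  by_cases hCB : 1 < CB
  swap
  · refine ⟨1, one_pos, fun n₁ n₂ s r K mhat m X svd μ₀ ε₀ η B hr hrank hinc hη0 hη1 hε0 hε1 hε => ?_⟩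
    have : 1 < (1 + ε₀) ^ 3 := one_lt_pow₀ (by linarith) three_ne_zero
    exact absurd (this.trans_le hε) hCB
  refine ⟨40000 * CB ^ 2, by positivity, ?_⟩
  intro n₁ n₂ s r K mhat m X svd μ₀ ε₀ η B hr hrank hinc hη0 hη1 hε0 hε1 _ hB hm hsize
  have hrk := hrank
  simp only [mulRank, Prod.mk.injEq] at hrk
  have hr1 : r ≤ n₁ := by
    rw [← hrk.1]; simpa using (unfold1 (hankel X : Tensor n₁ n₂ s)).rank_le_card_height
  have hr2 : r ≤ n₂ := by
    rw [← hrk.2.1]; simpa using (unfold2 (hankel X : Tensor n₁ n₂ s)).rank_le_card_height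
  have hr3 : r ≤ s := by
    rw [← hrk.2.2]; simpa using (unfold3 (hankel X : Tensor n₁ n₂ s)).rank_le_card_height
  have hn1 : 0 < n₁ := by omega
  have hn2 : 0 < n₂ := by omega
  have hs : 0 < s := by omega
  have hn : 0 < n₁ + n₂ - 1 := by omega
  obtain ⟨L, R, V, S, hL, hR, -, hFs, hLβ, hRβ⟩ := hinc
  set β := √(μ₀ * cSym n₁ n₂ * r / ((n₁ + n₂ - 1 : ℕ) : ℝ)) with hβ
  set σ := sigmaMin (hankel X : Tensor n₁ n₂ s) with hσ
  set τ := sigmaMax (hankel X : Tensor n₁ n₂ s) with hτ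
  set N : ℝ := ((n₁ + n₂ - 1 : ℕ) : ℝ) with hN
  have hN1 : (1 : ℝ) ≤ N := by rw [hN]; exact_mod_cast hn
  have hs1 : (1 : ℝ) ≤ s := by exact_mod_cast hs
  have hr' : (1 : ℝ) ≤ r := by exact_mod_cast hr
  have hN0 : 0 < N := by linarith
  have hs0 : (0 : ℝ) < s := by linarith
  have hσ0 : 0 < σ := sigmaMin_pos hr hrank
  have hστ : σ ≤ τ := sigmaMin_le_sigmaMax _
  have hτ0 : 0 < τ := hσ0.trans_le hστ
  have hβ0 : 0 < β := pos_of_orthonormal_of_rowNorm_le hr hL hLβ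
  have hβ2 : β ^ 2 = μ₀ * cSym n₁ n₂ * r / N := Real.sq_sqrt (Real.sqrt_pos.1 hβ0).le
  let Fs : Factors n₁ n₂ s r := ⟨L, R, V, S⟩
  obtain ⟨hZ1, hZ2, hX⟩ := signal_bounds (Fs := Fs) hn1 hn2 hFs hL hR hβ0.le hLβ hRβ
  -- The projection radius is C_B times the slice bound βτ of the signal. Since C_B > 1 the signal
  -- is admissible for the projection.
  have hBn : B / √N = CB * β * τ := by
    rw [hB, hβ, Real.sqrt_div' _ hN0.le]; ring
  have hB0 : 0 < B := by
    have : 0 < B / √N := by rw [hBn]; positivity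
    exact (div_pos_iff_of_pos_right (Real.sqrt_pos.2 hN0)).1 this
  have hβB : β * τ ≤ B / √N := by
    rw [hBn, mul_assoc]; exact le_mul_of_one_le_left (by positivity) hCB.le
  -- For sn ≤ 2 the claimed probability is nonpositive; otherwise the logarithm below is positive.
  rcases le_or_gt ((s : ℝ) * N) 2 with hsn | hsn
  · have h1 : 1 ≤ 6 / ((s : ℝ) * N) ^ 2 := by
      rw [one_le_div (by positivity)]
      nlinarith [mul_pos hs0 hN0]
    exact (sub_nonpos.2 h1).trans measureReal_nonneg
  set Q : ℝ := (K + 1) * (s * N) with hQ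
  have hsN0 : 0 < (s : ℝ) * N := by positivity
  have hK1 : (1 : ℝ) ≤ K + 1 := by have : (0 : ℝ) ≤ K := K.cast_nonneg; linarith
  have hQs : (s : ℝ) * N ≤ Q := le_mul_of_one_le_left hsN0.le hK1
  have hQ0 : 0 < Q := hsN0.trans_le hQs
  have hl : 0 < Real.log Q := Real.log_pos (by linarith)
  set l := Real.log Q with hldef
  set p : ℝ := (mhat : ℝ) / (s * N) with hp
  -- Per batch the factor K + 1 cancels. One of the three powers of r is absorbed into β² = μ₀ c_s r
  -- / n, and the other two pay for the initialization.
  have hsample : 40000 * CB ^ 2 * (ε₀⁻¹ ^ 2 * β ^ 2 * (r : ℝ) ^ 2 * (τ / σ) ^ 2 * l) ≤ p := by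
    rw [hp, le_div_iff₀ hsN0, hβ2]
    rw [hm, condNumber, ← hτ, ← hσ] at hsize
    push_cast at hsize
    refine le_of_mul_le_mul_left (le_trans (le_of_eq ?_) hsize) (by linarith : (0 : ℝ) < K + 1)
    field_simp
  have hp0 : 0 < p := lt_of_lt_of_le (by positivity) hsample
  have hmhat : 0 < mhat := by
    rcases Nat.eq_zero_or_pos mhat with h | h
    · rw [hp, h] at hp0; simp at hp0
    · exact h
  obtain ⟨b1, b2, b3⟩ := sample_size_bounds hCB rfl hl hσ0 hστ hε0 (by linarith) hr' hsample
  have hinit := Factors.ncard_not_spectral_close_le svd hr hr1 hr2 hr3 hmhat hrank hX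
    (frobNorm_sq_le_of_slices hn1 hn2 X hZ1 hZ2)
    (show 0 < ε₀ * σ / (7 * r) by positivity) (show 0 < 3 * l by positivity) b1 b2
  have hδ : 7 * (r : ℝ) * (ε₀ * σ / (7 * r)) = ε₀ * σ := by field_simp
  rw [hδ] at hinit
  set x : ℝ := Real.exp (-(3 * l)) with hx
  -- The incoherence parameter of the iterates is the slice bound after projection divided by the
  -- singular value bound σ - σ/200. It replaces β in the analysis of a step and brings in κ.
  have hγ : CB * β * τ / (σ - σ / 200) * (σ - σ / 200) = CB * β * τ :=
    div_mul_cancel₀ _ (by linarith)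
  have hRγ : β ≤ CB * β * τ / (σ - σ / 200) := by
    rw [le_div_iff₀ (by linarith)]
    calc β * (σ - σ / 200) ≤ β * τ := by gcongr; linarith
      _ ≤ CB * β * τ := by rw [← hBn]; exact hβB
  have hstep : ∀ F : Factors n₁ n₂ s r, ‖tvec (F.toTensor - hankel X)‖ ≤ σ / 200 →
      (∀ i, rowNorm (unfold1 F.toTensor) i ≤ B / √N) →
      (∀ i, rowNorm (unfold2 F.toTensor) i ≤ B / √N) →
      (Set.ncard {Ω : Fin mhat → Fin s × Fin (n₁ + n₂ - 1) |
        ¬ ‖tvec ((Factors.gradStep X η Ω F).toTensor - hankel X)‖ ≤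
          (1 - 0.5 * η) * ‖tvec (F.toTensor - hankel X)‖} : ℝ) ≤ 4 * x * ((s : ℝ) * N) ^ mhat := by
    intro F hF h1 h2
    exact Factors.ncard_not_gradStep_contraction_le (Fs := Fs) hn1 hn2 hs hmhat hFs hR hrank hη0.le hη1 hσ0
      le_rfl hF (show 0 < 3 * l by positivity) (hβ0.le.trans hRγ)
      (fun i => (h1 i).trans (by rw [hγ, hBn])) (fun i => (h2 i).trans (by rw [hγ, hBn]))
      (fun i => (hRβ i).trans hRγ) b3
  have hbad := Factors.ncard_not_linear_convergence_le (K := K) (ε := ε₀) (qInit := N * (2 * x))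
    (qStep := 4 * x) svd hs hn hη0.le hη1 hB0 hε1 hσ0 (by positivity)
    (fun i => (hZ1 i).trans hβB) (fun i => (hZ2 i).trans hβB) (hinit.trans (le_of_eq (by ring)))
    hstep
  -- With level 3 log Q each Bernstein failure has probability of order Q⁻³. There are n frequencies
  -- and K steps, both at most Q in number, which gives 6/Q² and so c = 6.
  have hprob : N * (2 * x) + K * (4 * x) ≤ 6 / ((s : ℝ) * N) ^ 2 := by
    have hx3 : x = (Q ^ 3)⁻¹ := by
      rw [hx, hldef, Real.exp_neg, mul_comm, Real.exp_mul, Real.exp_log hQ0]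
      norm_cast
    have hNQ : N ≤ Q := le_trans (le_mul_of_one_le_left hN0.le hs1) hQs
    have hKQ : (K : ℝ) ≤ Q := by
      have : (K : ℝ) + 1 ≤ Q := le_mul_of_one_le_right (by linarith)
        (one_le_mul_of_one_le_of_one_le hs1 hN1)
      linarith
    have hx0 : 0 < x := Real.exp_pos _
    calc N * (2 * x) + K * (4 * x) ≤ Q * (2 * x) + Q * (4 * x) := by gcongr
      _ = 6 / Q ^ 2 := by rw [hx3]; field_simp; ring
      _ ≤ _ := by gcongr
  refine sampleLaw_real_ge hs hn (le_trans ?_ (hbad.trans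
    (mul_le_mul_of_nonneg_right hprob (by positivity))))
  norm_cast
  refine Set.ncard_le_ncard (fun Ω hΩ hgood => hΩ fun k => ?_) (Set.toFinite _)
  refine (frobNorm_estimate_sub_le hn1 hn2 _ X).trans ((hgood k).trans ?_)
  have hρ : 0 ≤ (1 - 0.5 * η) ^ (k : ℕ) := pow_nonneg (by linarith) _
  have : 0 ≤ ε₀ * σ * (1 - 0.5 * η) ^ (k : ℕ) := by positivity
  linarith

end
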